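/- Let $\Omega$ be either an open subset of $\mathbb{R}^2$ with $C^1$ boundary (bounded or unbounded, possibly $\mathbb{R}^2$ itself) or the flat torus $\mathbb{T}^2=\mathbb{R}^2/\mathbb{Z}^2$, and let $d$ be the Euclidean distance in the first case and the geodesic distance in the second. For $p\in(2,\infty)$ let $L^p_{\rm ul}(\Omega)$ be the space of functions with $\sup_{x\in\Omega}\|f\|_{L^p(\Omega\cap B_1(x))}<\infty$, and let $L^\infty_{\rm ul}=L^\infty$. Let $k:\Omega\times\Omega\to\mathbb{R}^2$ be a measurable kernel such that, for constants $C_1,C_2>0$, $$|k(x,y)|\le \frac{C_1}{d(x,y)}\quad(x\neq y),\qquad |k(x,z)-k(y,z)|\le C_2\,\frac{d(x,y)}{d(x,z)\,d(y,z)}\quad(z\neq x,y),$$ and put $K\omega(x)=\int_\Omega k(x,z)\,\omega(z)\,dz$. Assume that for some $p\in(2,\infty]$ and $C_3>0$ and all $\omega\in L^1(\Omega)\cap L^p_{\rm ul}(\Omega)$ the distributional divergence of $K\omega$ satisfies $\|\operatorname{div}(K\omega)\|_{L^\infty}\le C_3\|\omega\|_{L^1}$, and that $\nu_\Omega\cdot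 K\omega=0$ on $\partial\Omega$, where $\nu_\Omega$ is the inner unit normal (no condition if $\partial\Omega=\emptyset$). Then for every $\omega_0\in L^1(\Omega)\cap L^\infty(\Omega)$ there is a pair $(\omega,v)$, defined for all times $t\in[0,\infty)$, such that: 1. $\omega\in L^\infty_{\rm loc}([0,\infty);L^1(\Omega)\cap L^\infty(\Omega))$, $v\in L^\infty_{\rm loc}([0,\infty);C_b(\Omega;\mathbb{R}^2))$, and $v(t,\cdot)=K\omega(t,\cdot)$ for every $t\ge0$. 2. For all $T>0$ and all $\varphi\in C^1_c([0,T]\times\Omega)$, $$\int_\Omega\varphi(T,x)\,\omega(T,x)\,dx-\int_\Omega\varphi(0,x)\,\omega_0(x)\,dx=\int_0^T\!\!\int_\Omega\omega\,(\partial_t\varphi+v\cdot\nabla\varphi)\,dx\,dt .$$ 3. There is a classical flow $X$ of $v$ in $\Omega$, that is, $X(t,\cdot):\Omega\to\Omega$ with $\frac{d}{dt}X(t,x)=v(t,X(t,x))$ and $X(0,x)=x$, such that $\omega(t,\cdot)=X(t,\cdot)_\#\omega_0$ for every $t\ge0$, i.e. $\int_\Omega\omega(t,x)\,\varphi(x)\,dx=\int_\Omega\omega_0(x)\,\varphi(X(t,x))\,dx$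 for all bounded Borel functions $\varphi$ on $\Omega$. 4. For all $T>0$, all $t\in[0,T]$ and all $x,y\in\Omega$, $$\|\omega(t,\cdot)\|_{L^1}\le\|\omega_0\|_{L^1},\qquad \|\omega(t,\cdot)\|_{L^\infty}\le e^{C_3T\|\omega_0\|_{L^1}}\,\|\omega_0\|_{L^\infty},$$ $$|v(t,x)|\le C\,e^{C_3T\|\omega_0\|_{L^1}}\big(\|\omega_0\|_{L^1}+\|\omega_0\|_{L^\infty}\big),$$ $$|v(t,x)-v(t,y)|\le C\,e^{C_3T\|\omega_0\|_{L^1}}\big(\|\omega_0\|_{L^1}+\|\omega_0\|_{L^\infty}\big)\,\ell(d(x,y)),$$ where $\ell(0)=0$, $\ell(r)=r(1-\log r)$ for $0<r\le1$, $\ell(r)=1$ for $r>1$, and the constant $C>0$ depends only on $C_1$ and $C_2$. -/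

import Mathlib

open MeasureTheory Set Filter Topology
open scoped ENNReal NNReal BoundedContinuousFunction

noncomputable section

namespace EulerVorticity

/-- The Euclidean plane. -/
abbrev Plane : Type := EuclideanSpace ℝ (Fin 2)

/-- `ρ` is a `C¹` function near the point `x₀` with `ρ x₀ = 0` and non-vanishing gradient there,
such that near `x₀` the set `Ω` is exactly `{ρ > 0}`. -/
def IsLocalDefiningFunction (Ω : Set Plane) (x₀ : Plane) (ρ : Plane → ℝ) : Prop :=
  ContDiffAt ℝ 1 ρ x₀ ∧ ρ x₀ = 0 ∧ gradient ρ x₀ ≠ 0 ∧ ∀ᶠ x in 𝓝 x₀, (x ∈ Ω ↔ 0 < ρ x)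

/-- `Ω` has boundary of class `C¹` (no condition if the boundary is empty). -/
def HasC1Boundary (Ω : Set Plane) : Prop :=
  ∀ x₀ ∈ frontier Ω, ∃ ρ : Plane → ℝ, IsLocalDefiningFunction Ω x₀ ρ

/-- `ν` is the inner unit normal of `Ω` at the boundary point `x₀`. -/
def IsInnerUnitNormal (Ω : Set Plane) (x₀ ν : Plane) : Prop :=
  ∃ ρ : Plane → ℝ, IsLocalDefiningFunction Ω x₀ ρ ∧ ν = ‖gradient ρ x₀‖⁻¹ • gradient ρ x₀

/-- The spatial domains of the Euler equations: an open subset of the plane with `C¹` boundary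
(bounded or not, possibly the whole plane), or the flat torus `ℝ² / ℤ²`. -/
inductive FluidDomain : Type
  | planar (Ω : Set Plane) (isOpen : IsOpen Ω) (regular : HasC1Boundary Ω) : FluidDomain
  | torus : FluidDomain

/-- The standard basis of the plane. -/
abbrev stdBasis : Module.Basis (Fin 2) ℝ Plane := (EuclideanSpace.basisFun (Fin 2) ℝ).toBasis

namespace FluidDomain

/-- The set of points of the plane that represent points of the domain: `Ω` itself in the planar
case; all of `ℝ²` in the case of the torus, whose points are classes modulo `ℤ²`. Accordingly,
functions on the torus are `ℤ²`-periodic functions on `ℝ²`. -/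
def carrier : FluidDomain → Set Plane
  | planar Ω _ _ => Ω
  | torus => univ

/-- The group of translations by which one divides: trivial in the planar case, `ℤ²` for the
torus. -/
def lattice : FluidDomain → AddSubgroup Plane
  | planar _ _ _ => ⊥
  | torus => (Submodule.span ℤ (range stdBasis)).toAddSubgroup

/-- A measurable set of representatives, one for each point of the domain: `Ω` in the planar case,
the unit square `[0,1)²` for the torus. -/
def cell : FluidDomain → Set Plane
  | planar Ω _ _ => Ω
  | torus => ZSpan.fundamentalDomain stdBasis

/-- Integration over the domain: Lebesgue measure on the set of representatives. -/
def measure (D : FluidDomain) : Measure Plane := volume.restrict D.cell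

/-- The natural distance of the domain: Euclidean in the planar case, geodesic for the torus,
that is, `inf {|x - y - l| : l ∈ ℤ²}`. -/
def distance (D : FluidDomain) (x y : Plane) : ℝ := Metric.infDist (x - y) (D.lattice : Set Plane)

/-- `f` descends to a function on the domain (no condition in the planar case). -/
def Periodic {α : Type} (D : FluidDomain) (f : Plane → α) : Prop :=
  ∀ x ∈ D.carrier, ∀ l ∈ D.lattice, f (x + l) = f x

/-- The norm of `L^p_ul`, the supremum of the `L^p` norms over the unit balls of the domain, with
`L^∞_ul = L^∞`. -/
def lpUlNorm (D : FluidDomain) (f : Plane → ℝ) (p : ℝ≥0∞) : ℝ≥0∞ :=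
  if p = ∞ then eLpNorm f ∞ D.measure
  else ⨆ x ∈ D.carrier, eLpNorm f p (D.measure.restrict {y | D.distance x y < 1})

/-- `f` belongs to `L¹ ∩ L^p_ul` of the domain. -/
structure InL1LpUl (D : FluidDomain) (p : ℝ≥0∞) (f : Plane → ℝ) : Prop where
  periodic : D.Periodic f
  memL1 : MemLp f 1 D.measure
  memLpUl : D.lpUlNorm f p < ∞

/-- The operator `K ω (x) = ∫ k(x,z) ω(z) dz`, the integral being over the domain. -/
def velocityOf (D : FluidDomain) (k : Plane → Plane → Plane) (ω : Plane → ℝ) (x : Plane) : Plane :=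
  ∫ z, ω z • k x z ∂D.measure

/-- `k` is a measurable kernel on the domain with values in the plane, such that
`|k(x,y)| ≤ C₁ / d(x,y)` for `x ≠ y`, and
`|k(x,z) - k(y,z)| ≤ C₂ d(x,y) / (d(x,z) d(y,z))` for `z ≠ x, y`. Points of the domain are equal
when their representatives differ by an element of the lattice. -/
structure KernelEstimates (D : FluidDomain) (k : Plane → Plane → Plane) (C₁ C₂ : ℝ) : Prop where
  measurable : Measurable ((D.carrier ×ˢ D.carrier).domRestrict (Function.uncurry k))
  periodic_left : ∀ y ∈ D.carrier, D.Periodic (fun x => k x y)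
  periodic_right : ∀ x ∈ D.carrier, D.Periodic (fun y => k x y)
  bound : ∀ x ∈ D.carrier, ∀ y ∈ D.carrier, x - y ∉ D.lattice → ‖k x y‖ ≤ C₁ / D.distance x y
  oscillation : ∀ x ∈ D.carrier, ∀ y ∈ D.carrier, ∀ z ∈ D.carrier,
    x - z ∉ D.lattice → y - z ∉ D.lattice →
      ‖k x z - k y z‖ ≤ C₂ * (D.distance x y / (D.distance x z * D.distance y z))

/-- A smooth compactly supported function on the domain. -/
structure IsTestFunction (D : FluidDomain) (ψ : Plane → ℝ) : Prop where
  smooth : ContDiff ℝ ((⊤ : ℕ∞) : WithTop ℕ∞) ψ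
  periodic : ∀ x, ∀ l ∈ D.lattice, ψ (x + l) = ψ x
  support : ∃ S : Set Plane, IsCompact S ∧ S ⊆ D.carrier ∧
    ∀ x, ψ x ≠ 0 → ∃ l ∈ D.lattice, x + l ∈ S

/-- The distributional divergence of the vector field `u` on the domain is the function `g`. -/
def HasDistribDiv (D : FluidDomain) (u : Plane → Plane) (g : Plane → ℝ) : Prop :=
  ∀ ψ : Plane → ℝ, D.IsTestFunction ψ →
    ∫ x, fderiv ℝ ψ x (u x) ∂D.measure = - ∫ x, g x * ψ x ∂D.measure

/-- For every `ω ∈ L¹ ∩ L^p_ul`, the distributional divergence of `K ω` is a bounded function with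
`‖div (K ω)‖_∞ ≤ C₃ ‖ω‖_{L¹}`, and (the continuous extension to the boundary of) `K ω` is
tangent to the boundary of the domain. The second condition is empty if there is no boundary. -/
structure BoundedDivNoFlow (D : FluidDomain) (k : Plane → Plane → Plane) (p : ℝ≥0∞) (C₃ : ℝ) :
    Prop where
  divergence : ∀ ω : Plane → ℝ, D.InL1LpUl p ω →
    ∃ g : Plane → ℝ, AEStronglyMeasurable g D.measure ∧
      eLpNorm g ∞ D.measure ≤ ENNReal.ofReal C₃ * eLpNorm ω 1 D.measure ∧
      D.HasDistribDiv (D.velocityOf k ω) g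
  no_flow : ∀ ω : Plane → ℝ, D.InL1LpUl p ω →
    ∀ x₀ ∈ frontier D.carrier, ∀ ν : Plane, IsInnerUnitNormal D.carrier x₀ ν →
      Tendsto (fun x => inner ℝ ν (D.velocityOf k ω x)) (𝓝[D.carrier] x₀) (𝓝 0)

/-- A `C¹` function of time and space whose support is compact in space. For every `T > 0` the
restrictions to `[0,T]` in time of these functions are the functions of class `C¹_c([0,T] × Ω)`;
they need not vanish at the times `0` and `T`. -/
structure IsSpaceTimeTestFunction (D : FluidDomain) (φ : ℝ × Plane → ℝ) : Prop where
  contDiff : ContDiff ℝ 1 φ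
  periodic : ∀ t x, ∀ l ∈ D.lattice, φ (t, x + l) = φ (t, x)
  support : ∃ S : Set Plane, IsCompact S ∧ S ⊆ D.carrier ∧
    ∀ t x, φ (t, x) ≠ 0 → ∃ l ∈ D.lattice, x + l ∈ S

/-- `(ω, v)` is a weak solution, with vorticity in `L¹ ∩ L^p_ul` and initial datum `ω₀`, of
`∂ₜω + div (v ω) = 0`, `v = K ω`. -/
structure IsWeakSolution (D : FluidDomain) (k : Plane → Plane → Plane) (p : ℝ≥0∞)
    (ω₀ : Plane → ℝ) (ω : ℝ → Plane → ℝ) (v : ℝ → Plane → Plane) : Prop where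
  measurable : AEStronglyMeasurable (Function.uncurry ω)
    ((volume.restrict (Ici (0 : ℝ))).prod D.measure)
  vorticity_mem : ∀ t : ℝ, 0 ≤ t → D.InL1LpUl p (ω t)
  vorticity_bound : ∀ T : ℝ, 0 < T → ∃ M : ℝ≥0, ∀ t ∈ Icc 0 T,
    eLpNorm (ω t) 1 D.measure ≤ M ∧ D.lpUlNorm (ω t) p ≤ M
  velocity_eq : ∀ t : ℝ, 0 ≤ t → ∀ x ∈ D.carrier, v t x = D.velocityOf k (ω t) x
  /-- `v` belongs to `L^∞_loc([0,∞); C_b(Ω; ℝ²))`. -/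
  velocity_mem : ∃ V : ℝ → (D.carrier →ᵇ Plane),
    (∀ t : ℝ, 0 ≤ t → ∀ x : D.carrier, V t x = v t x) ∧
    ∀ T : ℝ, 0 < T → MemLp V ∞ (volume.restrict (Icc 0 T))
  weak_form : ∀ T : ℝ, 0 < T → ∀ φ : ℝ × Plane → ℝ, D.IsSpaceTimeTestFunction φ →
    (∫ x, φ (T, x) * ω T x ∂D.measure) - ∫ x, φ (0, x) * ω₀ x ∂D.measure =
      ∫ t in (0 : ℝ)..T, ∫ x, ω t x *
        (deriv (fun s => φ (s, x)) t + fderiv ℝ (fun y => φ (t, y)) x (v t x)) ∂D.measure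

/-- `X` is a flow on the domain associated to the velocity field `v`, in the classical sense. In
the case of the torus, `X t` is given by a lift to the plane. -/
structure IsFlow (D : FluidDomain) (v : ℝ → Plane → Plane) (X : ℝ → Plane → Plane) : Prop where
  mem : ∀ t : ℝ, 0 ≤ t → ∀ x ∈ D.carrier, X t x ∈ D.carrier
  equivariant : ∀ t : ℝ, 0 ≤ t → ∀ x ∈ D.carrier, ∀ l ∈ D.lattice, X t (x + l) = X t x + l
  measurable : ∀ t : ℝ, 0 ≤ t → Measurable (D.carrier.domRestrict (X t))
  initial : ∀ x ∈ D.carrier, X 0 x = x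
  ode : ∀ x ∈ D.carrier, ∀ t : ℝ, 0 ≤ t →
    HasDerivWithinAt (fun s => X s x) (v t (X t x)) (Ici 0) t

/-- `ω₁` is the push-forward of `ω₀` under the map `Y`: the integrals of `ω₁ φ` and `ω₀ (φ ∘ Y)`
agree for all bounded Borel functions `φ` on the domain. -/
def IsPushForward (D : FluidDomain) (Y : Plane → Plane) (ω₀ ω₁ : Plane → ℝ) : Prop :=
  ∀ φ : Plane → ℝ, Measurable φ → D.Periodic φ → (∃ M : ℝ, ∀ x, |φ x| ≤ M) →
    ∫ x, ω₁ x * φ x ∂D.measure = ∫ x, ω₀ x * φ (Y x) ∂D.measure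

/-- A weak solution whose vorticity is transported by a flow of its velocity field. -/
def IsLagrangianWeakSolution (D : FluidDomain) (k : Plane → Plane → Plane) (p : ℝ≥0∞)
    (ω₀ : Plane → ℝ) (ω : ℝ → Plane → ℝ) (v : ℝ → Plane → Plane) : Prop :=
  D.IsWeakSolution k p ω₀ ω v ∧
    ∃ X : ℝ → Plane → Plane, D.IsFlow v X ∧ ∀ t : ℝ, 0 ≤ t → D.IsPushForward (X t) ω₀ (ω t)

end FluidDomain

/-- The log-Lipschitz modulus of continuity: `0` at `0`, `r (1 - log r)` for `0 < r ≤ 1`, and `1`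
for `r > 1`. -/
def logLipModulus (r : ℝ) : ℝ :=
  if r = 0 then 0 else if r ≤ 1 then r * (1 - Real.log r) else 1

end EulerVorticity

end

/-! The a priori bounds form a closed loop. A vorticity with `L¹` norm at most `A` and sup norm at
most `B` generates a velocity bounded by a multiple of `A + B` and log-Lipschitz with such a
constant. Its divergence is at most `C₃ A`, which involves only the `L¹` norm. A flow with
divergence at most `c = C₃ A` compresses areas by at most `exp (c t)`. So the transported vorticity
keeps its `L¹` norm, and its sup norm grows at most by that factor.

The loop is run on an explicit Euler scheme in Lagrangian form. At each step the particles move by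
`h` times a mollified velocity generated by the current vorticity. The Jacobian of a step is `1 + h
div b + O(h²)`, so the scheme compresses areas by at most `exp ((c + κ) t)` (`volume_euler_step_le`,
`IsEulerScheme.invariants`). Near the boundary the mollified field is not controlled, and particles
that come too close are discarded. They play no role in the limit: the velocity is tangent to the
boundary and log-Lipschitz, so the distance to the boundary obeys an Osgood inequality backward in
time. A particle starting at depth `δ` then keeps some depth `α > 0` up to time `T`
(`IsAdmissible.infDist_le`, `exists_osgoodPair`, `IsEulerScheme.survival`).

The same Osgood lemma makes the approximate flows equicontinuous in space. A subsequence therefore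
converges pointwise for all times and all points (`exists_tendsto_subseq`), and the compression
bound survives by Fatou's lemma, with rate exactly `c` (`IsLimitFlow.compressesBy`). Pointwise
convergence of flows with bounded compression gives weak convergence of the vorticities, even
against bounded Borel functions (`tendsto_integral_transport`). Away from its singularity the kernel
is such a function, and the singular part is uniformly small, so the velocities converge as well
(`KernelEstimates.tendsto_velocityOf`). The limit flow thus satisfies the integral equation. As the
velocity along a trajectory is continuous in time, the flow is classical, and the weak formulation
follows from the chain rule along trajectories.

On the torus everything is lifted to the plane. Integrals over the cell and over the plane are
related by summing over lattice translates (`lintegral_carrier`, `integral_carrier`), which treats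
both kinds of domain at once. -/

noncomputable section

namespace EulerVorticity
-- Representatives modulo the lattice and unfolding of integrals.
namespace FluidDomain

variable (D : FluidDomain)

lemma isOpen_carrier : IsOpen D.carrier := by
  cases D with
  | planar Ω h _ => exact h
  | torus => exact isOpen_univ

lemma measurableSet_carrier : MeasurableSet D.carrier := D.isOpen_carrier.measurableSet

instance countable_lattice : Countable D.lattice := by
  cases D with
  | planar Ω _ _ => exact inferInstanceAs (Countable (⊥ : AddSubgroup Plane))
  | torus => exact inferInstanceAs (Countable (Submodule.span ℤ (range stdBasis)))

lemma isClosed_lattice : IsClosed (D.lattice : Set Plane) := by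
  cases D with
  | planar Ω _ _ => simp [lattice]
  | torus =>
    exact AddSubgroup.isClosed_of_discrete (H := (Submodule.span ℤ (range stdBasis)).toAddSubgroup)

lemma finite_lattice_inter {s : Set Plane} (hs : Bornology.IsBounded s) :
    (s ∩ D.lattice).Finite := by
  cases D with
  | planar Ω _ _ =>
    exact (finite_singleton (0 : Plane)).subset fun x hx => by simpa [lattice] using hx.2
  | torus => exact ZSpan.setFinite_inter stdBasis hs

lemma add_mem_carrier {x l : Plane} (hx : x ∈ D.carrier) (hl : l ∈ D.lattice) :
    x + l ∈ D.carrier := by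
  cases D with
  | planar Ω _ _ =>
    have : l = 0 := by simpa [lattice] using hl
    simpa [this] using hx
  | torus => exact mem_univ _

lemma add_mem_carrier_iff {x l : Plane} (hl : l ∈ D.lattice) :
    x + l ∈ D.carrier ↔ x ∈ D.carrier :=
  ⟨fun h => by simpa using D.add_mem_carrier h (neg_mem hl), fun h => D.add_mem_carrier h hl⟩

lemma measurableSet_cell : MeasurableSet D.cell := by
  cases D with
  | planar Ω h _ => exact h.measurableSet
  | torus => exact ZSpan.fundamentalDomain_measurableSet stdBasis

lemma cell_subset_carrier : D.cell ⊆ D.carrier := by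
  cases D with
  | planar Ω h _ => exact Subset.rfl
  | torus => exact subset_univ _

/-- The representative of a point in the set of representatives. -/
def rep : FluidDomain → Plane → Plane
  | planar _ _ _ => id
  | torus => ZSpan.fract stdBasis

lemma measurable_rep : Measurable D.rep := by
  cases D with
  | planar Ω h _ => exact measurable_id
  | torus =>
    have h : FluidDomain.torus.rep = fun x : Plane => (MeasurableEquiv.toLp 2 (Fin 2 → ℝ))
        (fun i => Int.fract (x i)) := by
      funext x
      refine stdBasis.repr.injective (Finsupp.ext fun i => ?_)
      change stdBasis.repr (ZSpan.fract stdBasis x) i = _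
      rw [ZSpan.repr_fract_apply]
      simp [stdBasis]
    rw [h]
    refine (MeasurableEquiv.measurable _).comp (measurable_pi_lambda _ fun i => ?_)
    exact measurable_fract.comp (by fun_prop)

lemma rep_sub_mem (x : Plane) : D.rep x - x ∈ D.lattice := by
  cases D with
  | planar Ω h _ => simp [rep]
  | torus =>
    change ZSpan.fract stdBasis x - x ∈ Submodule.span ℤ (range stdBasis)
    rw [ZSpan.fract_apply, sub_sub_cancel_left]
    exact neg_mem (ZSpan.floor stdBasis x).2

lemma rep_mem_cell {x : Plane} (hx : x ∈ D.carrier) : D.rep x ∈ D.cell := by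
  cases D with
  | planar Ω h _ => exact hx
  | torus => exact ZSpan.fract_mem_fundamentalDomain stdBasis x

lemma rep_add (x : Plane) {l : Plane} (hl : l ∈ D.lattice) : D.rep (x + l) = D.rep x := by
  cases D with
  | planar Ω _ _ =>
    have : l = 0 := by simpa [lattice] using hl
    simp [this]
  | torus => exact ZSpan.fract_add_ZSpan stdBasis x hl

lemma rep_eq_self {x : Plane} (hx : x ∈ D.cell) : D.rep x = x := by
  cases D with
  | planar Ω h _ => rfl
  | torus => exact ZSpan.fract_eq_self.2 hx

lemma exists_rep_eq (x : Plane) : ∃ l ∈ D.lattice, D.rep x = x + l :=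
  ⟨D.rep x - x, D.rep_sub_mem x, by abel⟩

variable {D} in
lemma Periodic.rep {α : Type} {f : Plane → α} (hf : D.Periodic f) {x : Plane}
    (hx : x ∈ D.carrier) : f (D.rep x) = f x := by
  obtain ⟨l, hl, h⟩ := D.exists_rep_eq x
  rw [h, hf x hx l hl]

lemma carrier_eq_iUnion :
    D.carrier = ⋃ l : D.lattice, (fun x : Plane => x - l) ⁻¹' D.cell := by
  ext x
  simp only [mem_iUnion, mem_preimage]
  constructor
  · intro hx
    refine ⟨⟨-(D.rep x - x), neg_mem (D.rep_sub_mem x)⟩, ?_⟩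
    simpa using D.rep_mem_cell hx
  · rintro ⟨l, hl⟩
    have := D.add_mem_carrier (D.cell_subset_carrier hl) l.2
    simpa using this

lemma measurableSet_translate_cell (l : D.lattice) :
    MeasurableSet ((fun x : Plane => x - (l : Plane)) ⁻¹' D.cell) :=
  (measurable_sub_const _) D.measurableSet_cell

lemma pairwise_disjoint_translate_cell : Pairwise (Function.onFun Disjoint
    fun l : D.lattice => (fun x : Plane => x - (l : Plane)) ⁻¹' D.cell) := by
  intro l m hlm
  refine Set.disjoint_left.2 fun x hx hy => hlm ?_
  have e1 : D.rep (x - l) = x - l := D.rep_eq_self hx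
  have e2 : D.rep (x - m) = x - m := D.rep_eq_self hy
  rw [sub_eq_add_neg, D.rep_add _ (neg_mem l.2)] at e1
  rw [sub_eq_add_neg, D.rep_add _ (neg_mem m.2), e1] at e2
  exact Subtype.ext (by simpa using e2)

lemma image_translate_cell (l : Plane) :
    (fun x : Plane => x - l) '' ((fun x : Plane => x - l) ⁻¹' D.cell) = D.cell :=
  image_preimage_eq _ (MeasurableEquiv.subRight l).surjective

/-- Unfolding: an integral over the carrier is a sum of integrals over the cell. -/
lemma lintegral_carrier (F : Plane → ℝ≥0∞) :
    ∫⁻ x in D.carrier, F x = ∑' l : D.lattice, ∫⁻ x in D.cell, F (x + l) := by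
  rw [D.carrier_eq_iUnion, lintegral_iUnion D.measurableSet_translate_cell
    D.pairwise_disjoint_translate_cell]
  refine tsum_congr fun l => ?_
  have h3 := (measurePreserving_sub_right (volume : Measure Plane) (l : Plane))
  have := h3.setLIntegral_comp_emb (MeasurableEquiv.subRight (l : Plane)).measurableEmbedding
    (fun x => F (x + l)) ((fun x : Plane => x - (l : Plane)) ⁻¹' D.cell)
  simp only [sub_add_cancel] at this
  rw [this, image_translate_cell]

lemma integral_carrier {F : Plane → ℝ} (hF : IntegrableOn F D.carrier) :
    ∫ x in D.carrier, F x = ∫ x in D.cell, ∑' l : D.lattice, F (x + l) := by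
  have hme : ∀ l : D.lattice, MeasurableEmbedding (fun x : Plane => x - l) :=
    fun l => (MeasurableEquiv.subRight (l : Plane)).measurableEmbedding
  have hmp : ∀ l : D.lattice, MeasurePreserving (fun x : Plane => x - l) :=
    fun l => measurePreserving_sub_right (volume : Measure Plane) (l : Plane)
  rw [integral_tsum]
  · rw [D.carrier_eq_iUnion, integral_iUnion D.measurableSet_translate_cell
      D.pairwise_disjoint_translate_cell (by rwa [← D.carrier_eq_iUnion])]
    refine tsum_congr fun l => ?_
    have := (hmp l).setIntegral_image_emb (hme l) (fun x => F (x + l))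
      ((fun x : Plane => x - (l : Plane)) ⁻¹' D.cell)
    rw [image_translate_cell] at this
    simp only [this, sub_add_cancel]
  · intro l
    have h1 : AEStronglyMeasurable F (volume.restrict ((fun x : Plane => x - l) ⁻¹' D.cell)) :=
      hF.aestronglyMeasurable.mono_set (by
        rw [D.carrier_eq_iUnion]
        exact subset_iUnion (fun l : D.lattice => (fun x : Plane => x - (l : Plane)) ⁻¹' D.cell) l)
    have h2 := h1.comp_measurePreserving ((measurePreserving_add_right (volume : Measure Plane)
      (l : Plane)).restrict_preimage (D.measurableSet_translate_cell l))
    have h3 : (fun x : Plane => x + l) ⁻¹' ((fun x : Plane => x - l) ⁻¹' D.cell) = D.cell := by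
      ext x; simp
    rwa [h3] at h2
  · rw [← D.lintegral_carrier (fun x => ‖F x‖ₑ)]
    exact hF.2.ne

/-! ### The distance -/

lemma distance_eq (x y : Plane) : ∃ l ∈ D.lattice, D.distance x y = ‖x - y - l‖ := by
  obtain ⟨l, hl, h⟩ := D.isClosed_lattice.exists_infDist_eq_dist ⟨0, zero_mem _⟩ (x - y)
  exact ⟨l, hl, by rw [distance, h, dist_eq_norm]⟩

lemma distance_le (x y : Plane) {l : Plane} (hl : l ∈ D.lattice) :
    D.distance x y ≤ ‖x - y - l‖ := by
  rw [distance, ← dist_eq_norm]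
  exact Metric.infDist_le_dist_of_mem hl

lemma distance_le_norm (x y : Plane) : D.distance x y ≤ ‖x - y‖ := by
  simpa using D.distance_le x y (zero_mem _)

lemma distance_nonneg (x y : Plane) : 0 ≤ D.distance x y := Metric.infDist_nonneg

lemma distance_pos {x y : Plane} (h : x - y ∉ D.lattice) : 0 < D.distance x y :=
  (D.isClosed_lattice.notMem_iff_infDist_pos ⟨0, zero_mem _⟩).1 h

lemma distance_eq_zero {x y : Plane} (h : x - y ∈ D.lattice) : D.distance x y = 0 :=
  Metric.infDist_zero_of_mem h

lemma distance_comm (x y : Plane) : D.distance x y = D.distance y x := by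
  refine le_antisymm ?_ ?_
  · obtain ⟨l, hl, h⟩ := D.distance_eq y x
    rw [h, ← norm_neg]
    exact (D.distance_le x y (neg_mem hl)).trans_eq (congrArg norm (by abel))
  · obtain ⟨l, hl, h⟩ := D.distance_eq x y
    rw [h, ← norm_neg]
    exact (D.distance_le y x (neg_mem hl)).trans_eq (congrArg norm (by abel))

lemma distance_triangle (x y z : Plane) : D.distance x z ≤ D.distance x y + D.distance y z := by
  obtain ⟨l, hl, h⟩ := D.distance_eq x y
  obtain ⟨m, hm, h'⟩ := D.distance_eq y z
  rw [h, h']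
  refine (D.distance_le x z (add_mem hl hm)).trans ?_
  refine le_trans (le_of_eq ?_) (norm_add_le _ _)
  congr 1
  abel

lemma continuous_distance (x : Plane) : Continuous (D.distance x) := by
  unfold distance
  exact (Metric.continuous_infDist_pt _).comp (by fun_prop)

lemma distance_add_right (x y : Plane) {l : Plane} (hl : l ∈ D.lattice) :
    D.distance x (y + l) = D.distance x y := by
  refine le_antisymm ?_ ?_
  · obtain ⟨m, hm, h⟩ := D.distance_eq x y
    rw [h]
    exact (D.distance_le x (y + l) (sub_mem hm hl)).trans_eq (congrArg norm (by abel))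
  · obtain ⟨m, hm, h⟩ := D.distance_eq x (y + l)
    rw [h]
    exact (D.distance_le x y (add_mem hm hl)).trans_eq (congrArg norm (by abel))

end FluidDomain

/-! ### The modulus of continuity -/

/-- Truncating the argument at `1` removes the case distinction. Continuity is then that of
`Real.negMulLog`, and monotonicity only has to be checked on `[0, 1]`. -/
lemma logLipModulus_eq (r : ℝ) :
    logLipModulus r = min r 1 + Real.negMulLog (min r 1) := by
  unfold logLipModulus Real.negMulLog
  split_ifs with h1 h2
  · simp [h1]
  · rw [min_eq_left h2]; ring
  · rw [min_eq_right (not_le.1 h2).le]; simp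

lemma logLipModulus_of_le_one {r : ℝ} (_hr : r ≤ 1) :
    logLipModulus r = r * (1 - Real.log r) := by
  unfold logLipModulus
  split_ifs with h1 <;> simp [h1]

lemma logLipModulus_of_one_le {r : ℝ} (hr : 1 ≤ r) : logLipModulus r = 1 := by
  rw [logLipModulus_eq, min_eq_right hr]; simp

@[simp] lemma logLipModulus_zero : logLipModulus 0 = 0 := by simp [logLipModulus]

lemma le_logLipModulus {r : ℝ} (h0 : 0 ≤ r) (hr : r ≤ 1) : r ≤ logLipModulus r := by
  rw [logLipModulus_of_le_one hr]
  have := Real.log_nonpos h0 hr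
  nlinarith

lemma continuousOn_logLipModulus : ContinuousOn logLipModulus (Ici 0) := by
  have h : Continuous fun r : ℝ => min r 1 + Real.negMulLog (min r 1) := by fun_prop
  exact h.continuousOn.congr fun r _ => logLipModulus_eq r

lemma logLipModulus_mono {r s : ℝ} (h0 : 0 ≤ r) (hrs : r ≤ s) :
    logLipModulus r ≤ logLipModulus s := by
  rw [logLipModulus_eq r, logLipModulus_eq s]
  have hm : min r 1 ≤ min s 1 := min_le_min_right 1 hrs
  have h1 : min s 1 ≤ 1 := min_le_right _ _
  have h2 : 0 ≤ min r 1 := le_min h0 zero_le_one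
  generalize min r 1 = a at *
  generalize min s 1 = b at *
  rcases h2.eq_or_lt with rfl | ha
  · have := Real.negMulLog_nonneg hm h1
    simp; linarith
  · have hb : 0 < b := ha.trans_le hm
    -- For `0 < a ≤ b ≤ 1` the difference of the two sides is `(b - a) - a (log b - log a) - (b - a)
    -- log b`. The concavity bound on the logarithm makes the first two terms nonnegative together,
    -- and `log b ≤ 0` the last one.
    have h3 : Real.log (b / a) ≤ b / a - 1 := Real.log_le_sub_one_of_pos (by positivity)
    rw [Real.log_div hb.ne' ha.ne'] at h3
    have h4 := Real.log_nonpos hb.le h1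
    have h5 : a * (b / a - 1) = b - a := by field_simp
    have h6 : a * (Real.log b - Real.log a) ≤ b - a := by
      rw [← h5]; exact mul_le_mul_of_nonneg_left h3 ha.le
    unfold Real.negMulLog
    nlinarith

lemma logLipModulus_nonneg {r : ℝ} (h0 : 0 ≤ r) : 0 ≤ logLipModulus r := by
  simpa using logLipModulus_mono le_rfl h0

/-- Used near the boundary, where an Euler step and a mollification together can at most double the
distance to a boundary point. -/
lemma logLipModulus_two_mul_le {r : ℝ} (h0 : 0 ≤ r) :
    logLipModulus (2 * r) ≤ 2 * logLipModulus r := by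
  rcases le_total (2 * r) 1 with h | h
  · rw [logLipModulus_of_le_one h, logLipModulus_of_le_one (by linarith : r ≤ 1)]
    rcases h0.eq_or_lt with rfl | hr
    · simp
    have : Real.log r ≤ Real.log (2 * r) := Real.log_le_log hr (by linarith)
    nlinarith
  · have h1 : (1 : ℝ) / 2 ≤ logLipModulus r :=
      (le_logLipModulus (by norm_num) (by norm_num)).trans
        (logLipModulus_mono (by norm_num) (by linarith))
    rw [logLipModulus_of_one_le h]
    linarith

end EulerVorticity
end

noncomputable section

namespace EulerVorticity
/-! ### Radial integrals in the plane -/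

lemma lintegral_comp_norm {f : ℝ → ℝ≥0∞} (hf : Measurable f) :
    ∫⁻ w : Plane, f ‖w‖ = ENNReal.ofReal (2 * Real.pi) *
      ∫⁻ r in Ioi (0 : ℝ), ENNReal.ofReal r * f r := by
  -- An isometry with `ℂ` gives access to polar coordinates; the angle contributes the factor `2π`.
  have h1 : ∫⁻ w : Plane, f ‖w‖ = ∫⁻ z : ℂ, f ‖z‖ := by
    rw [← (Complex.orthonormalBasisOneI.measurePreserving_repr).lintegral_comp (by fun_prop)]
    simp
  rw [h1, ← Complex.lintegral_comp_polarCoord_symm]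
  have h2 : ∀ p ∈ polarCoord.target, ENNReal.ofReal p.1 • f ‖Complex.polarCoord.symm p‖ =
      ENNReal.ofReal p.1 * f p.1 := by
    intro p hp
    have : 0 < p.1 := by simpa [polarCoord] using hp.1
    rw [Complex.norm_polarCoord_symm, abs_of_pos this, smul_eq_mul]
  rw [setLIntegral_congr_fun polarCoord.open_target.measurableSet h2, polarCoord_target,
    Measure.volume_eq_prod, ← Measure.prod_restrict, lintegral_prod _ (by fun_prop)]
  simp only [lintegral_const, MeasurableSet.univ, Measure.restrict_apply, univ_inter,
    Real.volume_Ioo, sub_neg_eq_add]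
  rw [lintegral_mul_const _ (by fun_prop), mul_comm, two_mul]

/-- The radial function `1 / r` on `(0, R)`. -/
def invBelow (R r : ℝ) : ℝ≥0∞ := (Iio R).indicator (fun s => ENNReal.ofReal s⁻¹) r

/-- The radial function `1 / r²` on `[s, 1)`. -/
def invSqBetween (s r : ℝ) : ℝ≥0∞ := (Ico s 1).indicator (fun t => ENNReal.ofReal (t⁻¹ ^ 2)) r

@[fun_prop] lemma measurable_invBelow (R : ℝ) : Measurable (invBelow R) :=
  Measurable.indicator (by fun_prop) measurableSet_Iio

@[fun_prop] lemma measurable_invSqBetween (s : ℝ) : Measurable (invSqBetween s) :=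
  Measurable.indicator (by fun_prop) measurableSet_Ico

/-- The area element `r dr` cancels the singularity `1 / r`; the constant `8` is an upper bound for
`2π`. -/
lemma lintegral_invBelow_le {R : ℝ} (_hR : 0 ≤ R) :
    ∫⁻ w : Plane, invBelow R ‖w‖ ≤ ENNReal.ofReal (8 * R) := by
  rw [lintegral_comp_norm (measurable_invBelow R)]
  have h : ∫⁻ r in Ioi (0 : ℝ), ENNReal.ofReal r * invBelow R r ≤ ENNReal.ofReal R := by
    calc ∫⁻ r in Ioi (0 : ℝ), ENNReal.ofReal r * invBelow R r
        ≤ ∫⁻ r in Ioi (0 : ℝ), (Ioo 0 R).indicator (fun _ => 1) r := by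
          refine setLIntegral_mono' measurableSet_Ioi fun r hr => ?_
          have hr : 0 < r := hr
          unfold invBelow
          by_cases h : r < R
          · rw [indicator_of_mem (by exact h), indicator_of_mem (by exact ⟨hr, h⟩),
              ← ENNReal.ofReal_mul hr.le, mul_inv_cancel₀ hr.ne', ENNReal.ofReal_one]
          · rw [indicator_of_notMem (by exact h)]; simp
      _ ≤ ∫⁻ r, (Ioo 0 R).indicator (fun _ => 1) r := setLIntegral_le_lintegral _ _
      _ = ENNReal.ofReal R := by
          rw [lintegral_indicator measurableSet_Ioo]; simp
  calc _ ≤ ENNReal.ofReal 8 * ENNReal.ofReal R := by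
        gcongr; linarith [Real.pi_le_four]
    _ = _ := by rw [← ENNReal.ofReal_mul (by norm_num)]

/-- Here the area element leaves `∫ dr / r = -log s`. This is the origin of the logarithm in the
modulus of continuity of the velocity. -/
lemma lintegral_invSqBetween_le {s : ℝ} (hs : 0 < s) (hs1 : s ≤ 1) :
    ∫⁻ w : Plane, invSqBetween s ‖w‖ ≤ ENNReal.ofReal (8 * (-Real.log s)) := by
  rw [lintegral_comp_norm (measurable_invSqBetween s)]
  have h : ∫⁻ r in Ioi (0 : ℝ), ENNReal.ofReal r * invSqBetween s r ≤
      ENNReal.ofReal (-Real.log s) := by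
    calc ∫⁻ r in Ioi (0 : ℝ), ENNReal.ofReal r * invSqBetween s r
        ≤ ∫⁻ r in Ioi (0 : ℝ), (Icc s 1).indicator (fun r => ENNReal.ofReal r⁻¹) r := by
          refine setLIntegral_mono' measurableSet_Ioi fun r hr => ?_
          have hr : 0 < r := hr
          unfold invSqBetween
          by_cases h : r ∈ Ico s 1
          · rw [indicator_of_mem h, indicator_of_mem (Ico_subset_Icc_self h),
              ← ENNReal.ofReal_mul hr.le]
            apply le_of_eq; congr 1; field_simp
          · rw [indicator_of_notMem h]; simp
      _ ≤ ∫⁻ r, (Icc s 1).indicator (fun r => ENNReal.ofReal r⁻¹) r :=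
          setLIntegral_le_lintegral _ _
      _ = ∫⁻ r in Icc s 1, ENNReal.ofReal r⁻¹ := lintegral_indicator measurableSet_Icc _
      _ = ENNReal.ofReal (∫ r in Icc s 1, r⁻¹) := by
          rw [ofReal_integral_eq_lintegral_ofReal]
          · refine ContinuousOn.integrableOn_Icc (continuousOn_inv₀.mono fun r hr => ?_)
            exact (hs.trans_le hr.1).ne'
          · filter_upwards [ae_restrict_mem measurableSet_Icc] with r hr
            exact inv_nonneg.2 (hs.le.trans hr.1)
      _ = _ := by
          rw [integral_Icc_eq_integral_Ioc, ← intervalIntegral.integral_of_le hs1,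
            integral_inv_of_pos hs one_pos, one_div, Real.log_inv]
  calc _ ≤ ENNReal.ofReal 8 * ENNReal.ofReal (-Real.log s) := by
        gcongr; linarith [Real.pi_le_four]
    _ = _ := by rw [← ENNReal.ofReal_mul (by norm_num)]

/-! ### Size and modulus of continuity of the velocity. -/

namespace FluidDomain

variable {D : FluidDomain}

/-- The distance is attained at some lattice vector, so the integrand is at most the sum of `f ‖x -
z - l‖` over all `l`, and this sum unfolds to an integral over the plane. No constant depending on
the domain is lost. -/
lemma lintegral_comp_distance_le (x : Plane) {f : ℝ → ℝ≥0∞} (hf : Measurable f) :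
    ∫⁻ z, f (D.distance x z) ∂D.measure ≤ ∫⁻ w : Plane, f ‖w‖ := by
  calc ∫⁻ z, f (D.distance x z) ∂D.measure
      ≤ ∫⁻ z, ∑' l : D.lattice, f ‖x - (z + l)‖ ∂D.measure := by
        refine lintegral_mono fun z => ?_
        obtain ⟨l, hl, h⟩ := D.distance_eq x z
        simp only [h, ← sub_sub]
        exact ENNReal.le_tsum (f := fun l : D.lattice => f ‖x - z - l‖) ⟨l, hl⟩
    _ = ∑' l : D.lattice, ∫⁻ z in D.cell, f ‖x - (z + l)‖ :=
        lintegral_tsum fun l => by fun_prop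
    _ = ∫⁻ z in D.carrier, f ‖x - z‖ := (D.lintegral_carrier (fun z => f ‖x - z‖)).symm
    _ ≤ ∫⁻ z, f ‖x - z‖ := setLIntegral_le_lintegral _ _
    _ = ∫⁻ w : Plane, f ‖w‖ := lintegral_sub_left_eq_self (fun w => f ‖w‖) x

/-- Periodic vorticities with `L¹` norm at most `A` and `L^∞` norm at most `B`. -/
structure IsVorticity (D : FluidDomain) (A B : ℝ) (ω : Plane → ℝ) : Prop where
  periodic : D.Periodic ω
  aestronglyMeasurable : AEStronglyMeasurable ω D.measure
  l1 : ∫⁻ z, ‖ω z‖ₑ ∂D.measure ≤ ENNReal.ofReal A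
  sup : ∀ᵐ z ∂D.measure, |ω z| ≤ B

lemma ae_mem_cell : ∀ᵐ z ∂D.measure, z ∈ D.cell := ae_restrict_mem D.measurableSet_cell

lemma ae_mem_carrier : ∀ᵐ z ∂D.measure, z ∈ D.carrier :=
  ae_mem_cell.mono fun _ h => D.cell_subset_carrier h

lemma ae_sub_notMem_lattice (x : Plane) : ∀ᵐ z ∂D.measure, x - z ∉ D.lattice := by
  refine ae_restrict_of_ae ?_
  have : {z | x - z ∈ D.lattice} = (fun l => x - l) '' (D.lattice : Set Plane) := by
    ext z
    simp only [mem_ofPred_eq, mem_image, SetLike.mem_coe]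
    exact ⟨fun h => ⟨_, h, by abel⟩, fun ⟨l, hl, h⟩ => by simpa [← h] using hl⟩
  have hc : (D.lattice : Set Plane).Countable :=
    countable_coe_iff.1 (inferInstanceAs (Countable D.lattice))
  simpa [ae_iff, this] using (hc.image (fun l => x - l)).measure_zero volume

section Estimates

variable {k : Plane → Plane → Plane} {C₁ C₂ A B : ℝ} {ω : Plane → ℝ}

lemma KernelEstimates.measurable_indicator (hk : D.KernelEstimates k C₁ C₂) {x : Plane}
    (hx : x ∈ D.carrier) : Measurable (D.carrier.indicator (k x)) := by
  refine measurable_of_restrict_of_restrict_compl D.measurableSet_carrier ?_ ?_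
  · have h : Measurable fun z : D.carrier =>
        (⟨(x, (z : Plane)), hx, z.2⟩ : (D.carrier ×ˢ D.carrier : Set (Plane × Plane))) :=
      Measurable.subtype_mk (by fun_prop)
    have h2 := hk.measurable.comp h
    convert h2 using 1
    funext z
    simp
  · convert! measurable_const (a := (0 : Plane)) using 1
    funext z
    exact indicator_of_notMem z.2 _

lemma KernelEstimates.aestronglyMeasurable (hk : D.KernelEstimates k C₁ C₂) {x : Plane}
    (hx : x ∈ D.carrier) : AEStronglyMeasurable (k x) D.measure := by
  refine (hk.measurable_indicator hx).aestronglyMeasurable.congr ?_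
  filter_upwards [ae_mem_carrier] with z hz
  rw [indicator_of_mem hz]

lemma KernelEstimates.ae_bound (hk : D.KernelEstimates k C₁ C₂) {x : Plane}
    (hx : x ∈ D.carrier) : ∀ᵐ z ∂D.measure, 0 < D.distance x z ∧
      ‖k x z‖ ≤ C₁ * (D.distance x z)⁻¹ := by
  filter_upwards [ae_mem_carrier, ae_sub_notMem_lattice x] with z hz hxz
  exact ⟨D.distance_pos hxz, by simpa [div_eq_mul_inv] using hk.bound x hx z hz hxz⟩

lemma measurableSet_distance_lt (x : Plane) (r : ℝ) : MeasurableSet {z | D.distance x z < r} :=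
  measurableSet_lt (D.continuous_distance x).measurable measurable_const

lemma measurableSet_le_distance (x : Plane) (r : ℝ) : MeasurableSet {z | r ≤ D.distance x z} :=
  measurableSet_le measurable_const (D.continuous_distance x).measurable

/-- Close to the singularity the sup norm of the vorticity is used, `1 / d` being integrable in the
plane. -/
lemma KernelEstimates.lintegral_near_le (hk : D.KernelEstimates k C₁ C₂) (hC₁ : 0 ≤ C₁)
    (hB : 0 ≤ B) (hω : D.IsVorticity A B ω) {x : Plane} (hx : x ∈ D.carrier) {r : ℝ}
    (hr : 0 ≤ r) :
    ∫⁻ z in {z | D.distance x z < r}, ‖ω z • k x z‖ₑ ∂D.measure ≤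
      ENNReal.ofReal (8 * C₁ * B * r) := by
  calc ∫⁻ z in {z | D.distance x z < r}, ‖ω z • k x z‖ₑ ∂D.measure
      ≤ ∫⁻ z in {z | D.distance x z < r},
          ENNReal.ofReal (B * C₁) * invBelow r (D.distance x z) ∂D.measure := by
        refine lintegral_mono_ae ?_
        filter_upwards [ae_restrict_mem (measurableSet_distance_lt x r),
          ae_restrict_of_ae (hk.ae_bound hx), ae_restrict_of_ae hω.sup] with z hz hkz hωz
        rw [invBelow, indicator_of_mem (by exact hz), ← ENNReal.ofReal_mul (by positivity),
          ← ofReal_norm, norm_smul, Real.norm_eq_abs]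
        refine ENNReal.ofReal_le_ofReal ?_
        rw [mul_assoc]
        exact mul_le_mul hωz hkz.2 (norm_nonneg _) hB
    _ ≤ ∫⁻ z, ENNReal.ofReal (B * C₁) * invBelow r (D.distance x z) ∂D.measure :=
        setLIntegral_le_lintegral _ _
    _ = ENNReal.ofReal (B * C₁) * ∫⁻ z, invBelow r (D.distance x z) ∂D.measure :=
        lintegral_const_mul _ ((measurable_invBelow r).comp (D.continuous_distance x).measurable)
    _ ≤ ENNReal.ofReal (B * C₁) * ENNReal.ofReal (8 * r) := by
        gcongr
        exact (lintegral_comp_distance_le x (measurable_invBelow r)).trans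
          (lintegral_invBelow_le hr)
    _ = _ := by
        rw [← ENNReal.ofReal_mul (by positivity)]; congr 1; ring

/-- Far from the singularity the kernel is at most `C₁ / r`, and the `L¹` norm of the vorticity
suffices. -/
lemma KernelEstimates.lintegral_far_le (hk : D.KernelEstimates k C₁ C₂) (hC₁ : 0 ≤ C₁)
    (hω : D.IsVorticity A B ω) {x : Plane} (hx : x ∈ D.carrier) {r : ℝ} (hr : 0 < r) :
    ∫⁻ z in {z | r ≤ D.distance x z}, ‖ω z • k x z‖ₑ ∂D.measure ≤
      ENNReal.ofReal (C₁ * A / r) := by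
  calc ∫⁻ z in {z | r ≤ D.distance x z}, ‖ω z • k x z‖ₑ ∂D.measure
      ≤ ∫⁻ z in {z | r ≤ D.distance x z}, ENNReal.ofReal (C₁ / r) * ‖ω z‖ₑ ∂D.measure := by
        refine lintegral_mono_ae ?_
        filter_upwards [ae_restrict_mem (measurableSet_le_distance x r),
          ae_restrict_of_ae (hk.ae_bound hx)] with z hz hkz
        rw [← ofReal_norm, ← ofReal_norm, ← ENNReal.ofReal_mul (by positivity),
          norm_smul, mul_comm]
        refine ENNReal.ofReal_le_ofReal (mul_le_mul_of_nonneg_right ?_ (norm_nonneg _))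
        rw [div_eq_mul_inv]
        refine hkz.2.trans (mul_le_mul_of_nonneg_left ?_ hC₁)
        exact inv_anti₀ hr hz
    _ ≤ ∫⁻ z, ENNReal.ofReal (C₁ / r) * ‖ω z‖ₑ ∂D.measure := setLIntegral_le_lintegral _ _
    _ = ENNReal.ofReal (C₁ / r) * ∫⁻ z, ‖ω z‖ₑ ∂D.measure :=
        lintegral_const_mul'' _ hω.aestronglyMeasurable.enorm
    _ ≤ ENNReal.ofReal (C₁ / r) * ENNReal.ofReal A := by gcongr; exact hω.l1
    _ = _ := by
        rw [← ENNReal.ofReal_mul (by positivity)]; congr 1; ring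

lemma KernelEstimates.lintegral_le (hk : D.KernelEstimates k C₁ C₂) (hC₁ : 0 ≤ C₁)
    (hA : 0 ≤ A) (hB : 0 ≤ B) (hω : D.IsVorticity A B ω) {x : Plane} (hx : x ∈ D.carrier) {r : ℝ}
    (hr : 0 < r) :
    ∫⁻ z, ‖ω z • k x z‖ₑ ∂D.measure ≤ ENNReal.ofReal (C₁ * (8 * B * r + A / r)) := by
  rw [← lintegral_add_compl _ (measurableSet_distance_lt x r)]
  have h : {z | D.distance x z < r}ᶜ = {z | r ≤ D.distance x z} := by ext z; simp
  rw [h]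
  refine (add_le_add (hk.lintegral_near_le hC₁ hB hω hx hr.le)
    (hk.lintegral_far_le hC₁ hω hx hr)).trans ?_
  rw [← ENNReal.ofReal_add (by positivity) (by positivity)]
  apply le_of_eq; congr 1; ring

lemma KernelEstimates.integrable (hk : D.KernelEstimates k C₁ C₂) (hC₁ : 0 ≤ C₁)
    (hA : 0 ≤ A) (hB : 0 ≤ B) (hω : D.IsVorticity A B ω) {x : Plane} (hx : x ∈ D.carrier) :
    Integrable (fun z => ω z • k x z) D.measure :=
  ⟨hω.aestronglyMeasurable.smul (hk.aestronglyMeasurable hx),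
    (hk.lintegral_le hC₁ hA hB hω hx one_pos).trans_lt ENNReal.ofReal_lt_top⟩

lemma norm_integral_le_of_lintegral {α : Type*} [MeasurableSpace α] {μ : Measure α}
    {f : α → Plane} {c : ℝ} (hc : 0 ≤ c) (h : ∫⁻ z, ‖f z‖ₑ ∂μ ≤ ENNReal.ofReal c) :
    ‖∫ z, f z ∂μ‖ ≤ c := by
  rw [← ENNReal.ofReal_le_ofReal_iff hc, ofReal_norm]
  exact (enorm_integral_le_lintegral_enorm f).trans h

lemma KernelEstimates.norm_velocityOf_le (hk : D.KernelEstimates k C₁ C₂) (hC₁ : 0 ≤ C₁)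
    (hA : 0 ≤ A) (hB : 0 ≤ B) (hω : D.IsVorticity A B ω) {x : Plane} (hx : x ∈ D.carrier) {r : ℝ}
    (hr : 0 < r) :
    ‖D.velocityOf k ω x‖ ≤ C₁ * (8 * B * r + A / r) :=
  norm_integral_le_of_lintegral (by positivity) (hk.lintegral_le hC₁ hA hB hω hx hr)

lemma KernelEstimates.velocityOf_periodic (hk : D.KernelEstimates k C₁ C₂) {x l : Plane}
    (hx : x ∈ D.carrier) (hl : l ∈ D.lattice) :
    D.velocityOf k ω (x + l) = D.velocityOf k ω x := by
  refine integral_congr_ae ?_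
  filter_upwards [ae_mem_carrier] with z hz
  exact congrArg (ω z • ·) (hk.periodic_left z hz x hx l hl)

/-- The constant in the estimates of the velocity. -/
def velocityConst (C₁ C₂ : ℝ) : ℝ := 40 * C₁ + 16 * C₂

lemma KernelEstimates.norm_velocityOf_le_const (hk : D.KernelEstimates k C₁ C₂) (hC₁ : 0 ≤ C₁)
    (hC₂ : 0 ≤ C₂) (hA : 0 ≤ A) (hB : 0 ≤ B) (hω : D.IsVorticity A B ω) {x : Plane}
    (hx : x ∈ D.carrier) :
    ‖D.velocityOf k ω x‖ ≤ velocityConst C₁ C₂ * (A + B) := by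
  refine (hk.norm_velocityOf_le hC₁ hA hB hω hx one_pos).trans ?_
  unfold velocityConst
  have := mul_nonneg hC₁ hA; have := mul_nonneg hC₁ hB
  have := mul_nonneg hC₂ hA; have := mul_nonneg hC₂ hB
  nlinarith

/-- If `d(x,z) ≥ 2 d(x,y)`, then `d(y,z) ≥ d(x,z) / 2`, and the oscillation of the kernel is at most
`2 C₂ d(x,y) / d(x,z)²`. For `d(x,z) < 1` this is integrated against the sup norm and produces the
logarithm; for `d(x,z) ≥ 1` it is integrated against the `L¹` norm. -/
lemma KernelEstimates.lintegral_sub_far_le (hk : D.KernelEstimates k C₁ C₂) (hC₂ : 0 ≤ C₂)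
    (hA : 0 ≤ A) (hB : 0 ≤ B) (hω : D.IsVorticity A B ω) {x y : Plane} (hx : x ∈ D.carrier)
    (hy : y ∈ D.carrier) (hr : 0 < D.distance x y) (hr2 : D.distance x y < 1 / 2) :
    ∫⁻ z in {z | 2 * D.distance x y ≤ D.distance x z}, ‖ω z • k x z - ω z • k y z‖ₑ ∂D.measure ≤
      ENNReal.ofReal (16 * C₂ * (A + B) * (D.distance x y * (1 - Real.log (D.distance x y)))) := by
  set r := D.distance x y with hrdef
  have hlog : Real.log r ≤ Real.log (2 * r) := Real.log_le_log hr (by linarith)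
  have hlog2 : Real.log (2 * r) ≤ 0 := Real.log_nonpos (by linarith) (by linarith)
  calc ∫⁻ z in {z | 2 * r ≤ D.distance x z}, ‖ω z • k x z - ω z • k y z‖ₑ ∂D.measure
      ≤ ∫⁻ z in {z | 2 * r ≤ D.distance x z},
          (ENNReal.ofReal (2 * C₂ * r * B) * invSqBetween (2 * r) (D.distance x z) +
            ENNReal.ofReal (2 * C₂ * r) * ‖ω z‖ₑ) ∂D.measure := by
        refine lintegral_mono_ae ?_
        filter_upwards [ae_restrict_mem (measurableSet_le_distance x (2 * r)),
          ae_restrict_of_ae (ae_sub_notMem_lattice x),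
          ae_restrict_of_ae (ae_sub_notMem_lattice y),
          ae_restrict_of_ae hω.sup, ae_restrict_of_ae ae_mem_carrier] with z hz h1 h2 hωz hzc
        have hz : 2 * r ≤ D.distance x z := hz
        have hosc := hk.oscillation x hx y hy z hzc h1 h2
        have ht := D.distance_triangle x y z
        rw [← hrdef] at hosc ht
        set d := D.distance x z
        have hd : 0 < d := by linarith
        have hdy : d / 2 ≤ D.distance y z := by linarith
        have hker : ‖k x z - k y z‖ ≤ 2 * C₂ * r * d⁻¹ ^ 2 := by
          refine hosc.trans ?_
          calc C₂ * (r / (d * D.distance y z)) ≤ C₂ * (r / (d * (d / 2))) := by gcongr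
            _ = _ := by field_simp
        rw [← smul_sub, ← ofReal_norm, norm_smul, Real.norm_eq_abs]
        by_cases hd1 : d < 1
        · refine le_trans ?_ le_self_add
          rw [invSqBetween, indicator_of_mem (by exact ⟨hz, hd1⟩),
            ← ENNReal.ofReal_mul (by positivity)]
          refine ENNReal.ofReal_le_ofReal ?_
          calc |ω z| * ‖k x z - k y z‖ ≤ B * (2 * C₂ * r * d⁻¹ ^ 2) := by gcongr
            _ = _ := by ring
        · refine le_trans ?_ le_add_self
          rw [← ofReal_norm, ← ENNReal.ofReal_mul (by positivity), Real.norm_eq_abs,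
            mul_comm]
          refine ENNReal.ofReal_le_ofReal ?_
          have : d⁻¹ ^ 2 ≤ 1 := pow_le_one₀ (by positivity) (inv_le_one_of_one_le₀ (not_lt.1 hd1))
          gcongr
          refine hker.trans ?_
          have : 0 ≤ 2 * C₂ * r := by positivity
          nlinarith
    _ ≤ ∫⁻ z, (ENNReal.ofReal (2 * C₂ * r * B) * invSqBetween (2 * r) (D.distance x z) +
            ENNReal.ofReal (2 * C₂ * r) * ‖ω z‖ₑ) ∂D.measure := setLIntegral_le_lintegral _ _
    _ = ENNReal.ofReal (2 * C₂ * r * B) * ∫⁻ z, invSqBetween (2 * r) (D.distance x z) ∂D.measure +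
            ENNReal.ofReal (2 * C₂ * r) * ∫⁻ z, ‖ω z‖ₑ ∂D.measure := by
        have hm : Measurable fun z => invSqBetween (2 * r) (D.distance x z) :=
          (measurable_invSqBetween _).comp (D.continuous_distance x).measurable
        rw [lintegral_add_left (hm.const_mul _), lintegral_const_mul _ hm,
          lintegral_const_mul'' _ hω.aestronglyMeasurable.enorm]
    _ ≤ ENNReal.ofReal (2 * C₂ * r * B) * ENNReal.ofReal (8 * (-Real.log (2 * r))) +
            ENNReal.ofReal (2 * C₂ * r) * ENNReal.ofReal A := by
        gcongr
        · exact (lintegral_comp_distance_le x (measurable_invSqBetween _)).trans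
            (lintegral_invSqBetween_le (by linarith) (by linarith))
        · exact hω.l1
    _ ≤ _ := by
        rw [← ENNReal.ofReal_mul (by positivity), ← ENNReal.ofReal_mul (by positivity),
          ← ENNReal.ofReal_add (mul_nonneg (by positivity) (by linarith)) (by positivity)]
        refine ENNReal.ofReal_le_ofReal ?_
        have h1 : 0 ≤ C₂ * r * B := by positivity
        have h2 : 0 ≤ C₂ * r * A := by positivity
        -- The slack in the claim, written as a sum of two terms that are nonnegative because `log r
        -- ≤ log (2 r) ≤ 0`.
        have e : 16 * C₂ * (A + B) * (r * (1 - Real.log r)) -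
            (2 * C₂ * r * B * (8 * (-Real.log (2 * r)))
            + 2 * C₂ * r * A) = 16 * (C₂ * r * B) * (1 + (Real.log (2 * r) - Real.log r)) +
              (C₂ * r * A) * (14 + 16 * (-Real.log r)) := by ring
        have h3 : 0 ≤ 16 * (C₂ * r * B) * (1 + (Real.log (2 * r) - Real.log r)) :=
          mul_nonneg (by positivity) (by linarith)
        have h4 : 0 ≤ (C₂ * r * A) * (14 + 16 * (-Real.log r)) :=
          mul_nonneg h2 (by linarith)
        linarith

/-- At distance at least `1 / 2` the modulus is at least `1 / 2`, and the sup bounds at the two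
points are enough. At smaller distance `r` the integral is split at `d(x,z) = 2 r`. The near region
lies in the ball of radius `3 r` about `y`, so the two kernels contribute `8 C₁ B (2 r + 3 r) = 40
C₁ B r` there; the far region contributes the multiple `16 C₂`. These are the two terms of
`velocityConst`. -/
lemma KernelEstimates.norm_velocityOf_sub_le (hk : D.KernelEstimates k C₁ C₂) (hC₁ : 0 ≤ C₁)
    (hC₂ : 0 ≤ C₂) (hA : 0 ≤ A) (hB : 0 ≤ B) (hω : D.IsVorticity A B ω) {x y : Plane}
    (hx : x ∈ D.carrier) (hy : y ∈ D.carrier) :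
    ‖D.velocityOf k ω x - D.velocityOf k ω y‖ ≤
      velocityConst C₁ C₂ * (A + B) * logLipModulus (D.distance x y) := by
  by_cases hxy : x - y ∈ D.lattice
  · have : D.velocityOf k ω x = D.velocityOf k ω y := by
      simpa using hk.velocityOf_periodic (ω := ω) hy hxy
    simp [this, D.distance_eq_zero hxy]
  have hr := D.distance_pos hxy
  have h11 := mul_nonneg hC₁ hA; have h12 := mul_nonneg hC₁ hB
  have h21 := mul_nonneg hC₂ hA; have h22 := mul_nonneg hC₂ hB
  rcases le_or_gt (1 / 2) (D.distance x y) with h | h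
  · have h1 : (1 : ℝ) / 2 ≤ logLipModulus (D.distance x y) :=
      (le_logLipModulus (by norm_num) (by norm_num)).trans
        (logLipModulus_mono (by norm_num) h)
    have hx1 := hk.norm_velocityOf_le hC₁ hA hB hω hx one_pos
    have hy1 := hk.norm_velocityOf_le hC₁ hA hB hω hy one_pos
    have hC : 0 ≤ velocityConst C₁ C₂ * (A + B) := by unfold velocityConst; positivity
    calc _ ≤ ‖D.velocityOf k ω x‖ + ‖D.velocityOf k ω y‖ := norm_sub_le _ _
      _ ≤ velocityConst C₁ C₂ * (A + B) * (1 / 2) := by unfold velocityConst; nlinarith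
      _ ≤ _ := by gcongr
  · have hlog : Real.log (D.distance x y) ≤ 0 := Real.log_nonpos hr.le (by linarith)
    have hfar := hk.lintegral_sub_far_le hC₂ hA hB hω hx hy hr h
    rw [logLipModulus_of_le_one (by linarith)]
    set r := D.distance x y with hrdef
    have hnx := hk.lintegral_near_le hC₁ hB hω hx (r := 2 * r) (by positivity)
    have hny := hk.lintegral_near_le hC₁ hB hω hy (r := 3 * r) (by positivity)
    have hq : 0 ≤ r * (1 - Real.log r) := mul_nonneg hr.le (by linarith)
    have hcomp : {z | D.distance x z < 2 * r}ᶜ = {z | 2 * r ≤ D.distance x z} := by ext z; simp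
    have e : D.velocityOf k ω x - D.velocityOf k ω y =
        ∫ z, (ω z • k x z - ω z • k y z) ∂D.measure :=
      (integral_sub (hk.integrable hC₁ hA hB hω hx) (hk.integrable hC₁ hA hB hω hy)).symm
    rw [e]
    refine norm_integral_le_of_lintegral (by unfold velocityConst; positivity) ?_
    rw [← lintegral_add_compl _ (measurableSet_distance_lt x (2 * r)), hcomp]
    have hnear : ∫⁻ z in {z | D.distance x z < 2 * r}, ‖ω z • k x z - ω z • k y z‖ₑ ∂D.measure ≤
        ENNReal.ofReal (8 * C₁ * B * (2 * r)) + ENNReal.ofReal (8 * C₁ * B * (3 * r)) := by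
      calc _ ≤ ∫⁻ z in {z | D.distance x z < 2 * r}, (‖ω z • k x z‖ₑ + ‖ω z • k y z‖ₑ)
            ∂D.measure := lintegral_mono fun z => enorm_sub_le
        _ = ∫⁻ z in {z | D.distance x z < 2 * r}, ‖ω z • k x z‖ₑ ∂D.measure +
            ∫⁻ z in {z | D.distance x z < 2 * r}, ‖ω z • k y z‖ₑ ∂D.measure :=
          lintegral_add_left'
            (hk.integrable hC₁ hA hB hω hx).aestronglyMeasurable.enorm.restrict _
        _ ≤ _ := by
          refine add_le_add hnx ((lintegral_mono_set fun z hz => ?_).trans hny)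
          have hz : D.distance x z < 2 * r := hz
          have := D.distance_triangle y x z
          rw [D.distance_comm y x, ← hrdef] at this
          change D.distance y z < 3 * r
          linarith
    refine (add_le_add hnear hfar).trans ?_
    rw [← ENNReal.ofReal_add (by positivity) (by positivity),
      ← ENNReal.ofReal_add (by positivity) (by positivity)]
    refine ENNReal.ofReal_le_ofReal ?_
    unfold velocityConst
    have h1 : C₁ * B * r ≤ C₁ * B * (r * (1 - Real.log r)) :=
      mul_le_mul_of_nonneg_left (by nlinarith) h12
    have h2 : 0 ≤ C₁ * A * (r * (1 - Real.log r)) := by positivity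
    nlinarith

end Estimates

end FluidDomain

end EulerVorticity
end

/-! ### Periodization: from the divergence on the domain to test functions on the plane. -/

noncomputable section

namespace EulerVorticity
namespace FluidDomain

variable {D : FluidDomain}

lemma measurable_fderiv_apply {ψ : Plane → ℝ} (hψ : ContDiff ℝ 1 ψ) {u : Plane → Plane}
    (hu : Measurable u) : Measurable fun y => fderiv ℝ ψ y (u y) := by
  have h : Continuous fun p : (Plane →L[ℝ] ℝ) × Plane => p.1 p.2 :=
    isBoundedBilinearMap_apply.continuous
  exact h.measurable.comp ((hψ.continuous_fderiv one_ne_zero).measurable.prodMk hu)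

lemma integrable_fderiv_apply {ψ : Plane → ℝ} (hψ : ContDiff ℝ 1 ψ) (hψc : HasCompactSupport ψ)
    {u : Plane → Plane} (hu : Measurable u) {M : ℝ} (hM : ∀ x, ‖u x‖ ≤ M) :
    Integrable fun y => fderiv ℝ ψ y (u y) := by
  have h1 : Integrable fun y => ‖fderiv ℝ ψ y‖ * M :=
    (((hψ.continuous_fderiv one_ne_zero).norm.integrable_of_hasCompactSupport
      (hψc.fderiv ℝ).norm)).mul_const M
  refine h1.mono' (measurable_fderiv_apply hψ hu).aestronglyMeasurable (ae_of_all _ fun y => ?_)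
  exact (ContinuousLinearMap.le_opNorm _ _).trans
    (mul_le_mul_of_nonneg_left (hM y) (norm_nonneg _))

/-- The sum of all lattice translates of a function. -/
def periodize (D : FluidDomain) (ψ : Plane → ℝ) (y : Plane) : ℝ := ∑' l : D.lattice, ψ (y + l)

/-- Local finiteness: near a given point only finitely many translates of the support are met.
Locally the periodization is a finite sum, so smoothness and derivatives can be taken term by term.
-/
lemma exists_finset_periodize {ψ : Plane → ℝ} (hψc : HasCompactSupport ψ) (y₀ : Plane) :
    ∃ T : Finset D.lattice, ∀ y ∈ Metric.ball y₀ 1, ∀ l : D.lattice, l ∉ T →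
      y + l ∉ tsupport ψ := by
  obtain ⟨R, hR⟩ := hψc.isBounded.subset_closedBall 0
  have hfin : ((Metric.closedBall (0 : Plane) (R + ‖y₀‖ + 1)) ∩ D.lattice).Finite :=
    D.finite_lattice_inter Metric.isBounded_closedBall
  have hfin' :
      {l : D.lattice | (l : Plane) ∈ Metric.closedBall (0 : Plane) (R + ‖y₀‖ + 1)}.Finite :=
    Set.Finite.of_finite_image (f := Subtype.val)
      (hfin.subset (by rintro _ ⟨l, hl, rfl⟩; exact ⟨hl, l.2⟩)) Subtype.val_injective.injOn
  refine ⟨hfin'.toFinset, fun y hy l hl hmem => hl ?_⟩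
  have h1 := hR hmem
  simp only [Finite.mem_toFinset, mem_ofPred_eq, Metric.mem_closedBall,
    Metric.mem_ball, dist_eq_norm, sub_zero] at *
  have : (l : Plane) = (y + l) - (y - y₀) - y₀ := by abel
  calc ‖(l : Plane)‖ = ‖(y + l) - (y - y₀) - y₀‖ := congrArg norm this
    _ ≤ ‖(y + l) - (y - y₀)‖ + ‖y₀‖ := norm_sub_le _ _
    _ ≤ ‖y + l‖ + ‖y - y₀‖ + ‖y₀‖ := by gcongr; exact norm_sub_le _ _
    _ ≤ _ := by linarith

lemma periodize_eventuallyEq {ψ : Plane → ℝ} {y₀ : Plane} {T : Finset D.lattice}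
    (hT : ∀ y ∈ Metric.ball y₀ 1, ∀ l : D.lattice, l ∉ T → y + l ∉ tsupport ψ) :
    D.periodize ψ =ᶠ[𝓝 y₀] fun y => ∑ l ∈ T, ψ (y + l) := by
  filter_upwards [Metric.ball_mem_nhds y₀ one_pos] with y hy
  exact tsum_eq_sum fun l hl => image_eq_zero_of_notMem_tsupport (hT y hy l hl)

lemma contDiff_periodize {ψ : Plane → ℝ} {n : WithTop ℕ∞} (hψ : ContDiff ℝ n ψ)
    (hψc : HasCompactSupport ψ) : ContDiff ℝ n (D.periodize ψ) := by
  refine contDiff_iff_contDiffAt.2 fun y₀ => ?_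
  obtain ⟨T, hT⟩ := exists_finset_periodize (D := D) hψc y₀
  refine ContDiffAt.congr_of_eventuallyEq ?_ (periodize_eventuallyEq hT)
  exact (ContDiff.sum fun l _ => hψ.comp (contDiff_id.add contDiff_const)).contDiffAt

lemma fderiv_periodize {ψ : Plane → ℝ} (hψ : ContDiff ℝ 1 ψ)
    (hψc : HasCompactSupport ψ) (y w : Plane) :
    fderiv ℝ (D.periodize ψ) y w = ∑' l : D.lattice, fderiv ℝ ψ (y + l) w := by
  obtain ⟨T, hT⟩ := exists_finset_periodize (D := D) hψc y
  have h1 : ∀ l ∈ T, HasFDerivAt (fun y => ψ (y + (l : Plane))) (fderiv ℝ ψ (y + l)) y :=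
  fun l _ => by
      have h := ((hψ.differentiable one_ne_zero) (y + l)).hasFDerivAt.comp y
        ((hasFDerivAt_id y).add_const (l : Plane))
      rw [ContinuousLinearMap.comp_id] at h
      exact h
  rw [(periodize_eventuallyEq hT).fderiv_eq, (HasFDerivAt.fun_sum h1).fderiv,
    sum_apply, tsum_eq_sum]
  intro l hl
  have h2 : fderiv ℝ ψ (y + l) = 0 := by
    refine image_eq_zero_of_notMem_tsupport fun h => ?_
    exact hT y (Metric.mem_ball_self one_pos) l hl (tsupport_fderiv_subset ℝ h)
  rw [h2]; rfl

lemma isTestFunction_periodize {ψ : Plane → ℝ} (hψ : ContDiff ℝ ((⊤ : ℕ∞) : WithTop ℕ∞) ψ)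
    (hψc : HasCompactSupport ψ) (hψs : tsupport ψ ⊆ D.carrier) :
    D.IsTestFunction (D.periodize ψ) where
  smooth := contDiff_periodize hψ hψc
  periodic x l hl := by
    unfold periodize
    rw [← (Equiv.addLeft (⟨l, hl⟩ : D.lattice)).tsum_eq (fun m : D.lattice => ψ (x + m))]
    simp [add_assoc]
  support := by
    refine ⟨tsupport ψ, hψc, hψs, fun x hx => ?_⟩
    by_contra h
    push Not at h
    refine hx ?_
    unfold periodize
    have : ∀ l : D.lattice, ψ (x + l) = 0 :=
      fun l => image_eq_zero_of_notMem_tsupport (h l l.2)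
    simp [this]

/-- A bound of the distributional divergence on the domain gives the same bound for test functions
with compact support in the carrier. -/
lemma enorm_integral_fderiv_le {g : Plane → ℝ} {w : Plane → Plane} {c : ℝ≥0∞}
    (hdiv : D.HasDistribDiv w g) (hg : eLpNorm g ∞ D.measure ≤ c) {M : ℝ}
    (hw : Measurable (D.carrier.indicator w)) (hM : ∀ x, ‖D.carrier.indicator w x‖ ≤ M)
    (hper : ∀ x ∈ D.carrier, ∀ l ∈ D.lattice, w (x + l) = w x)
    {ψ : Plane → ℝ} (hψ : ContDiff ℝ ((⊤ : ℕ∞) : WithTop ℕ∞) ψ)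
    (hψc : HasCompactSupport ψ) (hψs : tsupport ψ ⊆ D.carrier) :
    ‖∫ y, fderiv ℝ ψ y (D.carrier.indicator w y)‖ₑ ≤ c * ∫⁻ y, ‖ψ y‖ₑ := by
  have hψ1 : ContDiff ℝ 1 ψ := hψ.of_le (by exact_mod_cast le_top)
  have hF := integrable_fderiv_apply hψ1 hψc hw hM
  have e1 : ∫ y, fderiv ℝ ψ y (D.carrier.indicator w y) =
      ∫ y in D.carrier, fderiv ℝ ψ y (D.carrier.indicator w y) := by
    refine (setIntegral_eq_integral_of_forall_compl_eq_zero fun y hy => ?_).symm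
    rw [indicator_of_notMem hy, map_zero]
  -- As the field is periodic, unfolding collects the derivatives of all translates of `ψ` into the
  -- derivative of the periodization, which is an admissible test function on the domain. The bound
  -- on `g` is unfolded back in the same way below.
  have e2 : ∫ y in D.carrier, fderiv ℝ ψ y (D.carrier.indicator w y) =
      ∫ y, fderiv ℝ (D.periodize ψ) y (w y) ∂D.measure := by
    rw [D.integral_carrier hF.integrableOn]
    refine integral_congr_ae ?_
    filter_upwards [ae_mem_carrier] with y hy
    rw [fderiv_periodize hψ1 hψc]
    refine tsum_congr fun l => ?_
    rw [indicator_of_mem (D.add_mem_carrier hy l.2), hper y hy l l.2]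
  rw [e1, e2, hdiv _ (isTestFunction_periodize hψ hψc hψs), enorm_neg]
  calc _ ≤ ∫⁻ y, ‖g y * D.periodize ψ y‖ₑ ∂D.measure := enorm_integral_le_lintegral_enorm _
    _ ≤ ∫⁻ y, c * ∑' l : D.lattice, ‖ψ (y + l)‖ₑ ∂D.measure := by
        refine lintegral_mono_ae ?_
        have := enorm_ae_le_eLpNormEssSup g D.measure
        rw [← eLpNorm_exponent_top] at this
        filter_upwards [this] with y hy
        rw [enorm_mul]
        gcongr
        · exact hy.trans hg
        · exact enorm_tsum_le_tsum_enorm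
    _ = c * ∑' l : D.lattice, ∫⁻ y in D.cell, ‖ψ (y + l)‖ₑ := by
        have hm : ∀ l : D.lattice, Measurable fun y : Plane => ‖ψ (y + l)‖ₑ := fun l =>
          (hψ1.continuous.comp (by fun_prop)).measurable.enorm
        rw [lintegral_const_mul _ (Measurable.tsum hm),
          lintegral_tsum fun l => (hm l).aemeasurable]
        rfl
    _ = c * ∫⁻ y in D.carrier, ‖ψ y‖ₑ := by rw [D.lintegral_carrier (fun y => ‖ψ y‖ₑ)]
    _ ≤ _ := mul_le_mul_right (setLIntegral_le_lintegral _ _) _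

end FluidDomain

end EulerVorticity
end

/-! ### Mollification of bounded vector fields. -/

noncomputable section

namespace EulerVorticity
/-- A smooth probability density supported in the ball of radius `ε`. -/
structure IsMollifier (ε : ℝ) (ρ : Plane → ℝ) : Prop where
  smooth : ContDiff ℝ ((⊤ : ℕ∞) : WithTop ℕ∞) ρ
  compact : HasCompactSupport ρ
  nonneg : ∀ y, 0 ≤ ρ y
  integral : ∫ y, ρ y = 1
  tsupport_subset : tsupport ρ ⊆ Metric.closedBall 0 ε

lemma exists_isMollifier {ε : ℝ} (hε : 0 < ε) : ∃ ρ, IsMollifier ε ρ := by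
  let φ : ContDiffBump (0 : Plane) := ⟨ε / 2, ε, by positivity, by linarith⟩
  exact ⟨φ.normed volume, φ.contDiff_normed, φ.hasCompactSupport_normed, φ.nonneg_normed,
    φ.integral_normed, φ.tsupport_normed_eq.subset⟩

/-- The convolution of a vector field with a mollifier. -/
def mollify (ρ : Plane → ℝ) (u : Plane → Plane) (x : Plane) : Plane := ∫ y, ρ y • u (x - y)

lemma mollify_eq_convolution (ρ : Plane → ℝ) (u : Plane → Plane) :
    mollify ρ u = convolution ρ u (ContinuousLinearMap.lsmul ℝ ℝ) volume := rfl

section Mollify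

variable {ε M : ℝ} {ρ : Plane → ℝ} {u : Plane → Plane}

lemma IsMollifier.norm_le (hρ : IsMollifier ε ρ) {y : Plane} (hy : ρ y ≠ 0) : ‖y‖ ≤ ε := by
  simpa using hρ.tsupport_subset (subset_tsupport ρ hy)

lemma IsMollifier.contDiff_one (hρ : IsMollifier ε ρ) : ContDiff ℝ 1 ρ :=
  hρ.smooth.of_le (by exact_mod_cast le_top)

lemma IsMollifier.integrable (hρ : IsMollifier ε ρ) : Integrable ρ :=
  hρ.smooth.continuous.integrable_of_hasCompactSupport hρ.compact

lemma IsMollifier.integrable_smul (hρ : IsMollifier ε ρ) (hu : Measurable u)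
    (hM : ∀ x, ‖u x‖ ≤ M) (x : Plane) : Integrable fun y => ρ y • u (x - y) := by
  refine (hρ.integrable.norm.mul_const M).mono' (hρ.smooth.continuous.aestronglyMeasurable.smul
    (hu.comp (measurable_const.sub measurable_id)).aestronglyMeasurable) (ae_of_all _ fun y => ?_)
  rw [norm_smul]
  exact mul_le_mul_of_nonneg_left (hM _) (norm_nonneg _)

/-- If a linear functional of `u` is at most `c` near `x`, it is for the mollification too. -/
lemma IsMollifier.inner_mollify_le (hρ : IsMollifier ε ρ) (hu : Measurable u)
    (hM : ∀ x, ‖u x‖ ≤ M) {n x : Plane} {c : ℝ}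
    (h : ∀ y, ‖y‖ ≤ ε → inner ℝ n (u (x - y)) ≤ c) : inner ℝ n (mollify ρ u x) ≤ c := by
  have hi := hρ.integrable_smul hu hM x
  unfold mollify
  rw [← integral_inner hi]
  calc ∫ y, inner ℝ n (ρ y • u (x - y)) ≤ ∫ y, ρ y * c := by
        refine integral_mono (hi.const_inner n) (hρ.integrable.mul_const c) fun y => ?_
        simp only [inner_smul_right]
        by_cases hy : ρ y = 0
        · simp [hy]
        · exact mul_le_mul_of_nonneg_left (h y (hρ.norm_le hy)) (hρ.nonneg y)
    _ = c := by rw [integral_mul_const, hρ.integral, one_mul]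

/-- The two averages have the same weights, so their difference is an average of differences. Two
different fields are allowed in order to compare with a constant field, which mollification leaves
unchanged; this gives the bounds on the mollification and on the mollification error. -/
lemma IsMollifier.norm_mollify_sub_le (hρ : IsMollifier ε ρ) (hu : Measurable u)
    (hM : ∀ x, ‖u x‖ ≤ M) {w : Plane → Plane} (hw : Measurable w) (hMw : ∀ x, ‖w x‖ ≤ M)
    {x x' : Plane} {c : ℝ}
    (h : ∀ y, ‖y‖ ≤ ε → ‖u (x - y) - w (x' - y)‖ ≤ c) :
    ‖mollify ρ u x - mollify ρ w x'‖ ≤ c := by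
  unfold mollify
  rw [← integral_sub (hρ.integrable_smul hu hM x) (hρ.integrable_smul hw hMw x')]
  calc _ ≤ ∫ y, ρ y * c := by
        refine norm_integral_le_of_norm_le (hρ.integrable.mul_const c) (ae_of_all _ fun y => ?_)
        rw [← smul_sub, norm_smul, Real.norm_of_nonneg (hρ.nonneg y)]
        by_cases hy : ρ y = 0
        · simp [hy]
        · exact mul_le_mul_of_nonneg_left (h y (hρ.norm_le hy)) (hρ.nonneg y)
    _ = c := by rw [integral_mul_const, hρ.integral, one_mul]

lemma IsMollifier.mollify_const (hρ : IsMollifier ε ρ) (c x : Plane) :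
    mollify ρ (fun _ => c) x = c := by
  unfold mollify
  rw [integral_smul_const, hρ.integral, one_smul]

lemma IsMollifier.norm_mollify_le (hρ : IsMollifier ε ρ) (hu : Measurable u)
    (hM : ∀ x, ‖u x‖ ≤ M) (x : Plane) : ‖mollify ρ u x‖ ≤ M := by
  have h := hρ.norm_mollify_sub_le hu hM (w := fun _ => 0) measurable_const
    (fun x => by simpa using (norm_nonneg _).trans (hM x)) (x := x) (x' := x) (c := M)
    (fun y _ => by simpa using hM _)
  rwa [hρ.mollify_const, sub_zero] at h

lemma IsMollifier.norm_mollify_sub_self_le (hρ : IsMollifier ε ρ) (hu : Measurable u)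
    (hM : ∀ x, ‖u x‖ ≤ M) {x : Plane} {c : ℝ} (h : ∀ y, ‖y‖ ≤ ε → ‖u (x - y) - u x‖ ≤ c) :
    ‖mollify ρ u x - u x‖ ≤ c := by
  have h := hρ.norm_mollify_sub_le hu hM (w := fun _ => u x) measurable_const
    (fun _ => hM x) (x := x) (x' := x) (c := c) h
  rwa [hρ.mollify_const] at h

lemma mollify_add_of_periodic {l : Plane} (h : ∀ x, u (x + l) = u x) (x : Plane) :
    mollify ρ u (x + l) = mollify ρ u x := by
  unfold mollify
  refine integral_congr_ae (ae_of_all _ fun y => ?_)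
  simp only [← h (x - y), sub_add_eq_add_sub]

lemma locallyIntegrable_of_bound (hu : Measurable u) (hM : ∀ x, ‖u x‖ ≤ M) :
    LocallyIntegrable u :=
  (locallyIntegrable_const M).mono hu.aestronglyMeasurable
    (ae_of_all _ fun x => (hM x).trans (le_abs_self M))

lemma IsMollifier.contDiff_mollify (hρ : IsMollifier ε ρ) (hu : Measurable u)
    (hM : ∀ x, ‖u x‖ ≤ M) : ContDiff ℝ 1 (mollify ρ u) := by
  rw [mollify_eq_convolution]
  exact hρ.compact.contDiff_convolution_left (n := 1) _ hρ.contDiff_one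
    (locallyIntegrable_of_bound hu hM)

lemma IsMollifier.fderiv_mollify_apply (hρ : IsMollifier ε ρ) (hu : Measurable u)
    (hM : ∀ x, ‖u x‖ ≤ M) (x e : Plane) :
    fderiv ℝ (mollify ρ u) x e = ∫ y, fderiv ℝ ρ y e • u (x - y) := by
  have h := (hρ.compact.hasFDerivAt_convolution_left (ContinuousLinearMap.lsmul ℝ ℝ)
    hρ.contDiff_one (locallyIntegrable_of_bound hu hM) x).fderiv
  rw [mollify_eq_convolution, h, convolution_def, ContinuousLinearMap.integral_apply]
  · rfl
  · have := (hρ.compact.fderiv ℝ).convolutionExists_left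
      ((ContinuousLinearMap.lsmul ℝ ℝ : ℝ →L[ℝ] Plane →L[ℝ] Plane).precompL Plane)
      (hρ.contDiff_one.continuous_fderiv one_ne_zero) (locallyIntegrable_of_bound hu hM) x
    exact this

/-- The integral of the norm of the gradient of a mollifier. -/
def gradientMass (ρ : Plane → ℝ) : ℝ := ∫ y, ‖fderiv ℝ ρ y‖

lemma gradientMass_nonneg (ρ : Plane → ℝ) : 0 ≤ gradientMass ρ :=
  integral_nonneg fun _ => norm_nonneg _

lemma IsMollifier.norm_fderiv_mollify_le (hρ : IsMollifier ε ρ) (hu : Measurable u)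
    (hM : ∀ x, ‖u x‖ ≤ M) (x : Plane) : ‖fderiv ℝ (mollify ρ u) x‖ ≤ gradientMass ρ * M := by
  have hM0 : 0 ≤ M := (norm_nonneg _).trans (hM 0)
  refine ContinuousLinearMap.opNorm_le_bound _ (mul_nonneg (gradientMass_nonneg ρ) hM0)
    fun e => ?_
  rw [hρ.fderiv_mollify_apply hu hM]
  have hi : Integrable fun y => ‖fderiv ℝ ρ y‖ :=
    (hρ.contDiff_one.continuous_fderiv one_ne_zero).norm.integrable_of_hasCompactSupport
      (hρ.compact.fderiv ℝ).norm
  calc _ ≤ ∫ y, ‖fderiv ℝ ρ y‖ * (M * ‖e‖) := by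
        refine norm_integral_le_of_norm_le (hi.mul_const _) (ae_of_all _ fun y => ?_)
        rw [norm_smul, mul_comm M, ← mul_assoc]
        exact mul_le_mul (ContinuousLinearMap.le_opNorm _ _) (hM _) (norm_nonneg _) (by positivity)
    _ = _ := by rw [integral_mul_const, gradientMass]; ring

/-- The vectors of the standard basis of the plane. -/
abbrev stdVec (i : Fin 2) : Plane := EuclideanSpace.single i 1

lemma eq_sum_stdVec (w : Plane) : w = w 0 • stdVec 0 + w 1 • stdVec 1 := by
  ext i
  fin_cases i <;> simp

/-- The divergence of a vector field. -/
def divergence (b : Plane → Plane) (x : Plane) : ℝ :=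
  fderiv ℝ b x (stdVec 0) 0 + fderiv ℝ b x (stdVec 1) 1

/-- Moving the derivative onto the mollifier turns the divergence at `x` into the weak divergence of
`u` tested with `ρ (x - ·)`. A bound on the distributional divergence thus becomes a pointwise one.
-/
lemma IsMollifier.divergence_mollify (hρ : IsMollifier ε ρ) (hu : Measurable u)
    (hM : ∀ x, ‖u x‖ ≤ M) (x : Plane) :
    divergence (mollify ρ u) x = - ∫ y, fderiv ℝ (fun z => ρ (x - z)) y (u y) := by
  have hi : ∀ i, Integrable fun y => fderiv ℝ ρ y (stdVec i) • u (x - y) := by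
    intro i
    have h1 : Integrable fun y => ‖fderiv ℝ ρ y (stdVec i)‖ * M := by
      refine (Integrable.norm ?_).mul_const M
      exact ((hρ.contDiff_one.continuous_fderiv one_ne_zero).clm_apply
        continuous_const).integrable_of_hasCompactSupport
        ((hρ.compact.fderiv ℝ).mono fun y hy hy' => hy (by simp [hy']))
    refine h1.mono' ?_ (ae_of_all _ fun y => ?_)
    · exact ((hρ.contDiff_one.continuous_fderiv one_ne_zero).clm_apply
        continuous_const).aestronglyMeasurable.smul
        (hu.comp (measurable_const.sub measurable_id)).aestronglyMeasurable
    · rw [norm_smul]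
      exact mul_le_mul_of_nonneg_left (hM _) (norm_nonneg _)
  have hp : ∀ i, (∫ y, fderiv ℝ ρ y (stdVec i) • u (x - y)) i =
      ∫ y, fderiv ℝ ρ y (stdVec i) * u (x - y) i := by
    intro i
    have := (EuclideanSpace.proj (𝕜 := ℝ) i).integral_comp_comm (hi i)
    exact this.symm
  have hip : ∀ i, Integrable fun y => fderiv ℝ ρ y (stdVec i) * u (x - y) i := fun i =>
    (EuclideanSpace.proj (𝕜 := ℝ) i).integrable_comp (hi i)
  unfold divergence
  rw [hρ.fderiv_mollify_apply hu hM, hρ.fderiv_mollify_apply hu hM, hp, hp,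
    ← integral_add (hip 0) (hip 1), ← integral_neg,
    ← integral_sub_left_eq_self _ volume x]
  refine integral_congr_ae (ae_of_all _ fun y => ?_)
  have h1 : HasFDerivAt (fun z => ρ (x - z)) (-(fderiv ℝ ρ (x - y))) y := by
    have h := ((hρ.contDiff_one.differentiable one_ne_zero) (x - y)).hasFDerivAt.comp y
      ((hasFDerivAt_id y).const_sub x)
    rw [ContinuousLinearMap.comp_neg, ContinuousLinearMap.comp_id] at h
    exact h
  simp only [h1.fderiv, sub_sub_cancel]
  conv_rhs => rw [eq_sum_stdVec (u y)]
  simp [mul_comm]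

end Mollify

/-! ### Explicit Euler steps -/

/-- In dimension two `det (1 + h A) = 1 + h tr A + h² det A`, and `|det A| ≤ 2 L²` because every
entry is at most `L`. -/
lemma det_id_add_smul_ge {A : Plane →L[ℝ] Plane} {h c L : ℝ} (hh : 0 ≤ h)
    (hL : ‖A‖ ≤ L) (htr : |A (stdVec 0) 0 + A (stdVec 1) 1| ≤ c) :
    1 - h * c - 2 * (h * L) ^ 2 ≤ |(ContinuousLinearMap.id ℝ Plane + h • A).det| := by
  have hent : ∀ i j, |A (stdVec j) i| ≤ L := fun i j => by
    have h1 : ‖A (stdVec j) i‖ ≤ ‖A (stdVec j)‖ := PiLp.norm_apply_le _ _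
    have h2 := A.le_opNorm (stdVec j)
    have h3 : ‖stdVec j‖ = 1 := by simp
    rw [h3, mul_one] at h2
    exact h1.trans (h2.trans hL)
  have hdet : (ContinuousLinearMap.id ℝ Plane + h • A).det =
      (1 + h * A (stdVec 0) 0) * (1 + h * A (stdVec 1) 1) -
        (h * A (stdVec 1) 0) * (h * A (stdVec 0) 1) := by
    rw [ContinuousLinearMap.det, ← LinearMap.det_toMatrix stdBasis, Matrix.det_fin_two]
    simp [LinearMap.toMatrix_apply, stdBasis]
  rw [hdet]
  refine le_trans ?_ (le_abs_self _)
  have h1 := abs_le.1 htr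
  have hL0 : 0 ≤ L := (norm_nonneg _).trans hL
  have hp : ∀ i j i' j', |A (stdVec j) i * A (stdVec j') i'| ≤ L ^ 2 := fun i j i' j' => by
    rw [abs_mul, sq]
    exact mul_le_mul (hent _ _) (hent _ _) (abs_nonneg _) hL0
  have h2 := abs_le.1 (hp 0 0 1 1)
  have h3 := abs_le.1 (hp 0 1 1 0)
  have h4 : h * (-c) ≤ h * (A (stdVec 0) 0 + A (stdVec 1) 1) :=
    mul_le_mul_of_nonneg_left h1.1 hh
  nlinarith [sq_nonneg h, mul_le_mul_of_nonneg_left h2.1 (sq_nonneg h),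
    mul_le_mul_of_nonneg_left h3.2 (sq_nonneg h)]

/-- The compression bound for an explicit Euler step. -/
lemma volume_euler_step_le {b : Plane → Plane} {h c L : ℝ} (hb : ContDiff ℝ 1 b)
    (hL : ∀ x, ‖fderiv ℝ b x‖ ≤ L) (hh : 0 ≤ h) (hhL : h * L < 1) {S : Set Plane}
    (hS : MeasurableSet S) (hdiv : ∀ x ∈ S, |divergence b x| ≤ c)
    {E : Set Plane} (hE : MeasurableSet E) :
    ENNReal.ofReal (1 - h * c - 2 * (h * L) ^ 2) *
      volume (S ∩ (fun x => x + h • b x) ⁻¹' E) ≤ volume E := by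
  have hd : ∀ x, HasFDerivAt (fun x => x + h • b x)
      (ContinuousLinearMap.id ℝ Plane + h • fderiv ℝ b x) x := fun x =>
    (hasFDerivAt_id x).add (((hb.differentiable one_ne_zero) x).hasFDerivAt.const_smul h)
  have hL0 : 0 ≤ L := (norm_nonneg _).trans (hL 0)
  have hlip : ∀ x y, ‖b x - b y‖ ≤ L * ‖x - y‖ := fun x y =>
    convex_univ.norm_image_sub_le_of_norm_fderiv_le
      (fun z _ => (hb.differentiable one_ne_zero) z) (fun z _ => hL z) (mem_univ y) (mem_univ x)
  -- Since `h L < 1` the step is a perturbation of the identity by a contraction, hence injective,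
  -- and the area formula holds without multiplicities.
  have hinj : Function.Injective fun x => x + h • b x := by
    intro x y hxy
    have h1 : x - y = h • (b y - b x) := by
      have : x + h • b x = y + h • b y := hxy
      rw [smul_sub, sub_eq_sub_iff_add_eq_add, this, add_comm]
    have h2 : ‖x - y‖ ≤ h * L * ‖x - y‖ := by
      conv_lhs => rw [h1, norm_smul, Real.norm_of_nonneg hh, norm_sub_rev]
      rw [mul_assoc]
      exact mul_le_mul_of_nonneg_left (hlip x y) hh
    have h3 : ‖x - y‖ ≤ 0 := by nlinarith [norm_nonneg (x - y)]
    exact sub_eq_zero.1 (norm_le_zero_iff.1 h3)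
  have hm : Measurable fun x => x + h • b x := by
    have := hb.continuous.measurable; fun_prop
  set S' := S ∩ (fun x => x + h • b x) ⁻¹' E
  have hS' : MeasurableSet S' := hS.inter (hm hE)
  calc ENNReal.ofReal (1 - h * c - 2 * (h * L) ^ 2) * volume S'
      = ∫⁻ x in S', ENNReal.ofReal (1 - h * c - 2 * (h * L) ^ 2) := by simp
    _ ≤ ∫⁻ x in S', ENNReal.ofReal
          |(ContinuousLinearMap.id ℝ Plane + h • fderiv ℝ b x).det| := by
        refine setLIntegral_mono' hS' fun x hx => ENNReal.ofReal_le_ofReal ?_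
        exact det_id_add_smul_ge hh (hL x) (hdiv x hx.1)
    _ = volume ((fun x => x + h • b x) '' S') :=
        lintegral_abs_det_fderiv_eq_addHaar_image volume hS'
          (fun x _ => (hd x).hasFDerivWithinAt) hinj.injOn
    _ ≤ volume E := measure_mono (by rintro _ ⟨x, hx, rfl⟩; exact hx.2)

namespace FluidDomain

variable {D : FluidDomain}

/-- The test function `ρ (x - ·)` has `L¹` norm `1`, and its support stays in the carrier because
the closed ball of radius `ε` about `x` does. Hence the bound on the distributional divergence
passes to the mollified field with the same constant. -/
lemma abs_divergence_mollify_le {ε M c : ℝ} {ρ : Plane → ℝ} {g : Plane → ℝ} {w : Plane → Plane}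
    (hρ : IsMollifier ε ρ) (hc : 0 ≤ c)
    (hdiv : D.HasDistribDiv w g) (hg : eLpNorm g ∞ D.measure ≤ ENNReal.ofReal c)
    (hw : Measurable (D.carrier.indicator w)) (hM : ∀ x, ‖D.carrier.indicator w x‖ ≤ M)
    (hper : ∀ x ∈ D.carrier, ∀ l ∈ D.lattice, w (x + l) = w x)
    {x : Plane} (hx : Metric.closedBall x ε ⊆ D.carrier) :
    |divergence (mollify ρ (D.carrier.indicator w)) x| ≤ c := by
  rw [hρ.divergence_mollify hw hM, abs_neg, ← ENNReal.ofReal_le_ofReal_iff hc,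
    ← Real.enorm_eq_ofReal_abs]
  have hsub : tsupport (fun z => ρ (x - z)) ⊆ Metric.closedBall x ε := by
    refine closure_minimal (fun z hz => ?_) Metric.isClosed_closedBall
    have := hρ.norm_le hz
    rwa [Metric.mem_closedBall, dist_comm, dist_eq_norm]
  have hcs : HasCompactSupport fun z => ρ (x - z) :=
    (isCompact_closedBall x ε).of_isClosed_subset (isClosed_tsupport _) hsub
  refine (enorm_integral_fderiv_le hdiv hg hw hM hper
    (hρ.smooth.comp (contDiff_const.sub contDiff_id)) hcs (hsub.trans hx)).trans (le_of_eq ?_)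
  have h1 : ∫⁻ y, ‖ρ (x - y)‖ₑ = ∫⁻ y, ‖ρ y‖ₑ := lintegral_sub_left_eq_self (fun y => ‖ρ y‖ₑ) x
  have h2 : ∫⁻ y, ‖ρ y‖ₑ = 1 := by
    rw [← ofReal_integral_norm_eq_lintegral_enorm hρ.integrable]
    simp [Real.norm_of_nonneg (hρ.nonneg _), hρ.integral]
  simp only [Function.comp_def, id]
  rw [h1, h2, mul_one]

end FluidDomain

end EulerVorticity
end

/-! ### Transport of vorticities and bounds on the transported densities. -/

noncomputable section

namespace EulerVorticity
namespace FluidDomain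

variable {D : FluidDomain}

/-- A measurable map from an invariant subset of the carrier to the carrier which is equivariant
under translations of the lattice. -/
structure IsTransport (D : FluidDomain) (S : Set Plane) (Y : Plane → Plane) : Prop where
  measurableSet : MeasurableSet S
  subset : S ⊆ D.carrier
  add_mem : ∀ x ∈ S, ∀ l ∈ D.lattice, x + l ∈ S
  measurable : Measurable Y
  mapsTo : ∀ x ∈ S, Y x ∈ D.carrier
  equivariant : ∀ x ∈ S, ∀ l ∈ D.lattice, Y (x + l) = Y x + l

/-- The map `Y` on `S` compresses areas by a factor of at most `Λ`. -/
def CompressesBy (Λ : ℝ≥0∞) (S : Set Plane) (Y : Plane → Plane) : Prop :=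
  ∀ E : Set Plane, MeasurableSet E → volume (S ∩ Y ⁻¹' E) ≤ Λ * volume E

/-- If `rep (Y z) = Y z + l`, equivariance gives `Y (z + l) = rep (Y z)`. So `z + l` belongs to the
preimage of `E ∩ cell`, and unfolding the area of that preimage over the lattice accounts for every
such `z`. Compression in the plane therefore implies compression on the quotient. -/
lemma IsTransport.volume_cell_le {S : Set Plane} {Y : Plane → Plane} (hY : D.IsTransport S Y)
    {E : Set Plane} (hE : MeasurableSet E) :
    volume (D.cell ∩ (S ∩ (fun z => D.rep (Y z)) ⁻¹' E)) ≤ volume (S ∩ Y ⁻¹' (E ∩ D.cell)) := by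
  have hT : MeasurableSet (S ∩ Y ⁻¹' (E ∩ D.cell)) :=
    hY.measurableSet.inter (hY.measurable (hE.inter D.measurableSet_cell))
  have h1 : volume (S ∩ Y ⁻¹' (E ∩ D.cell)) =
      ∑' l : D.lattice,
        volume ((fun z : Plane => z + l) ⁻¹' (S ∩ Y ⁻¹' (E ∩ D.cell)) ∩ D.cell) := by
    have h2 := D.lintegral_carrier ((S ∩ Y ⁻¹' (E ∩ D.cell)).indicator 1)
    rw [setLIntegral_indicator hT, inter_eq_left.2 (inter_subset_left.trans hY.subset)] at h2
    simp only [Pi.one_apply, lintegral_one, Measure.restrict_apply_univ] at h2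
    rw [h2]
    refine tsum_congr fun l => ?_
    have h3 : MeasurableSet ((fun z : Plane => z + l) ⁻¹' (S ∩ Y ⁻¹' (E ∩ D.cell))) :=
      (measurable_add_const _) hT
    rw [← Measure.restrict_apply h3, ← lintegral_indicator_one h3]
    rfl
  rw [h1]
  refine (measure_mono ?_).trans (measure_iUnion_le _)
  rintro z ⟨hz, hzS, hzE⟩
  obtain ⟨l, hl, h⟩ := D.exists_rep_eq (Y z)
  refine mem_iUnion.2 ⟨⟨l, hl⟩, ⟨hY.add_mem z hzS l hl, ?_⟩, hz⟩
  change Y (z + l) ∈ E ∩ D.cell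
  rw [hY.equivariant z hzS l hl, ← h]
  exact ⟨hzE, D.rep_mem_cell (hY.mapsTo z hzS)⟩

instance : SigmaFinite D.measure := by unfold FluidDomain.measure; infer_instance

lemma IsTransport.measurable_rep {S : Set Plane} {Y : Plane → Plane} (hY : D.IsTransport S Y) :
    Measurable fun z => D.rep (Y z) := D.measurable_rep.comp hY.measurable

lemma IsTransport.map_withDensity_le {S : Set Plane} {Y : Plane → Plane}
    (hY : D.IsTransport S Y) {Λ B : ℝ≥0∞} (hΛ : CompressesBy Λ S Y) {w : Plane → ℝ≥0∞}
    (hB : ∀ᵐ z ∂D.measure, w z ≤ B) {E : Set Plane} (hE : MeasurableSet E) :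
    ((D.measure.restrict S).withDensity w).map (fun z => D.rep (Y z)) E ≤
      B * (Λ * D.measure E) := by
  have hpre := hY.measurable_rep hE
  rw [Measure.map_apply hY.measurable_rep hE, withDensity_apply _ hpre]
  calc ∫⁻ z in (fun z => D.rep (Y z)) ⁻¹' E, w z ∂D.measure.restrict S
      ≤ ∫⁻ z in (fun z => D.rep (Y z)) ⁻¹' E, B ∂D.measure.restrict S :=
        lintegral_mono_ae (ae_restrict_of_ae (ae_restrict_of_ae hB))
    _ = B * volume (D.cell ∩ (S ∩ (fun z => D.rep (Y z)) ⁻¹' E)) := by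
        rw [setLIntegral_const, Measure.restrict_apply hpre, FluidDomain.measure,
          Measure.restrict_apply (hpre.inter hY.measurableSet)]
        congr 2
        ext z
        simp only [mem_inter_iff]
        tauto
    _ ≤ B * (Λ * D.measure E) := by
        gcongr
        rw [FluidDomain.measure, Measure.restrict_apply hE]
        exact (hY.volume_cell_le hE).trans (hΛ _ (hE.inter D.measurableSet_cell))

/-- The densities of the images of a measure under a family of maps, measurably in the
parameter. -/
lemma exists_density {S : Set Plane} {Y : ℝ → Plane → Plane}
    (hYm : Measurable (Function.uncurry Y)) (hY : ∀ t, D.IsTransport S (Y t))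
    (hΛ : ∀ t, ∃ Λ : ℝ≥0∞, CompressesBy Λ S (Y t)) {w : Plane → ℝ≥0∞} {B : ℝ≥0∞}
    (hB : ∀ᵐ z ∂D.measure, w z ≤ B) (hw : ∫⁻ z, w z ∂D.measure ≠ ∞) :
    ∃ f : ℝ → Plane → ℝ≥0∞, Measurable (Function.uncurry f) ∧
      (∀ t x, ∀ l ∈ D.lattice, f t (x + l) = f t x) ∧
      ∀ t, D.measure.withDensity (f t) =
        ((D.measure.restrict S).withDensity w).map (fun z => D.rep (Y t z)) := by
  set ν := (D.measure.restrict S).withDensity w with hν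
  have : IsFiniteMeasure ν := isFiniteMeasure_withDensity
    ((setLIntegral_le_lintegral _ _).trans_lt hw.lt_top).ne
  have hrm : Measurable fun p : ℝ × Plane => D.rep (Y p.1 p.2) := D.measurable_rep.comp hYm
  -- The image measures are arranged as a kernel in `t`, because the Radon–Nikodym derivative of
  -- kernels is jointly measurable in `(t, x)`.
  let κ : ProbabilityTheory.Kernel ℝ Plane :=
    (ProbabilityTheory.Kernel.id.prod (ProbabilityTheory.Kernel.const ℝ ν)).map
      fun p : ℝ × Plane => D.rep (Y p.1 p.2)
  have : ProbabilityTheory.IsFiniteKernel κ := ProbabilityTheory.Kernel.IsFiniteKernel.map _ _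
  have hκ : ∀ t, κ t = ν.map (fun z => D.rep (Y t z)) := fun t => by
    rw [ProbabilityTheory.Kernel.map_apply _ hrm, ProbabilityTheory.Kernel.prod_apply,
      ProbabilityTheory.Kernel.id_apply, ProbabilityTheory.Kernel.const_apply, Measure.dirac_prod,
      Measure.map_map hrm (by fun_prop)]
    rfl
  -- The reference kernel has to be finite, so `D.measure` is replaced by the equivalent finite
  -- measure `toFinite`. The first factor of `f` converts back to `D.measure`.
  let η : ProbabilityTheory.Kernel ℝ Plane := ProbabilityTheory.Kernel.const ℝ D.measure.toFinite
  let f : ℝ → Plane → ℝ≥0∞ := fun t x =>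
    (D.measure.toFinite.rnDeriv D.measure x) * κ.rnDeriv η t x
  have hf : Measurable (Function.uncurry f) :=
    ((Measure.measurable_rnDeriv _ _).comp measurable_snd).mul
      (ProbabilityTheory.Kernel.measurable_rnDeriv κ η)
  -- Composition with `rep` makes the densities periodic and does not change them on the cell, which
  -- carries the measure.
  refine ⟨fun t x => f t (D.rep x), hf.comp (measurable_fst.prodMk
    (D.measurable_rep.comp measurable_snd)), fun t x l hl => by simp only [D.rep_add x hl],
    fun t => ?_⟩
  -- This is where bounded compression is needed: null sets have null preimages.
  have hac : κ t ≪ η t := by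
    rw [hκ, ProbabilityTheory.Kernel.const_apply]
    refine Measure.AbsolutelyContinuous.trans ?_ (absolutelyContinuous_toFinite D.measure)
    refine Measure.AbsolutelyContinuous.mk fun E hE h0 => ?_
    obtain ⟨Λ, hΛ⟩ := hΛ t
    have := (hY t).map_withDensity_le hΛ hB hE
    rw [h0, mul_zero, mul_zero] at this
    exact le_antisymm this zero_le
  have h1 : D.measure.withDensity (f t) = κ t := by
    have h2 := ProbabilityTheory.Kernel.withDensity_rnDeriv_eq hac
    rw [ProbabilityTheory.Kernel.withDensity_apply _
      (ProbabilityTheory.Kernel.measurable_rnDeriv κ η), ProbabilityTheory.Kernel.const_apply] at h2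
    rw [← h2]
    change D.measure.withDensity ((D.measure.toFinite.rnDeriv D.measure) * κ.rnDeriv η t) = _
    rw [withDensity_mul _ (Measure.measurable_rnDeriv _ _)
      (ProbabilityTheory.Kernel.measurable_rnDeriv_right κ η t),
      Measure.withDensity_rnDeriv_eq _ _ (toFinite_absolutelyContinuous _)]
  rw [← hκ, ← h1]
  refine withDensity_congr_ae ?_
  filter_upwards [ae_mem_cell] with x hx
  rw [D.rep_eq_self hx]

/-- The vorticities transported by a family of maps. -/
theorem exists_transported_vorticity {S : Set Plane} {Y : ℝ → Plane → Plane}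
    (hYm : Measurable (Function.uncurry Y)) (hY : ∀ t, D.IsTransport S (Y t))
    (hΛ : ∀ t, ∃ Λ : ℝ, 0 ≤ Λ ∧ CompressesBy (ENNReal.ofReal Λ) S (Y t)) {ω₀ : Plane → ℝ} {A B : ℝ}
    (hB : 0 ≤ B) (hω₀ : D.IsVorticity A B ω₀) :
    ∃ ω : ℝ → Plane → ℝ, Measurable (Function.uncurry ω) ∧
      (∀ t Λ, 0 ≤ Λ → CompressesBy (ENNReal.ofReal Λ) S (Y t) → D.IsVorticity A (Λ * B) (ω t)) ∧
      ∀ t φ, Measurable φ → D.Periodic φ → (∃ M : ℝ, ∀ x, |φ x| ≤ M) →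
        ∫ x, ω t x * φ x ∂D.measure = ∫ x in S, ω₀ x * φ (Y t x) ∂D.measure := by
  have hΛ' : ∀ t, ∃ Λ : ℝ≥0∞, CompressesBy Λ S (Y t) := fun t =>
    let ⟨Λ, _, h⟩ := hΛ t; ⟨_, h⟩
  have hBp : ∀ᵐ z ∂D.measure, ENNReal.ofReal (ω₀ z) ≤ ENNReal.ofReal B := by
    filter_upwards [hω₀.sup] with z hz
    exact ENNReal.ofReal_le_ofReal ((le_abs_self _).trans hz)
  have hBn : ∀ᵐ z ∂D.measure, ENNReal.ofReal (-ω₀ z) ≤ ENNReal.ofReal B := by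
    filter_upwards [hω₀.sup] with z hz
    exact ENNReal.ofReal_le_ofReal ((neg_le_abs _).trans hz)
  have hfin : ∫⁻ z, ‖ω₀ z‖ₑ ∂D.measure ≠ ∞ := (hω₀.l1.trans_lt ENNReal.ofReal_lt_top).ne
  have hp : ∫⁻ z, ENNReal.ofReal (ω₀ z) ∂D.measure ≠ ∞ :=
    ((lintegral_mono fun z => Real.ofReal_le_enorm _).trans_lt hfin.lt_top).ne
  have hn : ∫⁻ z, ENNReal.ofReal (-ω₀ z) ∂D.measure ≠ ∞ :=
    ((lintegral_mono fun z => (Real.ofReal_le_enorm _).trans_eq (enorm_neg _)).trans_lt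
      hfin.lt_top).ne
  obtain ⟨f, hfm, hfper, hf⟩ := exists_density hYm hY hΛ' hBp hp
  obtain ⟨g, hgm, hgper, hg⟩ := exists_density hYm hY hΛ' hBn hn
  have hft : ∀ t, Measurable (f t) := fun t => hfm.comp measurable_prodMk_left
  have hgt : ∀ t, Measurable (g t) := fun t => hgm.comp measurable_prodMk_left
  have hwm : AEMeasurable ω₀ D.measure := hω₀.aestronglyMeasurable.aemeasurable
  -- The positive and negative parts of `ω₀` are transported separately; this is the common
  -- statement, applied to `ω₀` and to `-ω₀`.
  have key : ∀ (w : Plane → ℝ) (h : ℝ → Plane → ℝ≥0∞) (t : ℝ),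
      AEMeasurable w D.measure →
      Measurable (h t) →
      (∀ᵐ z ∂D.measure, ENNReal.ofReal (w z) ≤ ENNReal.ofReal B) →
      (∫⁻ z, ENNReal.ofReal (w z) ∂D.measure ≠ ∞) →
      (D.measure.withDensity (h t) =
        ((D.measure.restrict S).withDensity fun z => ENNReal.ofReal (w z)).map
          (fun z => D.rep (Y t z))) →
      (∫⁻ z, h t z ∂D.measure ≤ ∫⁻ z, ENNReal.ofReal (w z) ∂D.measure) ∧
      (∀ Λ : ℝ, 0 ≤ Λ → CompressesBy (ENNReal.ofReal Λ) S (Y t) →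
        ∀ᵐ z ∂D.measure, h t z ≤ ENNReal.ofReal (Λ * B)) ∧
      ∀ φ : Plane → ℝ, Measurable φ → D.Periodic φ → (∃ M : ℝ, ∀ x, |φ x| ≤ M) →
        Integrable (fun x => (h t x).toReal * φ x) D.measure ∧
        ∫ x, (h t x).toReal * φ x ∂D.measure =
          ∫ x in S, (ENNReal.ofReal (w x)).toReal * φ (Y t x) ∂D.measure := by
    intro w h t hw hh hwB hwi hd
    have h1 : ∫⁻ z, h t z ∂D.measure ≤ ∫⁻ z, ENNReal.ofReal (w z) ∂D.measure := by
      have := congrArg (fun μ : Measure Plane => μ univ) hd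
      simp only [withDensity_apply _ MeasurableSet.univ, Measure.restrict_univ,
        Measure.map_apply (hY t).measurable_rep MeasurableSet.univ, preimage_univ] at this
      rw [this]
      exact setLIntegral_le_lintegral _ _
    have hlt : ∀ᵐ z ∂D.measure, h t z < ∞ :=
      ae_lt_top hh ((h1.trans_lt hwi.lt_top).ne)
    refine ⟨h1, fun Λ hΛ0 hc => ?_, fun φ hφ hper ⟨M, hM⟩ => ⟨?_, ?_⟩⟩
    · refine ae_le_of_forall_setLIntegral_le_of_sigmaFinite hh fun E hE _ => ?_
      rw [← withDensity_apply _ hE, hd, setLIntegral_const]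
      refine ((hY t).map_withDensity_le hc hwB hE).trans (le_of_eq ?_)
      rw [ENNReal.ofReal_mul hΛ0]
      ring
    · refine Integrable.mul_bdd (c := M) ?_ hφ.aestronglyMeasurable
        (ae_of_all _ fun x => by simpa using hM x)
      exact integrable_toReal_of_lintegral_ne_top hh.aemeasurable (h1.trans_lt hwi.lt_top).ne
    · have e1 : ∫ x, (h t x).toReal * φ x ∂D.measure = ∫ x, φ x ∂(D.measure.withDensity (h t)) := by
        rw [integral_withDensity_eq_integral_toReal_smul hh hlt]
        rfl
      rw [e1, hd, integral_map (hY t).measurable_rep.aemeasurable hφ.aestronglyMeasurable]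
      rw [integral_withDensity_eq_integral_toReal_smul₀ (hw.restrict.ennreal_ofReal)
        (ae_of_all _ fun x => ENNReal.ofReal_lt_top)]
      refine setIntegral_congr_fun (hY t).measurableSet fun x hx => ?_
      simp only [smul_eq_mul]
      rw [hper.rep ((hY t).mapsTo x hx)]
  refine ⟨fun t x => (f t x).toReal - (g t x).toReal,
    hfm.ennreal_toReal.sub hgm.ennreal_toReal, fun t Λ hΛ0 hc => ?_, fun t φ hφ hper hM => ?_⟩
  · obtain ⟨f1, fs, -⟩ := key ω₀ f t hwm (hft t) hBp hp (hf t)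
    obtain ⟨g1, gs, -⟩ := key (fun z => -ω₀ z) g t hwm.neg (hgt t) hBn hn (hg t)
    have hΛB : 0 ≤ Λ * B := mul_nonneg hΛ0 hB
    refine ⟨fun x _ l hl => by simp only [hfper t x l hl, hgper t x l hl],
      ((hft t).ennreal_toReal.sub (hgt t).ennreal_toReal).aestronglyMeasurable, ?_, ?_⟩
    · calc ∫⁻ z, ‖(f t z).toReal - (g t z).toReal‖ₑ ∂D.measure
          ≤ ∫⁻ z, (f t z + g t z) ∂D.measure := by
            refine lintegral_mono fun z => enorm_sub_le.trans ?_
            gcongr <;> exact (Real.enorm_of_nonneg ENNReal.toReal_nonneg).trans_le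
              ENNReal.ofReal_toReal_le
        _ = ∫⁻ z, f t z ∂D.measure + ∫⁻ z, g t z ∂D.measure := lintegral_add_left (hft t) _
        _ ≤ ∫⁻ z, ENNReal.ofReal (ω₀ z) ∂D.measure + ∫⁻ z, ENNReal.ofReal (-ω₀ z) ∂D.measure :=
            add_le_add f1 g1
        _ = ∫⁻ z, ‖ω₀ z‖ₑ ∂D.measure := by
            rw [← lintegral_add_left' hwm.ennreal_ofReal]
            refine lintegral_congr fun z => ?_
            rw [← ofReal_norm, Real.norm_eq_abs]
            rcases le_total 0 (ω₀ z) with h | h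
            · rw [abs_of_nonneg h, ENNReal.ofReal_of_nonpos (neg_nonpos.2 h), add_zero]
            · rw [abs_of_nonpos h, ENNReal.ofReal_of_nonpos h, zero_add]
        _ ≤ _ := hω₀.l1
    · filter_upwards [fs Λ hΛ0 hc, gs Λ hΛ0 hc] with z h1 h2
      have h1' := ENNReal.toReal_le_of_le_ofReal hΛB h1
      have h2' := ENNReal.toReal_le_of_le_ofReal hΛB h2
      -- Both densities lie in `[0, Λ B]`, so their difference is at most `Λ B` in absolute value
      -- and no factor `2` appears.
      rw [abs_le]
      constructor <;> linarith [ENNReal.toReal_nonneg (a := f t z),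
        ENNReal.toReal_nonneg (a := g t z)]
  · obtain ⟨-, -, fφ⟩ := key ω₀ f t hwm (hft t) hBp hp (hf t)
    obtain ⟨-, -, gφ⟩ := key (fun z => -ω₀ z) g t hwm.neg (hgt t) hBn hn (hg t)
    obtain ⟨fi, fe⟩ := fφ φ hφ hper hM
    obtain ⟨gi, ge⟩ := gφ φ hφ hper hM
    simp only [sub_mul]
    rw [integral_sub fi gi, fe, ge]
    obtain ⟨M, hM⟩ := hM
    have hint : ∀ w : Plane → ℝ, AEMeasurable w D.measure →
        (∫⁻ z, ENNReal.ofReal (w z) ∂D.measure ≠ ∞) →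
        Integrable (fun x => (ENNReal.ofReal (w x)).toReal * φ (Y t x)) (D.measure.restrict S) := by
      intro w hw hwi
      refine Integrable.mul_bdd (c := M) ?_ (hφ.comp (hY t).measurable).aestronglyMeasurable
        (ae_of_all _ fun x => by simpa using hM _)
      exact (integrable_toReal_of_lintegral_ne_top hw.ennreal_ofReal hwi).restrict
    rw [← integral_sub (hint _ hwm hp) (hint (fun z => -ω₀ z) hwm.neg hn)]
    refine integral_congr_ae (ae_of_all _ fun x => ?_)
    simp only [ENNReal.toReal_ofReal']
    rw [← sub_mul]
    congr 1
    rcases le_total 0 (ω₀ x) with h | h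
    · rw [max_eq_left h, max_eq_right (neg_nonpos.2 h), sub_zero]
    · rw [max_eq_right h, max_eq_left (neg_nonneg.2 h)]; ring

end FluidDomain

end EulerVorticity
end

noncomputable section

namespace EulerVorticity
/-! ### The normal at a nearest boundary point -/

section Normal

variable {Ω : Set Plane} {z y : Plane}

/-- The open ball about `z` through the nearest exterior point `y` is contained in `Ω`, and `y` lies
in its closure. -/
lemma mem_closure_of_nearest (hz : z ∈ Ω) (hy : y ∉ Ω) (hmin : ∀ y', y' ∉ Ω → ‖z - y‖ ≤ ‖z - y'‖) :
    y ∈ closure Ω := by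
  have hzy : 0 < ‖z - y‖ := norm_pos_iff.2 (sub_ne_zero.2 (by rintro rfl; exact hy hz))
  have h1 : Metric.ball z ‖z - y‖ ⊆ Ω := fun w hw => by
    by_contra hwΩ
    have := hmin w hwΩ
    rw [Metric.mem_ball, dist_comm, dist_eq_norm] at hw
    linarith
  refine closure_mono h1 ?_
  rw [closure_ball z hzy.ne', Metric.mem_closedBall, dist_comm, dist_eq_norm]

/-- The ball about `z` through `y` touches the boundary from inside. Every direction pointing into
this ball enters `Ω`, so the defining function cannot decrease along it. Its gradient is thus
nonnegative on the half-space of vectors `w` with `⟪z - y, w⟫ > 0`, which forces it to be a positive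
multiple of `z - y`. -/
lemma isInnerUnitNormal_of_nearest (hΩ : HasC1Boundary Ω) (hz : z ∈ Ω) (hy : y ∉ Ω)
    (hmin : ∀ y', y' ∉ Ω → ‖z - y‖ ≤ ‖z - y'‖) :
    y ∈ frontier Ω ∧ IsInnerUnitNormal Ω y (‖z - y‖⁻¹ • (z - y)) := by
  have hcl := mem_closure_of_nearest hz hy hmin
  have hfr : y ∈ frontier Ω := ⟨hcl, fun h => hy (interior_subset h)⟩
  refine ⟨hfr, ?_⟩
  obtain ⟨ρ, hρ⟩ := hΩ y hfr
  refine ⟨ρ, hρ, ?_⟩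
  obtain ⟨hC, h0, hg, hev⟩ := hρ
  set n := gradient ρ y with hn
  set q := z - y with hq
  have hq0 : 0 < ‖q‖ := norm_pos_iff.2 (sub_ne_zero.2 (by rintro rfl; exact hy hz))
  have hd : ∀ w, HasDerivAt (fun t : ℝ => ρ (y + t • w)) (inner ℝ n w) 0 := by
    intro w
    have h1 : HasGradientAt ρ n y := (hC.differentiableAt one_ne_zero).hasGradientAt
    have h2 := h1.hasFDerivAt
    have h3 : HasDerivAt (fun t : ℝ => y + t • w) w 0 := by
      simpa using ((hasDerivAt_id (0 : ℝ)).smul_const w).const_add y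
    have h4 : HasFDerivAt ρ ((InnerProductSpace.toDual ℝ Plane) n) (y + (0 : ℝ) • w) := by
      simpa using h2
    have h5 := h4.comp_hasDerivAt 0 h3
    rw [InnerProductSpace.toDual_apply_apply] at h5
    exact h5
  have hpos : ∀ w, 0 < inner ℝ q w → 0 ≤ inner ℝ n w := by
    intro w hw
    have h1 := (hd w).tendsto_slope_zero_right
    refine ge_of_tendsto h1 ?_
    have hcont : Tendsto (fun t : ℝ => y + t • w) (𝓝[>] 0) (𝓝 y) := by
      have : Continuous fun t : ℝ => y + t • w := by fun_prop
      simpa using (this.tendsto 0).mono_left nhdsWithin_le_nhds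
    have hsmall : ∀ᶠ t : ℝ in 𝓝[>] 0, t * ‖w‖ ^ 2 < 2 * inner ℝ q w := by
      have : Continuous fun t : ℝ => t * ‖w‖ ^ 2 := by fun_prop
      have h := (this.tendsto 0).mono_left (nhdsWithin_le_nhds (s := Ioi 0))
      exact h.eventually_lt_const (by simpa using hw)
    filter_upwards [hcont.eventually hev, hsmall, self_mem_nhdsWithin] with t ht1 ht2 ht3
    have ht3 : 0 < t := ht3
    have hmem : y + t • w ∈ Ω := by
      by_contra hcon
      have h2 := hmin _ hcon
      have h3 : z - (y + t • w) = q - t • w := by rw [hq]; abel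
      rw [h3] at h2
      have h4 : ‖q - t • w‖ ^ 2 = ‖q‖ ^ 2 - 2 * (t * inner ℝ q w) + t ^ 2 * ‖w‖ ^ 2 := by
        rw [norm_sub_sq_real, inner_smul_right, norm_smul, mul_pow, Real.norm_eq_abs, sq_abs]
      have h5 : ‖q‖ ^ 2 ≤ ‖q - t • w‖ ^ 2 := by gcongr
      nlinarith
    have h6 := ht1.1 hmem
    simp only [zero_add, zero_smul, add_zero, h0, sub_zero, smul_eq_mul]
    positivity
  -- Passage to the closed half-space, by moving `w` slightly in the direction `q`. It allows
  -- testing with vectors orthogonal to `q`.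
  have hnonneg : ∀ w, 0 ≤ inner ℝ q w → 0 ≤ inner ℝ n w := by
    intro w hw
    have hlim : Tendsto (fun t : ℝ => inner ℝ n (w + t • q)) (𝓝[>] 0) (𝓝 (inner ℝ n w)) := by
      have : Continuous fun t : ℝ => inner ℝ n (w + t • q) := by fun_prop
      simpa using (this.tendsto 0).mono_left nhdsWithin_le_nhds
    refine ge_of_tendsto hlim ?_
    filter_upwards [self_mem_nhdsWithin] with t ht
    have ht : 0 < t := ht
    refine hpos _ ?_
    rw [inner_add_right, inner_smul_right, real_inner_self_eq_norm_sq]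
    positivity
  have hqq : inner ℝ q q = ‖q‖ ^ 2 := real_inner_self_eq_norm_sq q
  -- The part `n - a • q` of the gradient is orthogonal to `q`. Testing with its negative shows that
  -- it vanishes.
  set a : ℝ := inner ℝ q n / ‖q‖ ^ 2 with ha
  have haq : a * ‖q‖ ^ 2 = inner ℝ q n := by rw [ha]; field_simp
  have hperp : inner ℝ q (n - a • q) = 0 := by
    rw [inner_sub_right, inner_smul_right, hqq, haq, sub_self]
  have h1 : 0 ≤ inner ℝ n (-(n - a • q)) := hnonneg _ (by rw [inner_neg_right, hperp, neg_zero])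
  have h2 : inner ℝ n (n - a • q) = ‖n - a • q‖ ^ 2 := by
    rw [← real_inner_self_eq_norm_sq, inner_sub_left (x := n), inner_smul_left, hperp]
    simp
  rw [inner_neg_right, h2] at h1
  have h3 : n = a • q := by
    have : ‖n - a • q‖ = 0 := by
      have := norm_nonneg (n - a • q); nlinarith
    exact sub_eq_zero.1 (norm_eq_zero.1 this)
  have h4 : 0 ≤ a := by
    have := hnonneg q (by rw [hqq]; positivity)
    rw [real_inner_comm] at this
    exact div_nonneg this (by positivity)
  have h5 : 0 < a := lt_of_le_of_ne h4 (by rintro h; rw [← h, zero_smul] at h3; exact hg h3)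
  rw [h3, norm_smul, Real.norm_of_nonneg h4, smul_smul]
  congr 1
  field_simp

end Normal

lemma FluidDomain.hasC1Boundary (D : FluidDomain) : HasC1Boundary D.carrier := by
  cases D with
  | planar Ω _ h => exact h
  | torus => intro x hx; simp [FluidDomain.carrier] at hx

/-- The normal component vanishes at the boundary point `y`, and the modulus of continuity carries
this to `x`. Since `u` is controlled in `Ω` only, `y` is approached by points of `Ω`. -/
lemma neg_mul_logLipModulus_le_inner {Ω : Set Plane} {u : Plane → Plane} {M : ℝ}
    (hu : ∀ x ∈ Ω, ∀ y ∈ Ω, ‖u x - u y‖ ≤ M * logLipModulus ‖x - y‖)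
    {x y ν : Plane} (hx : x ∈ Ω) (hy : y ∈ closure Ω) (hν : ‖ν‖ ≤ 1)
    (hlim : Tendsto (fun z => inner ℝ ν (u z)) (𝓝[Ω] y) (𝓝 0)) :
    -(M * logLipModulus ‖x - y‖) ≤ inner ℝ ν (u x) := by
  have : (𝓝[Ω] y).NeBot := mem_closure_iff_nhdsWithin_neBot.1 hy
  have h1 : Tendsto (fun z => inner ℝ ν (u z) - M * logLipModulus ‖x - z‖) (𝓝[Ω] y)
      (𝓝 (0 - M * logLipModulus ‖x - y‖)) := by
    refine hlim.sub (Tendsto.const_mul M ?_)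
    have h2 := continuousOn_logLipModulus ‖x - y‖ (norm_nonneg _)
    refine h2.tendsto.comp (tendsto_nhdsWithin_iff.2 ⟨?_, Eventually.of_forall
      fun z => norm_nonneg _⟩)
    have : Continuous fun z => ‖x - z‖ := by fun_prop
    exact this.continuousAt.tendsto.mono_left nhdsWithin_le_nhds
  rw [zero_sub] at h1
  refine le_of_tendsto h1 ?_
  filter_upwards [self_mem_nhdsWithin] with z hz
  have h3 : |inner ℝ ν (u x - u z)| ≤ M * logLipModulus ‖x - z‖ :=
    calc |inner ℝ ν (u x - u z)| ≤ ‖ν‖ * ‖u x - u z‖ := abs_real_inner_le_norm _ _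
      _ ≤ 1 * ‖u x - u z‖ := by gcongr
      _ ≤ _ := by rw [one_mul]; exact hu x hx z hz
  rw [inner_sub_right] at h3
  have := (abs_le.1 h3).1
  linarith

/-! ### The discrete Osgood lemma -/

/-- Every discrete solution on `[0, T]` of the differential inequality `a' ≤ M ℓ(a)` starting below
`α` stays below `η`. -/
def OsgoodPair (M T α η : ℝ) : Prop :=
  ∀ (h : ℝ) (N : ℕ) (a : ℕ → ℝ), 0 ≤ h → 2 * M * h ≤ 1 → N * h ≤ T → (∀ j, 0 ≤ a j) →
    (∀ j < N, a (j + 1) ≤ a j + h * (M * logLipModulus (a j))) → a 0 ≤ α →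
    ∀ j ≤ N, a j < η

/-- With `a = exp (1 - q)` and `q ≥ 1` one has `ℓ(a) = q a`, so the equation `a' = M ℓ(a)` becomes
the linear equation `q' = -M q`. The barrier `exp (1 - q j)` lets `q` decay at the rate `2 M`; the
spare factor absorbs the error of the explicit discretization. -/
lemma exists_osgoodPair {M T η : ℝ} (hM : 0 ≤ M) (hη : 0 < η) :
    ∃ α > 0, OsgoodPair M T α η := by
  set E := Real.exp (-(2 * M * T)) with hE
  have hE0 : 0 < E := Real.exp_pos _
  -- `E` is the total decay of `q` up to time `T`. This choice keeps `q ≥ 1`, where the formula for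
  -- the modulus holds, and `q ≥ 2 - log η`, which puts the barrier strictly below `η`.
  set Q : ℝ := (max 1 (2 - Real.log η)) / E with hQ
  have hQE : Q * E = max 1 (2 - Real.log η) := by rw [hQ]; field_simp
  refine ⟨Real.exp (1 - Q), Real.exp_pos _, ?_⟩
  intro h N a hh hMh hN ha hrec h0
  have hQ0 : 0 < Q := div_pos (lt_of_lt_of_le one_pos (le_max_left _ _)) hE0
  set q : ℕ → ℝ := fun j => Q * Real.exp (-(2 * M * h * j)) with hq
  have hqE : ∀ j ≤ N, max 1 (2 - Real.log η) ≤ q j := by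
    intro j hj
    rw [← hQE]
    refine mul_le_mul_of_nonneg_left (Real.exp_le_exp.2 (neg_le_neg ?_)) hQ0.le
    have : (j : ℝ) * h ≤ T := le_trans (by gcongr) hN
    nlinarith
  have hb : ∀ j ≤ N, a j ≤ Real.exp (1 - q j) := by
    intro j
    induction j with
    | zero => intro _; simpa [hq] using h0
    | succ j ih =>
      intro hj
      have hj' : j < N := hj
      have h1 := ih hj'.le
      have hq1 : 1 ≤ q j := (le_max_left _ _).trans (hqE j hj'.le)
      have hle1 : Real.exp (1 - q j) ≤ 1 := Real.exp_le_one_iff.2 (by linarith)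
      have h2 : logLipModulus (a j) ≤ Real.exp (1 - q j) * q j := by
        refine (logLipModulus_mono (ha j) h1).trans (le_of_eq ?_)
        rw [logLipModulus_of_le_one hle1, Real.log_exp]; ring
      have h3 : q (j + 1) = q j * Real.exp (-(2 * M * h)) := by
        simp only [hq, mul_assoc, ← Real.exp_add]
        congr 2; push_cast; ring
      -- With `x = M h`, this is `exp (-2 x) ≤ 1 / (1 + 2 x) ≤ 1 - x`; the last inequality requires
      -- `x ≤ 1 / 2`, which is the condition `2 M h ≤ 1` in `OsgoodPair`.
      have h4 : q (j + 1) ≤ q j * (1 - M * h) := by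
        rw [h3]
        refine mul_le_mul_of_nonneg_left ?_ (by linarith)
        have h5 : Real.exp (-(2 * M * h)) ≤ 1 / (1 + 2 * M * h) := by
          rw [Real.exp_neg, ← one_div]
          have := Real.add_one_le_exp (2 * M * h)
          exact one_div_le_one_div_of_le (by nlinarith [mul_nonneg hM hh]) (by linarith)
        refine h5.trans ?_
        rw [div_le_iff₀ (by nlinarith [mul_nonneg hM hh])]
        nlinarith [mul_nonneg hM hh]
      calc a (j + 1) ≤ a j + h * (M * logLipModulus (a j)) := hrec j hj'
        _ ≤ Real.exp (1 - q j) + h * (M * (Real.exp (1 - q j) * q j)) := by gcongr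
        _ = Real.exp (1 - q j) * (M * h * q j + 1) := by ring
        _ ≤ Real.exp (1 - q j) * Real.exp (M * h * q j) := by
            gcongr; exact Real.add_one_le_exp _
        _ = Real.exp (1 - q j + M * h * q j) := (Real.exp_add _ _).symm
        _ ≤ Real.exp (1 - q (j + 1)) := by
            refine Real.exp_le_exp.2 ?_
            linarith
  intro j hj
  refine (hb j hj).trans_lt ?_
  have h1 := (le_max_right _ _).trans (hqE j hj)
  calc Real.exp (1 - q j) < Real.exp (Real.log η) := Real.exp_lt_exp.2 (by linarith)
    _ = η := Real.exp_log hη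

/-! ### Admissible velocity fields -/

namespace FluidDomain

/-- The points at distance at least `r` from the complement of the carrier. -/
def deep (D : FluidDomain) (r : ℝ) : Set Plane := {x | ∀ y, y ∉ D.carrier → r ≤ ‖x - y‖}

variable {D : FluidDomain}

lemma isClosed_deep (r : ℝ) : IsClosed (D.deep r) := by
  have : D.deep r = ⋂ y, ⋂ (_ : y ∉ D.carrier), {x | r ≤ ‖x - y‖} := by
    ext x; simp [deep]
  rw [this]
  exact isClosed_iInter fun y => isClosed_iInter fun _ => isClosed_le (by fun_prop) (by fun_prop)

lemma deep_anti {r s : ℝ} (h : r ≤ s) : D.deep s ⊆ D.deep r := fun _ hx y hy => h.trans (hx y hy)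

lemma deep_subset_carrier {r : ℝ} (hr : 0 < r) : D.deep r ⊆ D.carrier := fun x hx => by
  by_contra h
  have := hx x h
  simp at this
  linarith

lemma add_mem_deep {x l : Plane} {r : ℝ} (hx : x ∈ D.deep r) (hl : l ∈ D.lattice) :
    x + l ∈ D.deep r := fun y hy => by
  have h := hx (y - l) (fun h => hy (by simpa using D.add_mem_carrier h hl))
  rwa [sub_sub_eq_add_sub] at h

lemma deep_translate {x w : Plane} {r s : ℝ} (hx : x ∈ D.deep r) (hw : ‖w‖ ≤ s) :
    x + w ∈ D.deep (r - s) := fun y hy => by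
  have h := hx y hy
  have : ‖x - y‖ ≤ ‖x + w - y‖ + ‖w‖ := by
    calc ‖x - y‖ = ‖(x + w - y) - w‖ := congrArg norm (by abel)
      _ ≤ _ := norm_sub_le _ _
  linarith

lemma exists_mem_deep {x : Plane} (hx : x ∈ D.carrier) : ∃ r > 0, x ∈ D.deep r := by
  obtain ⟨r, hr, h⟩ := Metric.isOpen_iff.1 D.isOpen_carrier x hx
  refine ⟨r, hr, fun y hy => ?_⟩
  by_contra hlt
  refine hy (h ?_)
  rw [Metric.mem_ball, dist_comm, dist_eq_norm]
  exact not_le.1 hlt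

lemma closedBall_subset_of_mem_deep {x : Plane} {r s : ℝ} (hx : x ∈ D.deep r) (hrs : s < r) :
    Metric.closedBall x s ⊆ D.carrier := fun y hy => by
  by_contra h
  have := hx y h
  rw [Metric.mem_closedBall, dist_comm, dist_eq_norm] at hy
  linarith

/-- The properties of the velocity fields generated by bounded integrable vorticities. -/
structure IsAdmissible (D : FluidDomain) (M c : ℝ) (u : Plane → Plane) : Prop where
  measurable : Measurable u
  norm_le : ∀ x, ‖u x‖ ≤ M
  logLip : ∀ x ∈ D.carrier, ∀ y ∈ D.carrier, ‖u x - u y‖ ≤ M * logLipModulus ‖x - y‖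
  periodic : ∀ x, ∀ l ∈ D.lattice, u (x + l) = u x
  divergence : ∀ ε ρ, IsMollifier ε ρ → ∀ x, Metric.closedBall x ε ⊆ D.carrier →
    |divergence (mollify ρ u) x| ≤ c
  normal : ∀ x ∈ D.carrier, ∀ z ∈ D.carrier, ∀ y, y ∉ D.carrier →
    (∀ y', y' ∉ D.carrier → ‖z - y‖ ≤ ‖z - y'‖) →
    -(‖z - y‖ * (M * logLipModulus ‖x - y‖)) ≤ inner ℝ (z - y) (u x)

lemma IsAdmissible.mono {M M' c : ℝ} {u : Plane → Plane} (hu : D.IsAdmissible M c u)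
    (h : M ≤ M') : D.IsAdmissible M' c u where
  measurable := hu.measurable
  norm_le x := (hu.norm_le x).trans h
  logLip x hx y hy := (hu.logLip x hx y hy).trans
    (mul_le_mul_of_nonneg_right h (logLipModulus_nonneg (norm_nonneg _)))
  periodic := hu.periodic
  divergence := hu.divergence
  normal x hx z hz y hy hmin := by
    refine le_trans (neg_le_neg ?_) (hu.normal x hx z hz y hy hmin)
    exact mul_le_mul_of_nonneg_left
      (mul_le_mul_of_nonneg_right h (logLipModulus_nonneg (norm_nonneg _))) (norm_nonneg _)

lemma IsVorticity.memLp_top {A B : ℝ} {ω : Plane → ℝ} (hω : D.IsVorticity A B ω) :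
    MemLp ω ∞ D.measure :=
  memLp_top_of_bound hω.aestronglyMeasurable B hω.sup

lemma IsVorticity.memLp_one {A B : ℝ} {ω : Plane → ℝ} (hω : D.IsVorticity A B ω) :
    MemLp ω 1 D.measure :=
  ⟨hω.aestronglyMeasurable, by
    rw [eLpNorm_one_eq_lintegral_enorm]; exact hω.l1.trans_lt ENNReal.ofReal_lt_top⟩

/-- Interpolation `|ω|^p ≤ B^(p-1) |ω|`. It allows the assumptions on divergence and boundary flux,
made for one exponent `p`, to be applied to bounded integrable vorticities. -/
lemma IsVorticity.inL1LpUl {A B : ℝ} {ω : Plane → ℝ} (hω : D.IsVorticity A B ω) {p : ℝ≥0∞}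
    (hp : 1 ≤ p) : D.InL1LpUl p ω where
  periodic := hω.periodic
  memL1 := hω.memLp_one
  memLpUl := by
    unfold lpUlNorm
    split_ifs with h
    · exact hω.memLp_top.2
    · have h1 : MemLp ω p D.measure := by
        have h2 := hω.memLp_one
        refine ⟨hω.aestronglyMeasurable, ?_⟩
        have hp0 : p ≠ 0 := (lt_of_lt_of_le one_pos hp).ne'
        have hp1 : 1 ≤ p.toReal := by
          rw [← ENNReal.toReal_one]; exact ENNReal.toReal_mono h hp
        rw [eLpNorm_lt_top_iff_lintegral_rpow_enorm_lt_top hp0 h]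
        calc ∫⁻ z, ‖ω z‖ₑ ^ p.toReal ∂D.measure
            ≤ ∫⁻ z, ENNReal.ofReal B ^ (p.toReal - 1) * ‖ω z‖ₑ ∂D.measure := by
              refine lintegral_mono_ae ?_
              filter_upwards [hω.sup] with z hz
              calc ‖ω z‖ₑ ^ p.toReal = ‖ω z‖ₑ ^ (p.toReal - 1) * ‖ω z‖ₑ := by
                    conv_lhs => rw [← sub_add_cancel p.toReal 1]
                    rw [ENNReal.rpow_add_of_nonneg _ _ (by linarith) zero_le_one,
                      ENNReal.rpow_one]
                _ ≤ _ := by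
                    gcongr
                    rw [← ofReal_norm]; exact ENNReal.ofReal_le_ofReal hz
          _ = ENNReal.ofReal B ^ (p.toReal - 1) * ∫⁻ z, ‖ω z‖ₑ ∂D.measure :=
              lintegral_const_mul'' _ hω.aestronglyMeasurable.enorm
          _ < ∞ := ENNReal.mul_lt_top (ENNReal.rpow_lt_top_of_nonneg (by linarith)
              ENNReal.ofReal_ne_top) (hω.l1.trans_lt ENNReal.ofReal_lt_top)
      refine lt_of_le_of_lt (iSup₂_le fun x _ => ?_) h1.2
      exact eLpNorm_mono_measure _ Measure.restrict_le_self

lemma KernelEstimates.measurable_velocity {k : Plane → Plane → Plane} {C₁ C₂ A B : ℝ}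
    {ω : Plane → ℝ} (hk : D.KernelEstimates k C₁ C₂) (hC₁ : 0 ≤ C₁)
    (hC₂ : 0 ≤ C₂) (hA : 0 ≤ A) (hB : 0 ≤ B) (hω : D.IsVorticity A B ω) :
    Measurable (D.carrier.indicator (D.velocityOf k ω)) := by
  have h : ContinuousOn (D.velocityOf k ω) D.carrier := by
    intro x hx
    refine tendsto_iff_norm_sub_tendsto_zero.2 ?_
    have h1 : Tendsto (fun y => velocityConst C₁ C₂ * (A + B) * logLipModulus (D.distance y x))
        (𝓝[D.carrier] x) (𝓝 (velocityConst C₁ C₂ * (A + B) * logLipModulus 0)) := by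
      refine Tendsto.const_mul _ ((continuousOn_logLipModulus 0 (mem_Ici.2 le_rfl)).tendsto.comp
        (tendsto_nhdsWithin_iff.2 ⟨?_, Eventually.of_forall fun y => D.distance_nonneg _ _⟩))
      have h2 : Tendsto (fun y => D.distance x y) (𝓝[D.carrier] x) (𝓝 (D.distance x x)) :=
        (D.continuous_distance x).continuousAt.tendsto.mono_left nhdsWithin_le_nhds
      rw [D.distance_eq_zero (by simp)] at h2
      exact h2.congr fun y => D.distance_comm x y
    rw [logLipModulus_zero, mul_zero] at h1
    refine squeeze_zero' (Eventually.of_forall fun _ => norm_nonneg _) ?_ h1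
    filter_upwards [self_mem_nhdsWithin] with y hy
    exact hk.norm_velocityOf_sub_le hC₁ hC₂ hA hB hω hy hx
  classical
  have h2 := h.measurable_piecewise (g := 0) continuousOn_const
    D.measurableSet_carrier
  rwa [piecewise_eq_indicator] at h2

/-- Everything the scheme needs to know about the kernel is collected here. For the boundary
condition, `z - y` is an unnormalized inner normal at the exterior point `y` nearest to `z`. The
field is evaluated at another point `x`, because in an Euler step the normal is taken from the new
position and the velocity from the old one. -/
lemma KernelEstimates.isAdmissible {k : Plane → Plane → Plane} {C₁ C₂ C₃ A B : ℝ} {p : ℝ≥0∞}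
    {ω : Plane → ℝ} (hk : D.KernelEstimates k C₁ C₂) (hdiv : D.BoundedDivNoFlow k p C₃)
    (hp : 1 ≤ p) (hC₁ : 0 ≤ C₁) (hC₂ : 0 ≤ C₂) (hC₃ : 0 ≤ C₃) (hA : 0 ≤ A) (hB : 0 ≤ B)
    (hω : D.IsVorticity A B ω) :
    D.IsAdmissible (velocityConst C₁ C₂ * (A + B)) (C₃ * A)
      (D.carrier.indicator (D.velocityOf k ω)) := by
  have hm := hk.measurable_velocity hC₁ hC₂ hA hB hω
  have hM : 0 ≤ velocityConst C₁ C₂ * (A + B) := by unfold velocityConst; positivity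
  have hbd : ∀ x, ‖D.carrier.indicator (D.velocityOf k ω) x‖ ≤ velocityConst C₁ C₂ * (A + B) := by
    intro x
    by_cases hx : x ∈ D.carrier
    · rw [indicator_of_mem hx]; exact hk.norm_velocityOf_le_const hC₁ hC₂ hA hB hω hx
    · rw [indicator_of_notMem hx]; simpa using hM
  have hll : ∀ x ∈ D.carrier, ∀ y ∈ D.carrier, ‖D.carrier.indicator (D.velocityOf k ω) x -
      D.carrier.indicator (D.velocityOf k ω) y‖ ≤
        velocityConst C₁ C₂ * (A + B) * logLipModulus ‖x - y‖ := by
    intro x hx y hy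
    rw [indicator_of_mem hx, indicator_of_mem hy]
    refine (hk.norm_velocityOf_sub_le hC₁ hC₂ hA hB hω hx hy).trans ?_
    exact mul_le_mul_of_nonneg_left (logLipModulus_mono (D.distance_nonneg _ _)
      (D.distance_le_norm x y)) hM
  refine ⟨hm, hbd, hll, fun x l hl => ?_, fun ε ρ hρ x hx => ?_, fun x hx z hz y hy hmin => ?_⟩
  · by_cases hx : x ∈ D.carrier
    · rw [indicator_of_mem hx, indicator_of_mem (D.add_mem_carrier hx hl),
        hk.velocityOf_periodic hx hl]
    · rw [indicator_of_notMem hx, indicator_of_notMem (by rwa [D.add_mem_carrier_iff hl])]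
  · obtain ⟨g, -, hg, hgd⟩ := hdiv.divergence ω (hω.inL1LpUl hp)
    refine abs_divergence_mollify_le hρ (mul_nonneg hC₃ hA) hgd (hg.trans ?_) hm hbd
      (fun x hx l hl => hk.velocityOf_periodic hx hl) hx
    rw [ENNReal.ofReal_mul hC₃]
    gcongr
    rw [eLpNorm_one_eq_lintegral_enorm]
    exact hω.l1
  · obtain ⟨hfr, hν⟩ := isInnerUnitNormal_of_nearest D.hasC1Boundary hz hy hmin
    have hlim := hdiv.no_flow ω (hω.inL1LpUl hp) y hfr _ hν
    have hzy : 0 < ‖z - y‖ := norm_pos_iff.2 (sub_ne_zero.2 (by rintro rfl; exact hy hz))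
    have hlim' : Tendsto (fun x => inner ℝ (‖z - y‖⁻¹ • (z - y))
        (D.carrier.indicator (D.velocityOf k ω) x)) (𝓝[D.carrier] y) (𝓝 0) := by
      refine hlim.congr' ?_
      filter_upwards [self_mem_nhdsWithin] with x hx
      rw [indicator_of_mem hx]
    have h1 := neg_mul_logLipModulus_le_inner hll hx hfr.1
      (by rw [norm_smul, norm_inv, norm_norm, inv_mul_cancel₀ hzy.ne']) hlim'
    rw [inner_smul_left] at h1
    simp only [map_inv₀, RCLike.conj_to_real] at h1
    have h2 := mul_le_mul_of_nonneg_left h1 hzy.le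
    rw [← mul_assoc, mul_inv_cancel₀ hzy.ne', one_mul] at h2
    linarith

end FluidDomain

end EulerVorticity
end

/-! ### The Lagrangian Euler scheme. -/

noncomputable section

namespace EulerVorticity
namespace FluidDomain

variable {D : FluidDomain}

/-- `ω` is the vorticity `ω₀` on `S` transported by `Y`. -/
def TransportsTo (D : FluidDomain) (A B : ℝ) (ω₀ : Plane → ℝ) (S : Set Plane) (Y : Plane → Plane)
    (ω : Plane → ℝ) : Prop :=
  (∀ Λ, 0 ≤ Λ → CompressesBy (ENNReal.ofReal Λ) S Y → D.IsVorticity A (Λ * B) ω) ∧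
  ∀ φ : Plane → ℝ, Measurable φ → D.Periodic φ → (∃ M : ℝ, ∀ x, |φ x| ≤ M) →
    ∫ x, ω x * φ x ∂D.measure = ∫ x in S, ω₀ x * φ (Y x) ∂D.measure

/-- The explicit Euler scheme for the vorticity equation with mollified velocity, in Lagrangian
form. Particles which come too close to the boundary are discarded. -/
structure IsEulerScheme (D : FluidDomain) (K : (Plane → ℝ) → Plane → Plane) (A B : ℝ)
    (ω₀ : Plane → ℝ) (ρ : Plane → ℝ) (ε h : ℝ) (X : ℕ → Plane → Plane) (S : ℕ → Set Plane)
    (ω : ℕ → Plane → ℝ) : Prop where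
  zero_map : ∀ x, X 0 x = x
  zero_set : S 0 = D.carrier
  succ_map : ∀ j x, X (j + 1) x = X j x + h • mollify ρ (K (ω j)) (X j x)
  succ_set : ∀ j, S (j + 1) = S j ∩ X j ⁻¹' D.deep (2 * ε)
  transports : ∀ j, D.IsTransport (S j) (X j) →
    (∃ Λ : ℝ, 0 ≤ Λ ∧ CompressesBy (ENNReal.ofReal Λ) (S j) (X j)) →
    D.TransportsTo A B ω₀ (S j) (X j) (ω j)

lemma exists_isEulerScheme (K : (Plane → ℝ) → Plane → Plane) {A B : ℝ} (hB : 0 ≤ B)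
    {ω₀ : Plane → ℝ} (hω₀ : D.IsVorticity A B ω₀) (ρ : Plane → ℝ) (ε h : ℝ) :
    ∃ X S ω, IsEulerScheme D K A B ω₀ ρ ε h X S ω := by
  have h1 : ∀ q : (Plane → Plane) × Set Plane, ∃ ω : Plane → ℝ, D.IsTransport q.2 q.1 →
      (∃ Λ : ℝ, 0 ≤ Λ ∧ CompressesBy (ENNReal.ofReal Λ) q.2 q.1) →
      D.TransportsTo A B ω₀ q.2 q.1 ω := by
    rintro ⟨Y, S⟩
    by_cases hT : D.IsTransport S Y ∧
      ∃ Λ : ℝ, 0 ≤ Λ ∧ CompressesBy (ENNReal.ofReal Λ) S Y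
    · obtain ⟨ω, -, h2, h3⟩ := exists_transported_vorticity (Y := fun _ => Y)
        (hT.1.measurable.comp measurable_snd) (fun _ => hT.1) (fun _ => hT.2) hB hω₀
      exact ⟨ω 0, fun _ _ => ⟨h2 0, h3 0⟩⟩
    · exact ⟨0, fun h2 h3 => (hT ⟨h2, h3⟩).elim⟩
  choose F hF using h1
  let q : ℕ → (Plane → Plane) × Set Plane := fun j => Nat.rec (id, D.carrier)
    (fun _ q => (fun x => q.1 x + h • mollify ρ (K (F q)) (q.1 x), q.2 ∩ q.1 ⁻¹' D.deep (2 * ε))) j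
  exact ⟨fun j => (q j).1, fun j => (q j).2, fun j => F (q j), fun x => rfl, rfl,
    fun j x => rfl, fun j => rfl, fun j => hF (q j)⟩

/-- The bound of the velocity up to the time `T`. -/
def velBound (C A B c T : ℝ) : ℝ := C * (A + Real.exp ((c + 1) * T) * B)

lemma velBound_nonneg {C A B c : ℝ} (hC : 0 ≤ C) (hA : 0 ≤ A) (hB : 0 ≤ B) (T : ℝ) :
    0 ≤ velBound C A B c T := by unfold velBound; positivity

lemma velBound_mono {C A B c T T' : ℝ} (hC : 0 ≤ C) (hB : 0 ≤ B) (hc : 0 ≤ c)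
    (h : T ≤ T') : velBound C A B c T ≤ velBound C A B c T' := by
  unfold velBound; gcongr

/-- The smallness conditions on the parameters of the Euler scheme. -/
structure IsFine (ρ : Plane → ℝ) (ε h κ c M : ℝ) : Prop where
  eps_pos : 0 < ε
  eps_le : ε ≤ κ
  kappa_pos : 0 < κ
  kappa_le : κ ≤ 1
  mollifier : IsMollifier ε ρ
  step_pos : 0 < h
  step_lip : h * (gradientMass ρ * M) < 1
  step_exp : Real.exp (-(h * (c + κ))) ≤ 1 - h * c - 2 * (h * (gradientMass ρ * M)) ^ 2
  step_le : h * M ≤ ε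
  step_sq : h * M ^ 2 ≤ 4 * ε ^ 2
  step_osgood : 2 * (2 * M + 1) * h ≤ 1

lemma eventually_mul_lt {a b : ℝ} (hb : 0 < b) : ∀ᶠ h : ℝ in 𝓝[>] 0, h * a < b := by
  have : Continuous fun h : ℝ => h * a := by fun_prop
  have h1 := (this.tendsto 0).mono_left (nhdsWithin_le_nhds (s := Ioi 0))
  exact h1.eventually_lt_const (by simpa using hb)

/-- The mollifier is fixed first, with `ε = κ`. Its gradient mass is then a constant, and every
remaining condition holds for small `h > 0`. -/
lemma exists_isFine {κ c M : ℝ} (hκ : 0 < κ) (hκ1 : κ ≤ 1) (hc : 0 ≤ c) :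
    ∃ ρ ε h, IsFine ρ ε h κ c M := by
  obtain ⟨ρ, hρ⟩ := exists_isMollifier hκ
  set L := gradientMass ρ * M
  have h1 := eventually_mul_lt (a := L) one_pos
  have h2 := eventually_mul_lt (a := M) hκ
  have h3 := eventually_mul_lt (a := M ^ 2) (b := 4 * κ ^ 2) (by positivity)
  have h4 := eventually_mul_lt (a := 2 * (2 * M + 1)) one_pos
  have h5 := eventually_mul_lt (a := (c + κ) ^ 2 + 2 * L ^ 2) hκ
  obtain ⟨h, h1, h2, h3, h4, h5, hpos⟩ :=
    (h1.and (h2.and (h3.and (h4.and (h5.and self_mem_nhdsWithin))))).exists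
  have hpos : 0 < h := hpos
  refine ⟨ρ, κ, h, hκ, le_rfl, hκ, hκ1, hρ, hpos, h1, ?_, h2.le, h3.le, by linarith⟩
  have hx : 0 ≤ h * (c + κ) := by positivity
  -- `exp (-x) ≤ 1 - x + x²` follows from `(1 - x + x²) (1 + x) = 1 + x³`. The term `h κ` left over
  -- then pays for `h² (c + κ)²` and for the quadratic error of the Jacobian.
  have e1 : Real.exp (-(h * (c + κ))) ≤ 1 - h * (c + κ) + (h * (c + κ)) ^ 2 := by
    have h6 := Real.add_one_le_exp (h * (c + κ))
    rw [Real.exp_neg, inv_le_iff_one_le_mul₀ (Real.exp_pos _)]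
    generalize h * (c + κ) = x at *
    have h7 : 0 < 1 - x + x ^ 2 := by nlinarith [sq_nonneg (x - 1)]
    calc (1 : ℝ) ≤ (1 - x + x ^ 2) * (x + 1) := by nlinarith [pow_nonneg hx 3]
      _ ≤ _ := by gcongr
  have e2 : h * (h * ((c + κ) ^ 2 + 2 * L ^ 2)) ≤ h * κ := by gcongr
  nlinarith

section Scheme

variable {K : (Plane → ℝ) → Plane → Plane} {A B C c : ℝ} {ω₀ : Plane → ℝ} {ρ : Plane → ℝ}
  {ε h κ N : ℝ} {X : ℕ → Plane → Plane} {S : ℕ → Set Plane} {ω : ℕ → Plane → ℝ}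

/-- The loop of a priori bounds, by induction on the step. Compression up to step `j` bounds the
vorticity, hence the velocity is admissible. The next step acts only on points of depth `2 ε`, where
the mollified divergence is at most `c`, so it multiplies the compression factor by at most `exp (h
(c + κ))`. -/
lemma IsEulerScheme.invariants (hX : IsEulerScheme D K A B ω₀ ρ ε h X S ω)
    (hf : IsFine ρ ε h κ c (velBound C A B c N)) (hC : 0 ≤ C) (hB : 0 ≤ B) (hc : 0 ≤ c)
    (hK : ∀ B' ω, 0 ≤ B' → D.IsVorticity A B' ω → D.IsAdmissible (C * (A + B')) c (K ω)) :
    ∀ j : ℕ, j * h ≤ N → D.IsTransport (S j) (X j) ∧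
      CompressesBy (ENNReal.ofReal (Real.exp ((c + κ) * (j * h)))) (S j) (X j) ∧
      D.IsVorticity A (Real.exp ((c + κ) * (j * h)) * B) (ω j) ∧
      D.IsAdmissible (velBound C A B c (j * h)) c (K (ω j)) := by
  have hadm : ∀ j : ℕ, D.IsTransport (S j) (X j) →
      CompressesBy (ENNReal.ofReal (Real.exp ((c + κ) * (j * h)))) (S j) (X j) →
      D.IsVorticity A (Real.exp ((c + κ) * (j * h)) * B) (ω j) ∧
      D.IsAdmissible (velBound C A B c (j * h)) c (K (ω j)) := by
    intro j h1 h2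
    have h3 := (hX.transports j h1 ⟨_, (Real.exp_pos _).le, h2⟩).1 _ (Real.exp_pos _).le h2
    refine ⟨h3, (hK _ _ (by positivity) h3).mono ?_⟩
    -- The rate `c + 1` in `velBound` leaves room for `c + κ` with `κ ≤ 1`, so the bound does not
    -- depend on `κ`.
    unfold velBound
    have := hf.step_pos.le
    have := hf.kappa_le
    gcongr
  intro j
  induction j with
  | zero =>
    intro _
    have h1 : D.IsTransport (S 0) (X 0) := by
      have : X 0 = id := funext hX.zero_map
      rw [hX.zero_set, this]
      exact ⟨D.measurableSet_carrier, Subset.rfl, fun x hx l hl => D.add_mem_carrier hx hl,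
        measurable_id, fun x hx => hx, fun _ _ _ _ => rfl⟩
    have h2 : CompressesBy (ENNReal.ofReal (Real.exp ((c + κ) * ((0 : ℕ) * h)))) (S 0) (X 0) := by
      intro E _
      have : X 0 = id := funext hX.zero_map
      simp only [Nat.cast_zero, zero_mul, mul_zero, Real.exp_zero, ENNReal.ofReal_one,
        one_mul, this]
      exact measure_mono inter_subset_right
    exact ⟨h1, h2, hadm 0 h1 h2⟩
  | succ j ih =>
    intro hj
    have hj' : (j : ℝ) * h ≤ N := by
      push_cast at hj; nlinarith [hf.step_pos]
    obtain ⟨h1, h2, h3, h4⟩ := ih hj'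
    have h4 := h4.mono (velBound_mono hC hB hc hj')
    set b := mollify ρ (K (ω j)) with hb
    have hbC := hf.mollifier.contDiff_mollify h4.measurable h4.norm_le
    have hbm : Measurable b := hbC.continuous.measurable
    have hbn : ∀ x, ‖h • b x‖ ≤ ε := fun x => by
      rw [norm_smul, Real.norm_of_nonneg hf.step_pos.le]
      exact (mul_le_mul_of_nonneg_left (hf.mollifier.norm_mollify_le h4.measurable h4.norm_le x)
        hf.step_pos.le).trans hf.step_le
    have hdeep : MeasurableSet (D.deep (2 * ε)) := (isClosed_deep _).measurableSet
    have hXs : X (j + 1) = fun x => X j x + h • b (X j x) := funext (hX.succ_map j)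
    have hT : D.IsTransport (S (j + 1)) (X (j + 1)) := by
      rw [hX.succ_set, hXs]
      refine ⟨h1.measurableSet.inter (h1.measurable hdeep), inter_subset_left.trans h1.subset,
        fun x hx l hl => ⟨h1.add_mem x hx.1 l hl, ?_⟩,
        h1.measurable.add ((hbm.comp h1.measurable).const_smul h), fun x hx => ?_,
        fun x hx l hl => ?_⟩
      · rw [mem_preimage, h1.equivariant x hx.1 l hl]
        exact add_mem_deep hx.2 hl
      · exact deep_subset_carrier (by linarith [hf.eps_pos]) (deep_translate hx.2 (hbn _))
      · simp only [h1.equivariant x hx.1 l hl, hb,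
          mollify_add_of_periodic (fun y => h4.periodic y l hl)]
        abel
    have hCo : CompressesBy (ENNReal.ofReal (Real.exp ((c + κ) * ((j + 1 : ℕ) * h))))
        (S (j + 1)) (X (j + 1)) := by
      intro E hE
      have e1 : S (j + 1) ∩ X (j + 1) ⁻¹' E =
          S j ∩ X j ⁻¹' (D.deep (2 * ε) ∩ (fun x => x + h • b x) ⁻¹' E) := by
        rw [hX.succ_set, hXs]; ext x; simp [and_assoc]
      have hm : Measurable fun x => x + h • b x := measurable_id.add (hbm.const_smul h)
      have h5 := volume_euler_step_le hbC
        (fun x => hf.mollifier.norm_fderiv_mollify_le h4.measurable h4.norm_le x)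
        hf.step_pos.le hf.step_lip hdeep (fun x hx => h4.divergence ε ρ hf.mollifier x
          (closedBall_subset_of_mem_deep hx (by linarith [hf.eps_pos]))) hE
      have h6 : volume (D.deep (2 * ε) ∩ (fun x => x + h • b x) ⁻¹' E) ≤
          ENNReal.ofReal (Real.exp (h * (c + κ))) * volume E := by
        calc _ = ENNReal.ofReal (Real.exp (h * (c + κ))) * (ENNReal.ofReal
                (Real.exp (-(h * (c + κ)))) *
                  volume (D.deep (2 * ε) ∩ (fun x => x + h • b x) ⁻¹' E)) := by
              rw [← mul_assoc, ← ENNReal.ofReal_mul (Real.exp_pos _).le, ← Real.exp_add]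
              simp
          _ ≤ _ := by
              gcongr
              refine le_trans ?_ h5
              gcongr
              exact hf.step_exp
      rw [e1]
      calc _ ≤ ENNReal.ofReal (Real.exp ((c + κ) * (j * h))) *
            volume (D.deep (2 * ε) ∩ (fun x => x + h • b x) ⁻¹' E) := h2 _ (hdeep.inter (hm hE))
        _ ≤ ENNReal.ofReal (Real.exp ((c + κ) * (j * h))) *
            (ENNReal.ofReal (Real.exp (h * (c + κ))) * volume E) := by gcongr
        _ = _ := by
            rw [← mul_assoc, ← ENNReal.ofReal_mul (Real.exp_pos _).le, ← Real.exp_add]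
            congr 3; push_cast; ring
    exact ⟨hT, hCo, hadm _ hT hCo⟩

lemma IsEulerScheme.antitone (hX : IsEulerScheme D K A B ω₀ ρ ε h X S ω) : Antitone S :=
  antitone_nat_of_succ_le fun j => by rw [hX.succ_set]; exact inter_subset_left

lemma IsEulerScheme.mem_deep (hX : IsEulerScheme D K A B ω₀ ρ ε h X S ω) {i j : ℕ} (hij : i < j)
    {x : Plane} (hx : x ∈ S j) : X i x ∈ D.deep (2 * ε) := by
  have h1 := hX.antitone (Nat.succ_le_of_lt hij) hx
  rw [Nat.succ_eq_add_one, hX.succ_set] at h1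
  exact h1.2

/-- The mollified velocity has the same modulus of continuity away from the boundary. -/
lemma IsAdmissible.norm_mollify_sub_le {M : ℝ} {u : Plane → Plane} (hu : D.IsAdmissible M c u)
    (hρ : IsMollifier ε ρ) (hε : 0 < ε) {x y : Plane} (hx : x ∈ D.deep (2 * ε))
    (hy : y ∈ D.deep (2 * ε)) :
    ‖mollify ρ u x - mollify ρ u y‖ ≤ M * logLipModulus ‖x - y‖ := by
  refine hρ.norm_mollify_sub_le hu.measurable hu.norm_le hu.measurable hu.norm_le fun w hw => ?_
  have h1 : ∀ z ∈ D.deep (2 * ε), z - w ∈ D.carrier := fun z hz => by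
    rw [sub_eq_add_neg]
    exact deep_subset_carrier (by linarith) (deep_translate hz (by rwa [norm_neg] : ‖-w‖ ≤ ε))
  have := hu.logLip _ (h1 x hx) _ (h1 y hy)
  rwa [sub_sub_sub_cancel_right] at this

lemma IsAdmissible.norm_mollify_sub_self_le {M : ℝ} {u : Plane → Plane}
    (hu : D.IsAdmissible M c u) (hρ : IsMollifier ε ρ) (hε : 0 < ε) {x : Plane}
    (hx : x ∈ D.deep (2 * ε)) :
    ‖mollify ρ u x - u x‖ ≤ M * logLipModulus ε := by
  have hM : 0 ≤ M := (norm_nonneg _).trans (hu.norm_le 0)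
  refine hρ.norm_mollify_sub_self_le hu.measurable hu.norm_le fun w hw => ?_
  have h1 : x - w ∈ D.carrier := by
    rw [sub_eq_add_neg]
    exact deep_subset_carrier (by linarith) (deep_translate hx (by rwa [norm_neg] : ‖-w‖ ≤ ε))
  refine (hu.logLip _ h1 _ (deep_subset_carrier (by linarith) hx)).trans ?_
  rw [sub_sub_cancel_left, norm_neg]
  exact mul_le_mul_of_nonneg_left (logLipModulus_mono (norm_nonneg _) hw) hM

/-- One Euler step decreases the distance to the boundary at most at an Osgood rate. -/
lemma IsAdmissible.infDist_le {M : ℝ} {u : Plane → Plane} (hu : D.IsAdmissible M c u)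
    (hρ : IsMollifier ε ρ) (hε : 0 < ε) (hε1 : ε ≤ 1) (hh : 0 < h) (hhM : h * M ≤ ε)
    (hhM2 : h * M ^ 2 ≤ 4 * ε ^ 2) (hne : (D.carrierᶜ).Nonempty) {x : Plane}
    (hx : x ∈ D.deep (2 * ε)) (hx' : x + h • mollify ρ u x ∈ D.deep (2 * ε)) :
    Metric.infDist x D.carrierᶜ ≤ Metric.infDist (x + h • mollify ρ u x) D.carrierᶜ +
      h * ((2 * M + 1) *
        logLipModulus (Metric.infDist (x + h • mollify ρ u x) D.carrierᶜ)) := by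
  set b := mollify ρ u x with hb
  set z := x + h • b with hz
  have hM : 0 ≤ M := (norm_nonneg _).trans (hu.norm_le 0)
  -- The nearest exterior point is taken for the new position `z`. The old distance is then
  -- estimated by the new one, as needed to run the Osgood lemma backward in time.
  obtain ⟨y, hy, hyd⟩ := D.isOpen_carrier.isClosed_compl.exists_infDist_eq_dist hne z
  have hmin : ∀ y', y' ∉ D.carrier → ‖z - y‖ ≤ ‖z - y'‖ := fun y' hy' => by
    rw [← dist_eq_norm, ← dist_eq_norm, ← hyd]
    exact Metric.infDist_le_dist_of_mem hy'
  rw [hyd, dist_eq_norm]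
  set s := ‖z - y‖ with hs
  have hs2 : 2 * ε ≤ s := hx' y hy
  have hs0 : 0 < s := by linarith
  have hbn : ‖b‖ ≤ M := hρ.norm_mollify_le hu.measurable hu.norm_le x
  have hxy : x - y = (z - y) - h • b := by rw [hz]; abel
  have hxy1 : ‖x - y‖ ≤ s + ε := by
    rw [hxy]
    refine (norm_sub_le _ _).trans ?_
    rw [norm_smul, Real.norm_of_nonneg hh.le]
    have : h * ‖b‖ ≤ h * M := by gcongr
    linarith
  have hls := logLipModulus_nonneg hs0.le
  -- The mollification averages `u` over points `x - w` with `‖x - w - y‖ ≤ s + 2 ε ≤ 2 s`, where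
  -- the normal component is controlled by `ℓ(2 s) ≤ 2 ℓ(s)`.
  have hinner : inner ℝ (-(z - y)) b ≤ s * (M * (2 * logLipModulus s)) := by
    refine hρ.inner_mollify_le hu.measurable hu.norm_le fun w hw => ?_
    have h1 : x - w ∈ D.carrier := by
      rw [sub_eq_add_neg]
      exact deep_subset_carrier (by linarith) (deep_translate hx (by rwa [norm_neg] : ‖-w‖ ≤ ε))
    have h2 := hu.normal (x - w) h1 z (deep_subset_carrier (by linarith) hx') y hy hmin
    rw [inner_neg_left]
    have h3 : logLipModulus ‖x - w - y‖ ≤ 2 * logLipModulus s := by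
      refine le_trans (logLipModulus_mono (norm_nonneg _) ?_) (logLipModulus_two_mul_le hs0.le)
      have : ‖x - w - y‖ ≤ ‖x - y‖ + ‖w‖ := by
        rw [sub_right_comm]; exact norm_sub_le _ _
      linarith
    have h4 : s * (M * logLipModulus ‖x - w - y‖) ≤ s * (M * (2 * logLipModulus s)) := by gcongr
    linarith
  rw [inner_neg_left] at hinner
  refine (Metric.infDist_le_dist_of_mem hy).trans ?_
  rw [dist_eq_norm]
  -- Squares are compared. The cross term gives the part `2 M` of the rate. The quadratic term is at
  -- most `4 h ε² ≤ 2 h s ℓ(s)`, which is the additional `1`.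
  refine abs_le_of_sq_le_sq' ?_ (by positivity) |>.2
  rw [hxy, norm_sub_sq_real, inner_smul_right, norm_smul, mul_pow, Real.norm_eq_abs, sq_abs,
    ← hs]
  have hεs : ε ≤ logLipModulus s :=
    (le_logLipModulus hε.le hε1).trans (logLipModulus_mono hε.le (by linarith))
  have hb2 : h ^ 2 * ‖b‖ ^ 2 ≤ h * (4 * ε ^ 2) := by
    calc h ^ 2 * ‖b‖ ^ 2 ≤ h ^ 2 * M ^ 2 := by gcongr
      _ = h * (h * M ^ 2) := by ring
      _ ≤ _ := by gcongr
  have h5 : h * (4 * ε ^ 2) ≤ h * (2 * s * logLipModulus s) := by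
    refine mul_le_mul_of_nonneg_left ?_ hh.le
    have := mul_le_mul hs2 hεs hε.le hs0.le
    nlinarith
  have h6 : h * (-(inner ℝ (z - y) b)) ≤ h * (s * (M * (2 * logLipModulus s))) := by gcongr
  have h7 : 0 ≤ (h * ((2 * M + 1) * logLipModulus s)) ^ 2 := sq_nonneg _
  nlinarith

end Scheme

end FluidDomain

end EulerVorticity
end

noncomputable section

namespace EulerVorticity
/-! ### Integrals of step functions -/

lemma floor_div_eq {h s : ℝ} (hh : 0 < h) {j : ℕ} (h1 : j * h ≤ s) (h2 : s < (j + 1) * h) :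
    ⌊s / h⌋₊ = j := by
  have hs : 0 ≤ s := le_trans (by positivity) h1
  rw [Nat.floor_eq_iff (by positivity), le_div_iff₀ hh, div_lt_iff₀ hh]
  exact ⟨h1, h2⟩

lemma integral_step_piece {h r : ℝ} (hh : 0 < h) (f : ℕ → Plane) {j : ℕ} (h1 : j * h ≤ r)
    (h2 : r ≤ (j + 1) * h) :
    IntervalIntegrable (fun s => f ⌊s / h⌋₊) volume (j * h) r ∧
      ∫ s in (j * h)..r, f ⌊s / h⌋₊ = (r - j * h) • f j := by
  have hcongr : EqOn (fun _ => f j) (fun s => f ⌊s / h⌋₊) (Ioo (j * h) r) := fun s hs => by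
    simp only [floor_div_eq hh hs.1.le (hs.2.trans_le h2)]
  constructor
  · rw [intervalIntegrable_iff_integrableOn_Ioo_of_le h1]
    refine IntegrableOn.congr_fun ?_ hcongr measurableSet_Ioo
    exact integrableOn_const (by simp)
  · rw [intervalIntegral.integral_of_le h1, integral_Ioc_eq_integral_Ioo,
      ← setIntegral_congr_fun measurableSet_Ioo hcongr, setIntegral_const]
    simp [Measure.real, Real.volume_Ioo, h1]

lemma integral_step {h t : ℝ} (hh : 0 < h) (ht : 0 ≤ t) (f : ℕ → Plane) :
    ∫ s in (0 : ℝ)..t, f ⌊s / h⌋₊ =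
      ∑ j ∈ Finset.range ⌊t / h⌋₊, h • f j + (t - ⌊t / h⌋₊ * h) • f ⌊t / h⌋₊ := by
  set J := ⌊t / h⌋₊ with hJ
  have h1 : (J : ℝ) * h ≤ t := by
    rw [← le_div_iff₀ hh]; exact Nat.floor_le (by positivity)
  have h2 : t ≤ (J + 1) * h := by
    rw [← div_le_iff₀ hh]; exact (Nat.lt_floor_add_one _).le
  have hp : ∀ j : ℕ, IntervalIntegrable (fun s => f ⌊s / h⌋₊) volume (j * h) ((j + 1 : ℕ) * h) ∧
      ∫ s in (j * h)..((j + 1 : ℕ) * h), f ⌊s / h⌋₊ = h • f j := fun j => by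
    have := integral_step_piece hh f (j := j) (r := (j + 1 : ℕ) * h) (by push_cast; nlinarith)
      (by push_cast; rfl)
    refine ⟨this.1, this.2.trans ?_⟩
    congr 1; push_cast; ring
  have hsum := intervalIntegral.sum_integral_adjacent_intervals (a := fun j : ℕ => (j : ℝ) * h)
    (n := J) (fun j _ => (hp j).1)
  have hint := IntervalIntegrable.trans_iterate (a := fun j : ℕ => (j : ℝ) * h) (n := J)
    (fun j _ => (hp j).1)
  have hlast := integral_step_piece hh f h1 h2
  simp only [Nat.cast_zero, zero_mul] at hsum hint
  rw [← intervalIntegral.integral_add_adjacent_intervals hint hlast.1, ← hsum, hlast.2]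
  congr 1
  exact Finset.sum_congr rfl fun j _ => (hp j).2

/-! ### Approximate solutions in continuous time. -/

namespace FluidDomain

variable {D : FluidDomain}

/-- Approximate solutions up to the time `N` with an error of order `κ`. -/
structure IsApproxSolution (D : FluidDomain) (K : (Plane → ℝ) → Plane → Plane) (A B C c : ℝ)
    (ω₀ : Plane → ℝ) (κ N : ℝ) (X : ℝ → Plane → Plane) (S : ℝ → Set Plane)
    (ω : ℝ → Plane → ℝ) : Prop where
  transport : ∀ t, 0 ≤ t → t ≤ N → D.IsTransport (S t) (X t)
  compresses : ∀ t, 0 ≤ t → t ≤ N →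
    CompressesBy (ENNReal.ofReal (Real.exp ((c + κ) * t))) (S t) (X t)
  vorticity : ∀ t, 0 ≤ t → t ≤ N → D.IsVorticity A (Real.exp ((c + κ) * t) * B) (ω t)
  push : ∀ t, 0 ≤ t → t ≤ N → ∀ φ : Plane → ℝ, Measurable φ → D.Periodic φ →
    (∃ M : ℝ, ∀ x, |φ x| ≤ M) →
      ∫ x, ω t x * φ x ∂D.measure = ∫ x in S t, ω₀ x * φ (X t x) ∂D.measure
  initial : ∀ x, X 0 x = x
  displacement : ∀ s t T, 0 ≤ s → s ≤ t → t ≤ T → T ≤ N → ∀ x ∈ S t,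
    ‖X t x - X s x‖ ≤ velBound C A B c T * (t - s) + κ
  measurable_velocity : ∀ x, Measurable fun s => K (ω s) (X s x)
  integral_eq : ∀ t, 0 ≤ t → t ≤ N → ∀ x ∈ S t,
    ‖X t x - x - ∫ s in (0 : ℝ)..t, K (ω s) (X s x)‖ ≤
      (velBound C A B c t * t + 1) * logLipModulus κ
  equicontinuous : ∀ T α η, 0 ≤ T → T ≤ N → OsgoodPair (velBound C A B c T) T α η →
    ∀ t, 0 ≤ t → t ≤ T → ∀ x ∈ S t, ∀ y ∈ S t, ‖x - y‖ ≤ α → ‖X t x - X t y‖ < η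
  survival : ∀ T α δ, 0 ≤ T → T ≤ N → OsgoodPair (2 * velBound C A B c T + 1) T α δ →
    3 * κ ≤ α → α ≤ δ → ∀ x ∈ D.deep δ, ∀ t, 0 ≤ t → t ≤ T → x ∈ S t ∧ X t x ∈ D.deep α

section

variable {K : (Plane → ℝ) → Plane → Plane} {A B C c : ℝ} {ω₀ : Plane → ℝ} {ρ : Plane → ℝ}
  {ε h κ N : ℝ} {X : ℕ → Plane → Plane} {S : ℕ → Set Plane} {ω : ℕ → Plane → ℝ}

lemma IsEulerScheme.norm_sub_le (hX : IsEulerScheme D K A B ω₀ ρ ε h X S ω) (hh : 0 ≤ h)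
    {M : ℝ} {i j : ℕ} (hij : i ≤ j) (hM : ∀ m < j, ∀ x, ‖mollify ρ (K (ω m)) x‖ ≤ M) (x : Plane) :
    ‖X j x - X i x‖ ≤ (j - i) * h * M := by
  induction j, hij using Nat.le_induction with
  | base => simp
  | succ j hij ih =>
    have h1 := ih fun m hm => hM m (by omega)
    rw [hX.succ_map]
    calc ‖X j x + h • mollify ρ (K (ω j)) (X j x) - X i x‖
        ≤ ‖X j x - X i x‖ + ‖h • mollify ρ (K (ω j)) (X j x)‖ := by
          rw [add_sub_right_comm]; exact norm_add_le _ _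
      _ ≤ (j - i) * h * M + h * M := by
          rw [norm_smul, Real.norm_of_nonneg hh]
          have := hM j (by omega) (X j x)
          gcongr
      _ = _ := by push_cast; ring

lemma IsEulerScheme.sub_eq_sum (hX : IsEulerScheme D K A B ω₀ ρ ε h X S ω) (j : ℕ) (x : Plane) :
    X j x - x = ∑ i ∈ Finset.range j, h • mollify ρ (K (ω i)) (X i x) := by
  induction j with
  | zero => simp [hX.zero_map]
  | succ j ih => rw [Finset.sum_range_succ, ← ih, hX.succ_map]; abel

/-- Particles alive at step `J` were at depth `2 ε` at all earlier steps, where the mollified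
velocity keeps the log-Lipschitz modulus. Their distance is therefore a discrete Osgood sequence. -/
lemma IsEulerScheme.equicontinuous (hX : IsEulerScheme D K A B ω₀ ρ ε h X S ω)
    (hρ : IsMollifier ε ρ) (hε : 0 < ε) (hh : 0 ≤ h) {M T α η : ℝ} (hMh : 2 * M * h ≤ 1) {J : ℕ}
    (hJ : J * h ≤ T) (hK : ∀ j < J, D.IsAdmissible M c (K (ω j))) (hO : OsgoodPair M T α η)
    {x y : Plane} (hx : x ∈ S J) (hy : y ∈ S J) (hxy : ‖x - y‖ ≤ α) :
    ‖X J x - X J y‖ < η := by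
  refine hO h J (fun j => ‖X j x - X j y‖) hh hMh hJ (fun j => norm_nonneg _) (fun j hj => ?_)
    (by simpa [hX.zero_map] using hxy) J le_rfl
  have h1 := (hK j hj).norm_mollify_sub_le hρ hε (hX.mem_deep hj hx) (hX.mem_deep hj hy)
  have e : X (j + 1) x - X (j + 1) y = (X j x - X j y) +
      h • (mollify ρ (K (ω j)) (X j x) - mollify ρ (K (ω j)) (X j y)) := by
    rw [hX.succ_map, hX.succ_map, smul_sub]; abel
  rw [e]
  refine (norm_add_le _ _).trans ?_
  rw [norm_smul, Real.norm_of_nonneg hh]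
  gcongr

/-- As long as the depth is at least `α ≥ 3 ε`, the next step is allowed and ends at depth at least
`2 ε`, so the estimate of `IsAdmissible.infDist_le` applies. If the depth fell below `α`, the Osgood
lemma applied to the reversed sequence of boundary distances would put the starting point at
distance less than `δ` from the complement. -/
lemma IsEulerScheme.survival (hX : IsEulerScheme D K A B ω₀ ρ ε h X S ω)
    (hρ : IsMollifier ε ρ) (hε : 0 < ε) (hε1 : ε ≤ 1) (hh : 0 < h) {M T α δ : ℝ}
    (hMh : 2 * (2 * M + 1) * h ≤ 1) (hhM : h * M ≤ ε) (hhM2 : h * M ^ 2 ≤ 4 * ε ^ 2) {J : ℕ}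
    (hJ : J * h ≤ T) (hK : ∀ j < J, D.IsAdmissible M c (K (ω j)))
    (hO : OsgoodPair (2 * M + 1) T α δ) (hα : 3 * ε ≤ α) (hαδ : α ≤ δ)
    {x : Plane} (hx : x ∈ D.deep δ) : ∀ j ≤ J, x ∈ S j ∧ X j x ∈ D.deep α := by
  intro j
  induction j using Nat.strong_induction_on with
  | _ j ih =>
  intro hj
  rcases j with _ | j
  · rw [hX.zero_set, hX.zero_map]
    exact ⟨deep_subset_carrier (by linarith) hx, deep_anti hαδ hx⟩
  have hjs := ih j (by omega) (by omega)
  have hS : x ∈ S (j + 1) := by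
    rw [hX.succ_set]; exact ⟨hjs.1, deep_anti (by linarith) hjs.2⟩
  refine ⟨hS, ?_⟩
  have hadj := hK j hj
  have hstep : ‖h • mollify ρ (K (ω j)) (X j x)‖ ≤ ε := by
    rw [norm_smul, Real.norm_of_nonneg hh.le]
    exact (mul_le_mul_of_nonneg_left (hρ.norm_mollify_le hadj.measurable hadj.norm_le _)
      hh.le).trans hhM
  have hdeep : ∀ i ≤ j + 1, X i x ∈ D.deep (2 * ε) := by
    intro i hi
    rcases Nat.lt_or_ge i (j + 1) with h1 | h1
    · exact deep_anti (by linarith) (ih i h1 (by omega)).2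
    · rw [le_antisymm hi h1, hX.succ_map]
      exact deep_anti (by linarith) (deep_translate hjs.2 hstep)
  intro y hy
  by_contra hlt
  have hlt := not_le.1 hlt
  have hne : (D.carrierᶜ).Nonempty := ⟨y, hy⟩
  have h1 : Metric.infDist (X (j + 1) x) D.carrierᶜ ≤ α :=
    ((Metric.infDist_le_dist_of_mem (x := X (j + 1) x) hy).trans_eq (dist_eq_norm _ _)).trans hlt.le
  have hM : 0 ≤ M := (norm_nonneg _).trans (hadj.norm_le 0)
  -- The distances in reversed order: the sequence starts at the final position, at most `α` from
  -- the complement, and ends at the initial point `x`.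
  have hfin := hO h (j + 1) (fun i => Metric.infDist (X (j + 1 - i) x) D.carrierᶜ) hh.le hMh
    (le_trans (by gcongr) hJ) (fun i => Metric.infDist_nonneg) (fun i hi => ?_) (by simpa using h1)
    (j + 1) le_rfl
  · simp only [Nat.sub_self, hX.zero_map] at hfin
    obtain ⟨y', hy', hyd⟩ := D.isOpen_carrier.isClosed_compl.exists_infDist_eq_dist hne x
    have := hx y' hy'
    rw [hyd, dist_eq_norm] at hfin
    linarith
  · obtain ⟨m, hm⟩ : ∃ m, j + 1 - i = m + 1 := ⟨j - i, by omega⟩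
    have hm' : j + 1 - (i + 1) = m := by omega
    simp only [hm, hm']
    have h2 := hdeep (m + 1) (by omega)
    rw [hX.succ_map] at h2 ⊢
    exact (hK m (by omega)).infDist_le hρ hε hε1 hh hhM hhM2 hne (hdeep m (by omega)) h2

lemma IsEulerScheme.isApproxSolution (hX : IsEulerScheme D K A B ω₀ ρ ε h X S ω)
    (hf : IsFine ρ ε h κ c (velBound C A B c N)) (hC : 0 ≤ C) (hA : 0 ≤ A) (hB : 0 ≤ B)
    (hc : 0 ≤ c)
    (hK : ∀ B' ω, 0 ≤ B' → D.IsVorticity A B' ω → D.IsAdmissible (C * (A + B')) c (K ω)) :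
    IsApproxSolution D K A B C c ω₀ κ N (fun t => X ⌊t / h⌋₊) (fun t => S ⌊t / h⌋₊)
      (fun t => ω ⌊t / h⌋₊) := by
  have hh := hf.step_pos
  have hfl : ∀ {t : ℝ}, 0 ≤ t → (⌊t / h⌋₊ : ℝ) * h ≤ t := fun ht => by
    rw [← le_div_iff₀ hh]; exact Nat.floor_le (by positivity)
  have hfl' : ∀ t : ℝ, t < (⌊t / h⌋₊ + 1 : ℝ) * h := fun t => by
    rw [← div_lt_iff₀ hh]; exact Nat.lt_floor_add_one _
  have inv : ∀ t, 0 ≤ t → t ≤ N → _ := fun t ht htN =>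
    hX.invariants hf hC hB hc hK ⌊t / h⌋₊ ((hfl ht).trans htN)
  have hexp : ∀ {t : ℝ}, 0 ≤ t →
      Real.exp ((c + κ) * (⌊t / h⌋₊ * h)) ≤ Real.exp ((c + κ) * t) := fun ht => by
    have := hf.kappa_pos
    gcongr
    exact hfl ht
  have hadm : ∀ {T : ℝ} {j : ℕ}, 0 ≤ T → T ≤ N → j ≤ ⌊T / h⌋₊ →
      D.IsAdmissible (velBound C A B c T) c (K (ω j)) := fun {T j} hT hTN hj => by
    have h1 : (j : ℝ) * h ≤ T := le_trans (by gcongr) (hfl hT)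
    exact (hX.invariants hf hC hB hc hK j (h1.trans hTN)).2.2.2.mono
      (velBound_mono hC hB hc h1)
  have hMT : ∀ {T : ℝ}, T ≤ N → velBound C A B c T ≤ velBound C A B c N :=
    fun hT => velBound_mono hC hB hc hT
  refine ⟨fun t ht htN => (inv t ht htN).1, fun t ht htN E hE => ?_, fun t ht htN => ?_,
    fun t ht htN => ?_, fun x => by simpa using hX.zero_map x,
    fun s t T hs hst htT hTN x hx => ?_, fun x => ?_, fun t ht htN x hx => ?_,
    fun T α η hT hTN hO t ht htT x hx y hy hxy => ?_,
    fun T α δ hT hTN hO hα hαδ x hx t ht htT => ?_⟩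
  · refine ((inv t ht htN).2.1 E hE).trans ?_
    exact mul_le_mul_left (ENNReal.ofReal_le_ofReal (hexp ht)) _
  · obtain ⟨h1, h2, h3⟩ := (inv t ht htN).2.2.1
    refine ⟨h1, h2, h3, ?_⟩
    rename_i h4
    exact h4.mono fun z hz => hz.trans (mul_le_mul_of_nonneg_right (hexp ht) hB)
  · exact (hX.transports _ (inv t ht htN).1 ⟨_, (Real.exp_pos _).le, (inv t ht htN).2.1⟩).2
  · have hT : 0 ≤ T := hs.trans (hst.trans htT)
    have h1 := hX.norm_sub_le hh.le (M := velBound C A B c T) (Nat.floor_mono (by gcongr) :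
      ⌊s / h⌋₊ ≤ ⌊t / h⌋₊) (fun m hm x => by
        have := hadm (j := m) hT hTN (hm.le.trans (Nat.floor_mono (by gcongr)))
        exact hf.mollifier.norm_mollify_le this.measurable this.norm_le x) x
    refine h1.trans ?_
    -- The approximate flow is piecewise constant in time. Rounding costs at most one additional
    -- step, whose length is at most `h M ≤ ε ≤ κ`.
    have h2 : ((⌊t / h⌋₊ : ℝ) - ⌊s / h⌋₊) * h ≤ (t - s) + h := by
      have := hfl (hs.trans hst); have := hfl' s; nlinarith
    have h3 : h * velBound C A B c T ≤ κ :=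
      (mul_le_mul_of_nonneg_left (hMT hTN) hh.le).trans (hf.step_le.trans hf.eps_le)
    calc _ ≤ ((t - s) + h) * velBound C A B c T :=
          mul_le_mul_of_nonneg_right h2 (velBound_nonneg hC hA hB T)
      _ ≤ _ := by nlinarith
  · have h1 : Measurable fun s : ℝ => ⌊s / h⌋₊ := Nat.measurable_floor.comp (by fun_prop)
    exact (measurable_from_nat (f := fun j => K (ω j) (X j x))).comp h1
  · set J := ⌊t / h⌋₊ with hJ
    rw [integral_step hh ht (fun j => K (ω j) (X j x)), hX.sub_eq_sum, ← hJ, ← sub_sub,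
      ← Finset.sum_sub_distrib]
    have hJh := hfl ht
    have hJh' := hfl' t
    rw [← hJ] at hJh hJh'
    have hMt := velBound_nonneg (c := c) hC hA hB t
    have hκ := hf.kappa_pos
    have hle : logLipModulus ε ≤ logLipModulus κ := logLipModulus_mono hf.eps_pos.le hf.eps_le
    have hl0 := logLipModulus_nonneg hκ.le
    -- Each complete step contributes the mollification error. The incomplete last step, estimated
    -- next, is at most `h M ≤ κ ≤ ℓ(κ)`.
    have h1 : ‖∑ j ∈ Finset.range J, (h • mollify ρ (K (ω j)) (X j x) - h • K (ω j) (X j x))‖ ≤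
        J * (h * (velBound C A B c t * logLipModulus κ)) := by
      refine (norm_sum_le_of_le (f := fun j => h • mollify ρ (K (ω j)) (X j x) -
        h • K (ω j) (X j x)) _ (n := fun _ => h * (velBound C A B c t * logLipModulus κ))
        fun j hj => ?_).trans (by simp)
      have hj : j < J := Finset.mem_range.1 hj
      rw [← smul_sub, norm_smul, Real.norm_of_nonneg hh.le]
      have := (hadm ht htN hj.le).norm_mollify_sub_self_le hf.mollifier hf.eps_pos
        (hX.mem_deep hj hx)
      exact mul_le_mul_of_nonneg_left (this.trans (by gcongr)) hh.le
    have h2 : ‖(t - J * h) • K (ω J) (X J x)‖ ≤ logLipModulus κ := by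
      rw [norm_smul, Real.norm_of_nonneg (by linarith)]
      have h3 := (hadm (j := J) ht htN le_rfl).norm_le (X J x)
      calc (t - J * h) * ‖K (ω J) (X J x)‖ ≤ h * velBound C A B c N := by
            refine mul_le_mul (by nlinarith) (h3.trans (hMT htN)) (norm_nonneg _) hh.le
        _ ≤ κ := hf.step_le.trans hf.eps_le
        _ ≤ _ := le_logLipModulus hκ.le hf.kappa_le
    refine (_root_.norm_sub_le _ _).trans ?_
    have h4 : J * (h * (velBound C A B c t * logLipModulus κ)) ≤
        t * (velBound C A B c t * logLipModulus κ) := by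
      rw [← mul_assoc]; gcongr
    linarith
  · have hJt : ⌊t / h⌋₊ ≤ ⌊T / h⌋₊ := Nat.floor_mono (by gcongr)
    refine hX.equicontinuous hf.mollifier hf.eps_pos hh.le ?_ ((hfl ht).trans htT)
      (fun j hj => hadm hT hTN (hj.le.trans hJt)) hO hx hy hxy
    have := hf.step_osgood
    have := hMT hTN
    have := velBound_nonneg (c := c) hC hA hB N
    nlinarith
  · have hJt : ⌊t / h⌋₊ ≤ ⌊T / h⌋₊ := Nat.floor_mono (by gcongr)
    have hM0 := velBound_nonneg (c := c) hC hA hB T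
    have hMN := hMT hTN
    refine hX.survival hf.mollifier hf.eps_pos (hf.eps_le.trans hf.kappa_le) hh ?_ ?_ ?_
      ((hfl ht).trans htT) (fun j hj => hadm hT hTN (hj.le.trans hJt)) hO
      (le_trans (by linarith [hf.eps_le]) hα) hαδ hx _ le_rfl
    · have := hf.step_osgood; nlinarith
    · exact (mul_le_mul_of_nonneg_left hMN hh.le).trans hf.step_le
    · refine le_trans ?_ hf.step_sq
      gcongr

lemma exists_isApproxSolution (hC : 0 ≤ C) (hA : 0 ≤ A) (hB : 0 ≤ B) (hc : 0 ≤ c)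
    (hω₀ : D.IsVorticity A B ω₀)
    (hK : ∀ B' ω, 0 ≤ B' → D.IsVorticity A B' ω → D.IsAdmissible (C * (A + B')) c (K ω))
    (hκ : 0 < κ) (hκ1 : κ ≤ 1) (N : ℝ) :
    ∃ X S ω, IsApproxSolution D K A B C c ω₀ κ N X S ω := by
  obtain ⟨ρ, ε, h, hf⟩ := exists_isFine (M := velBound C A B c N) hκ hκ1 hc
  obtain ⟨X, S, ω, hX⟩ := exists_isEulerScheme K hB hω₀ ρ ε h
  exact ⟨_, _, _, hX.isApproxSolution hf hC hA hB hc hK⟩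

end

end FluidDomain

end EulerVorticity
end

/-! ### Compactness and the limit flow. -/

noncomputable section

namespace EulerVorticity
namespace FluidDomain

variable {D : FluidDomain}

lemma OsgoodPair.anti {M T α α' η : ℝ} (h : OsgoodPair M T α η) (hα : α' ≤ α) :
    OsgoodPair M T α' η :=
  fun s N a h0 h1 h2 h3 h4 h5 => h s N a h0 h1 h2 h3 h4 (h5.trans hα)

section

variable {K : (Plane → ℝ) → Plane → Plane} {A B C c : ℝ} {ω₀ : Plane → ℝ} {κ N : ℕ → ℝ}
  {X : ℕ → ℝ → Plane → Plane} {S : ℕ → ℝ → Set Plane} {ω : ℕ → ℝ → Plane → ℝ}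

/-- The depth `α` provided by the Osgood lemma depends on `x` and `T` but not on the approximation.
Once `3 κ n ≤ α` the particle is never discarded up to time `T`. -/
lemma eventually_survival
    (hX : ∀ n, IsApproxSolution D K A B C c ω₀ (κ n) (N n) (X n) (S n) (ω n))
    (hκ : Tendsto κ atTop (𝓝 0)) (hN : Tendsto N atTop atTop) (hC : 0 ≤ C) (hA : 0 ≤ A)
    (hB : 0 ≤ B) {x : Plane} (hx : x ∈ D.carrier) {T : ℝ} (hT : 0 ≤ T) :
    ∃ α > 0, ∀ᶠ n in atTop, ∀ t, 0 ≤ t → t ≤ T → x ∈ S n t ∧ X n t x ∈ D.deep α := by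
  obtain ⟨δ, hδ, hxδ⟩ := exists_mem_deep hx
  have hM := velBound_nonneg (c := c) hC hA hB T
  obtain ⟨α, hα, hO⟩ := exists_osgoodPair (M := 2 * velBound C A B c T + 1) (T := T)
    (by positivity) hδ
  have hα' : 0 < min α δ := lt_min hα hδ
  refine ⟨min α δ, hα', ?_⟩
  filter_upwards [hκ.eventually_lt_const (show (0 : ℝ) < min α δ / 3 by positivity),
    hN.eventually_ge_atTop T] with n h1 h2
  exact (hX n).survival T _ δ hT h2 (OsgoodPair.anti hO (min_le_left _ _)) (by linarith)
    (min_le_right _ _) x hxδ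

/-- A subsequence converges at all nonnegative rational times and all points of a countable dense
set. Equicontinuity in space and the displacement bound in time, both uniform up to errors vanishing
with `κ`, make it Cauchy everywhere. -/
lemma exists_tendsto_subseq
    (hX : ∀ n, IsApproxSolution D K A B C c ω₀ (κ n) (N n) (X n) (S n) (ω n))
    (hκ : Tendsto κ atTop (𝓝 0)) (hN : Tendsto N atTop atTop) (hC : 0 ≤ C) (hA : 0 ≤ A)
    (hB : 0 ≤ B) :
    ∃ φ : ℕ → ℕ, StrictMono φ ∧ ∃ Y : ℝ → Plane → Plane, ∀ t, 0 ≤ t → ∀ x ∈ D.carrier,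
      Tendsto (fun n => X (φ n) t x) atTop (𝓝 (Y t x)) := by
  obtain ⟨Q, hQc, hQd⟩ := TopologicalSpace.exists_countable_dense D.carrier
  have := hQc.to_subtype
  let y : ℕ → (ℚ≥0 × Q) → Plane := fun n i => X n (i.1 : ℝ) ((i.2 : D.carrier) : Plane)
  have hbd : ∀ i, ∃ R, ∀ n, y n i ∈ Metric.closedBall (0 : Plane) R := by
    intro i
    have hx := (i.2 : D.carrier).2
    have hq : (0 : ℝ) ≤ (i.1 : ℝ) := NNRat.cast_nonneg _
    obtain ⟨α, -, hs⟩ := eventually_survival hX hκ hN hC hA hB hx hq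
    have h1 : IsBoundedUnder (· ≤ ·) atTop fun n => ‖y n i‖ := by
      refine ⟨velBound C A B c i.1 * i.1 + 1 + ‖((i.2 : D.carrier) : Plane)‖, ?_⟩
      rw [eventually_map]
      filter_upwards [hs, hκ.eventually_lt_const one_pos, hN.eventually_ge_atTop (i.1 : ℝ)]
        with n h1 h2 h3
      have h4 := (hX n).displacement 0 i.1 i.1 le_rfl hq le_rfl h3 _ (h1 _ hq le_rfl).1
      rw [(hX n).initial, sub_zero] at h4
      have h5 := norm_sub_norm_le (y n i) ((i.2 : D.carrier) : Plane)
      have h6 : ‖y n i - ((i.2 : D.carrier) : Plane)‖ ≤ _ := h4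
      linarith
    obtain ⟨R, hR⟩ := h1.bddAbove_range
    exact ⟨R, fun n => by simpa using hR (mem_range_self n)⟩
  choose R hR using hbd
  -- Tychonoff's theorem takes the place of the diagonal extraction; the countable index set makes
  -- the product first countable.
  obtain ⟨a, -, φ, hφ, hlim⟩ := (isCompact_univ_pi fun i => isCompact_closedBall (0 : Plane)
    (R i)).tendsto_subseq (x := y) (fun n => fun i _ => hR i n)
  rw [tendsto_pi_nhds] at hlim
  have hconv : ∀ t, 0 ≤ t → ∀ x ∈ D.carrier, ∃ z, Tendsto (fun n => X (φ n) t x) atTop (𝓝 z) := by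
    intro t ht x hx
    refine cauchySeq_tendsto_of_complete (Metric.cauchySeq_iff.2 fun η hη => ?_)
    have hT : 0 ≤ t + 1 := by linarith
    have hM := velBound_nonneg (c := c) hC hA hB (t + 1)
    obtain ⟨α, hα, hO⟩ := exists_osgoodPair (M := velBound C A B c (t + 1)) (T := t + 1) hM
      (show 0 < η / 10 by positivity)
    obtain ⟨x', hx'Q, hx'⟩ := Metric.dense_iff.1 hQd ⟨x, hx⟩ α hα
    have hxx' : ‖x - x'‖ ≤ α := by
      rw [Metric.mem_ball, dist_comm, Subtype.dist_eq, dist_eq_norm] at hx'Q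
      exact hx'Q.le
    obtain ⟨r, hr0, hr1, hrM⟩ : ∃ r > 0, r ≤ 1 ∧ velBound C A B c (t + 1) * r ≤ η / 10 := by
      obtain ⟨r, h1, h2, h3⟩ := ((eventually_mul_lt (a := velBound C A B c (t + 1))
        (show 0 < η / 10 by positivity)).and ((eventually_mul_lt (a := 1) one_pos).and
          self_mem_nhdsWithin)).exists
      exact ⟨r, h3, by linarith, by linarith⟩
    obtain ⟨q, hq1, hq2⟩ := exists_rat_btwn (show t < t + r by linarith)
    have hq0 : (0 : ℚ) ≤ q := by exact_mod_cast ht.trans hq1.le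
    lift q to ℚ≥0 using hq0
    simp only [Rat.cast_nnratCast] at hq1 hq2
    obtain ⟨α₁, -, hs⟩ := eventually_survival hX hκ hN hC hA hB hx hT
    obtain ⟨α₂, -, hs'⟩ := eventually_survival hX hκ hN hC hA hB x'.2 hT
    -- The three tenths are the change of the starting point, the change of time, and the rounding
    -- error `κ n`.
    have hclose : ∀ᶠ n in atTop, ‖X n t x - X n q x'‖ ≤ 3 * η / 10 := by
      filter_upwards [hs, hs', hκ.eventually_lt_const (show 0 < η / 10 by positivity),
        hN.eventually_ge_atTop (t + 1)] with n h1 h2 h3 h4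
      have h5 := (hX n).equicontinuous (t + 1) α _ hT h4 hO t ht (by linarith) x
        (h1 t ht (by linarith)).1 x' (h2 t ht (by linarith)).1 hxx'
      have h6 := (hX n).displacement t q (t + 1) ht hq1.le (by linarith) h4 x'
        (h2 q (ht.trans hq1.le) (by linarith)).1
      have h7 : velBound C A B c (t + 1) * (q - t) ≤ velBound C A B c (t + 1) * r := by
        gcongr; linarith
      calc ‖X n t x - X n q x'‖ = ‖(X n t x - X n t x') - (X n q x' - X n t x')‖ :=
            congrArg norm (by abel)
        _ ≤ ‖X n t x - X n t x'‖ + ‖X n q x' - X n t x'‖ := norm_sub_le _ _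
        _ ≤ _ := by linarith
    have hlim' := hlim (q, ⟨x', hx'⟩)
    obtain ⟨n₁, hn₁⟩ := Metric.cauchySeq_iff.1 hlim'.cauchySeq (η / 10) (by positivity)
    obtain ⟨n₂, hn₂⟩ := eventually_atTop.1 (hφ.tendsto_atTop.eventually hclose)
    refine ⟨max n₁ n₂, fun m hm n hn => ?_⟩
    have h1 := hn₁ m (le_of_max_le_left hm) n (le_of_max_le_left hn)
    have h2 := hn₂ m (le_of_max_le_right hm)
    have h3 := hn₂ n (le_of_max_le_right hn)
    rw [dist_eq_norm] at h1 ⊢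
    change ‖X (φ m) q x' - X (φ n) q x'‖ < _ at h1
    calc ‖X (φ m) t x - X (φ n) t x‖ = ‖(X (φ m) t x - X (φ m) q x') +
          (X (φ m) q x' - X (φ n) q x') - (X (φ n) t x - X (φ n) q x')‖ :=
          congrArg norm (by abel)
      _ ≤ ‖X (φ m) t x - X (φ m) q x'‖ + ‖X (φ m) q x' - X (φ n) q x'‖ +
          ‖X (φ n) t x - X (φ n) q x'‖ :=
          (norm_sub_le _ _).trans (by gcongr; exact norm_add_le _ _)
      _ < η := by linarith
  classical
  refine ⟨φ, hφ, fun t x => if h : 0 ≤ t ∧ x ∈ D.carrier then (hconv t h.1 x h.2).choose else 0,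
    fun t ht x hx => ?_⟩
  simp only [dif_pos (show 0 ≤ t ∧ x ∈ D.carrier from ⟨ht, hx⟩)]
  exact (hconv t ht x hx).choose_spec

/-- The flow `Y` is the limit of the approximate flows `X n`. For convenience, it is constant for
negative times and the identity outside of the carrier. -/
structure IsLimitFlow (D : FluidDomain) (K : (Plane → ℝ) → Plane → Plane) (A B C c : ℝ)
    (ω₀ : Plane → ℝ) (κ N : ℕ → ℝ) (X : ℕ → ℝ → Plane → Plane) (S : ℕ → ℝ → Set Plane)
    (ω : ℕ → ℝ → Plane → ℝ) (Y : ℝ → Plane → Plane) : Prop where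
  approx : ∀ n, IsApproxSolution D K A B C c ω₀ (κ n) (N n) (X n) (S n) (ω n)
  kappa_nonneg : ∀ n, 0 ≤ κ n
  kappa_tendsto : Tendsto κ atTop (𝓝 0)
  time_tendsto : Tendsto N atTop atTop
  tendsto : ∀ t, 0 ≤ t → ∀ x ∈ D.carrier, Tendsto (fun n => X n t x) atTop (𝓝 (Y t x))
  max_zero : ∀ t x, Y (max t 0) x = Y t x
  eq_self : ∀ t x, x ∉ D.carrier → Y t x = x

lemma exists_isLimitFlow (hC : 0 ≤ C) (hA : 0 ≤ A) (hB : 0 ≤ B) (hc : 0 ≤ c)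
    (hω₀ : D.IsVorticity A B ω₀)
    (hK : ∀ B' ω, 0 ≤ B' → D.IsVorticity A B' ω → D.IsAdmissible (C * (A + B')) c (K ω)) :
    ∃ κ N X S ω Y, IsLimitFlow D K A B C c ω₀ κ N X S ω Y := by
  have h1 : ∀ n : ℕ, ∃ X S ω, IsApproxSolution D K A B C c ω₀ (1 / ((n : ℝ) + 1)) n X S ω :=
    fun n => exists_isApproxSolution hC hA hB hc hω₀ hK (by positivity)
      (by rw [div_le_one (by positivity)]; linarith [Nat.cast_nonneg (α := ℝ) n]) n
  choose X S ω hX using h1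
  obtain ⟨φ, hφ, Y, hY⟩ := exists_tendsto_subseq hX tendsto_one_div_add_atTop_nhds_zero_nat
    tendsto_natCast_atTop_atTop hC hA hB
  classical
  refine ⟨fun n => 1 / ((φ n : ℝ) + 1), fun n => φ n, fun n => X (φ n), fun n => S (φ n),
    fun n => ω (φ n), fun t x => if x ∈ D.carrier then Y (max t 0) x else x,
    fun n => hX (φ n), fun n => by positivity,
    tendsto_one_div_add_atTop_nhds_zero_nat.comp hφ.tendsto_atTop,
    tendsto_natCast_atTop_atTop.comp hφ.tendsto_atTop, fun t ht x hx => ?_, fun t x => ?_,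
    fun t x hx => if_neg hx⟩
  · simpa [hx, ht] using hY t ht x hx
  · simp

variable {Y : ℝ → Plane → Plane}

lemma IsLimitFlow.eventually_survival (hY : IsLimitFlow D K A B C c ω₀ κ N X S ω Y) (hC : 0 ≤ C)
    (hA : 0 ≤ A) (hB : 0 ≤ B) {x : Plane} (hx : x ∈ D.carrier) {T : ℝ} (hT : 0 ≤ T) :
    ∃ α > 0, ∀ᶠ n in atTop, ∀ t, 0 ≤ t → t ≤ T → x ∈ S n t ∧ X n t x ∈ D.deep α :=
  FluidDomain.eventually_survival hY.approx hY.kappa_tendsto hY.time_tendsto hC hA hB hx hT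

lemma IsLimitFlow.eventually_mem (hY : IsLimitFlow D K A B C c ω₀ κ N X S ω Y) (hC : 0 ≤ C)
    (hA : 0 ≤ A) (hB : 0 ≤ B) {x : Plane} (hx : x ∈ D.carrier) {t : ℝ} (ht : 0 ≤ t) :
    ∀ᶠ n in atTop, x ∈ S n t := by
  obtain ⟨α, -, h⟩ := hY.eventually_survival hC hA hB hx ht
  exact h.mono fun n hn => (hn t ht le_rfl).1

lemma IsLimitFlow.mem_carrier (hY : IsLimitFlow D K A B C c ω₀ κ N X S ω Y) (hC : 0 ≤ C)
    (hA : 0 ≤ A) (hB : 0 ≤ B) {x : Plane} (hx : x ∈ D.carrier) (t : ℝ) : Y t x ∈ D.carrier := by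
  rw [← hY.max_zero]
  have ht : 0 ≤ max t 0 := le_max_right _ _
  obtain ⟨α, hα, h⟩ := hY.eventually_survival hC hA hB hx ht
  refine deep_subset_carrier hα ((isClosed_deep α).mem_of_tendsto (hY.tendsto _ ht x hx) ?_)
  exact h.mono fun n hn => (hn _ ht le_rfl).2

lemma IsLimitFlow.initial (hY : IsLimitFlow D K A B C c ω₀ κ N X S ω Y) (x : Plane) :
    Y 0 x = x := by
  by_cases hx : x ∈ D.carrier
  · refine tendsto_nhds_unique (hY.tendsto 0 le_rfl x hx) ?_
    simp only [(hY.approx _).initial]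
    exact tendsto_const_nhds
  · exact hY.eq_self 0 x hx

lemma IsLimitFlow.equivariant (hY : IsLimitFlow D K A B C c ω₀ κ N X S ω Y) (hC : 0 ≤ C)
    (hA : 0 ≤ A) (hB : 0 ≤ B) {x l : Plane} (hx : x ∈ D.carrier) (hl : l ∈ D.lattice) (t : ℝ) :
    Y t (x + l) = Y t x + l := by
  rw [← hY.max_zero, ← hY.max_zero t x]
  have ht : 0 ≤ max t 0 := le_max_right _ _
  refine tendsto_nhds_unique (hY.tendsto _ ht _ (D.add_mem_carrier hx hl)) ?_
  refine ((hY.tendsto _ ht x hx).add_const l).congr' ?_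
  filter_upwards [hY.eventually_mem hC hA hB hx ht, hY.time_tendsto.eventually_ge_atTop (max t 0)]
    with n h1 h2
  exact (((hY.approx n).transport _ ht h2).equivariant x h1 l hl).symm

lemma IsLimitFlow.displacement (hY : IsLimitFlow D K A B C c ω₀ κ N X S ω Y) (hC : 0 ≤ C)
    (hA : 0 ≤ A) (hB : 0 ≤ B) {x : Plane} (hx : x ∈ D.carrier) {s t T : ℝ} (hs : 0 ≤ s)
    (hst : s ≤ t) (htT : t ≤ T) : ‖Y t x - Y s x‖ ≤ velBound C A B c T * (t - s) := by
  have ht := hs.trans hst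
  have h1 := ((hY.tendsto t ht x hx).sub (hY.tendsto s hs x hx)).norm
  have h2 := hY.kappa_tendsto.const_add (velBound C A B c T * (t - s))
  rw [add_zero] at h2
  refine le_of_tendsto_of_tendsto h1 h2 ?_
  filter_upwards [hY.eventually_mem hC hA hB hx ht, hY.time_tendsto.eventually_ge_atTop T]
    with n h3 h4
  exact (hY.approx n).displacement s t T hs hst htT h4 x h3

lemma IsLimitFlow.continuous (hY : IsLimitFlow D K A B C c ω₀ κ N X S ω Y) (hC : 0 ≤ C)
    (hA : 0 ≤ A) (hB : 0 ≤ B) (x : Plane) : Continuous fun t => Y t x := by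
  by_cases hx : x ∈ D.carrier
  swap
  · simp only [hY.eq_self _ x hx]; exact continuous_const
  have h1 : ContinuousOn (fun t => Y t x) (Ici 0) := by
    intro t ht
    have ht : 0 ≤ t := ht
    refine tendsto_iff_norm_sub_tendsto_zero.2 ?_
    have h2 : Tendsto (fun s => velBound C A B c (t + 1) * |s - t|) (𝓝[Ici 0] t) (𝓝 0) := by
      have : Continuous fun s => velBound C A B c (t + 1) * |s - t| := by fun_prop
      simpa using (this.tendsto t).mono_left nhdsWithin_le_nhds
    refine squeeze_zero' (Eventually.of_forall fun _ => norm_nonneg _) ?_ h2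
    filter_upwards [self_mem_nhdsWithin,
      mem_nhdsWithin_of_mem_nhds (Iic_mem_nhds (lt_add_one t))] with s hs hs1
    rcases le_total s t with h | h
    · rw [norm_sub_rev, abs_sub_comm, abs_of_nonneg (sub_nonneg.2 h)]
      exact hY.displacement hC hA hB hx hs h (by linarith)
    · rw [abs_of_nonneg (sub_nonneg.2 h)]
      exact hY.displacement hC hA hB hx ht h hs1
  have h2 : Continuous fun t : ℝ => Y (max t 0) x :=
    h1.comp_continuous (by fun_prop) fun t => mem_Ici.2 (le_max_right _ _)
  simpa only [hY.max_zero] using h2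

lemma IsLimitFlow.measurable (hY : IsLimitFlow D K A B C c ω₀ κ N X S ω Y) (t : ℝ) :
    Measurable (Y t) := by
  have h0 : Y t = Y (max t 0) := funext fun x => (hY.max_zero t x).symm
  rw [h0]
  have ht : 0 ≤ max t 0 := le_max_right _ _
  -- Approximations are controlled only up to time `N n`, so the sequence is shifted until `N n`
  -- exceeds the given time.
  obtain ⟨n₀, hn₀⟩ := eventually_atTop.1 (hY.time_tendsto.eventually_ge_atTop (max t 0))
  classical
  refine measurable_of_tendsto_metrizable (f := fun n => D.carrier.piecewise
    (X (n + n₀) (max t 0)) id) (fun n => ?_) (tendsto_pi_nhds.2 fun x => ?_)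
  · exact Measurable.piecewise D.measurableSet_carrier
      ((hY.approx _).transport _ ht (hn₀ _ (by omega))).measurable measurable_id
  · by_cases hx : x ∈ D.carrier
    · simp only [piecewise_eq_of_mem _ _ _ hx]
      exact (hY.tendsto _ ht x hx).comp (tendsto_add_atTop_nat n₀)
    · simp only [piecewise_eq_of_notMem _ _ _ hx, id, hY.eq_self _ x hx]
      exact tendsto_const_nhds

lemma IsLimitFlow.measurable_uncurry (hY : IsLimitFlow D K A B C c ω₀ κ N X S ω Y) (hC : 0 ≤ C)
    (hA : 0 ≤ A) (hB : 0 ≤ B) : Measurable (Function.uncurry Y) := by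
  exact measurable_uncurry_of_continuous_of_measurable (fun x => hY.continuous hC hA hB x)
    hY.measurable

lemma IsLimitFlow.isTransport (hY : IsLimitFlow D K A B C c ω₀ κ N X S ω Y) (hC : 0 ≤ C)
    (hA : 0 ≤ A) (hB : 0 ≤ B) (t : ℝ) : D.IsTransport D.carrier (Y t) :=
  ⟨D.measurableSet_carrier, Subset.rfl, fun _ hx _ hl => D.add_mem_carrier hx hl,
    hY.measurable t, fun _ hx => hY.mem_carrier hC hA hB hx t,
    fun _ hx _ hl => hY.equivariant hC hA hB hx hl t⟩

/-- For open `U`, a point mapped into `U` by the limit is eventually mapped into `U` by the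
approximations, so Fatou's lemma bounds the area of the preimage, with `c + κ n → c`. General Borel
sets follow by outer regularity. -/
lemma IsLimitFlow.compressesBy (hY : IsLimitFlow D K A B C c ω₀ κ N X S ω Y) (hC : 0 ≤ C)
    (hA : 0 ≤ A) (hB : 0 ≤ B) {t : ℝ} (ht : 0 ≤ t) :
    CompressesBy (ENNReal.ofReal (Real.exp (c * t))) D.carrier (Y t) := by
  obtain ⟨n₀, hn₀⟩ := eventually_atTop.1 (hY.time_tendsto.eventually_ge_atTop t)
  have hopen : ∀ U : Set Plane, IsOpen U → volume (D.carrier ∩ Y t ⁻¹' U) ≤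
      ENNReal.ofReal (Real.exp (c * t)) * volume U := by
    intro U hU
    have hm : ∀ n, MeasurableSet (S (n + n₀) t ∩ X (n + n₀) t ⁻¹' U) := fun n => by
      have := (hY.approx _).transport t ht (hn₀ (n + n₀) (by omega))
      exact this.measurableSet.inter (this.measurable hU.measurableSet)
    have h1 : volume (D.carrier ∩ Y t ⁻¹' U) ≤
        ∫⁻ x, liminf (fun n => (S (n + n₀) t ∩ X (n + n₀) t ⁻¹' U).indicator 1 x) atTop := by
      rw [← lintegral_indicator_one (D.measurableSet_carrier.inter
        (hY.measurable t hU.measurableSet))]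
      refine lintegral_mono fun x => ?_
      by_cases hx : x ∈ D.carrier ∩ Y t ⁻¹' U
      · rw [indicator_of_mem hx]
        refine le_liminf_of_le (by isBoundedDefault) ?_
        have h2 := ((hY.tendsto t ht x hx.1).eventually (hU.mem_nhds hx.2)).and
          (hY.eventually_mem hC hA hB hx.1 ht)
        filter_upwards [(tendsto_add_atTop_nat n₀).eventually h2] with n hn
        rw [indicator_of_mem (show x ∈ S (n + n₀) t ∩ X (n + n₀) t ⁻¹' U from ⟨hn.2, hn.1⟩)]
      · rw [indicator_of_notMem hx]; exact zero_le
    refine h1.trans ((lintegral_liminf_le fun n => measurable_one.indicator (hm n)).trans ?_)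
    by_cases hUt : volume U = ∞
    · rw [hUt, ENNReal.mul_top (by simpa using Real.exp_pos _)]; exact le_top
    have h3 : Tendsto (fun n => ENNReal.ofReal (Real.exp ((c + κ (n + n₀)) * t)) * volume U) atTop
        (𝓝 (ENNReal.ofReal (Real.exp (c * t)) * volume U)) := by
      refine ENNReal.Tendsto.mul_const (ENNReal.tendsto_ofReal ?_) (Or.inr hUt)
      have h4 := (hY.kappa_tendsto.comp (tendsto_add_atTop_nat n₀)).const_add c
      rw [add_zero] at h4
      exact (Real.continuous_exp.tendsto _).comp (h4.mul_const t)
    rw [← h3.liminf_eq]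
    refine liminf_le_liminf (Eventually.of_forall fun n => ?_)
    rw [lintegral_indicator_one (hm n)]
    exact (hY.approx _).compresses t ht (hn₀ _ (by omega)) U hU.measurableSet
  intro E hE
  rw [mul_comm]
  by_cases hEt : volume E = ∞
  · rw [hEt, ENNReal.top_mul (by simpa using Real.exp_pos _)]; exact le_top
  have h5 : ∀ r > volume E, volume (D.carrier ∩ Y t ⁻¹' E) ≤
      r * ENNReal.ofReal (Real.exp (c * t)) := by
    intro r hr
    obtain ⟨U, hEU, hU, hUr⟩ := E.exists_isOpen_lt_of_lt r hr
    rw [mul_comm]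
    exact (measure_mono (inter_subset_inter_right _ (preimage_mono hEU))).trans
      ((hopen U hU).trans (by gcongr))
  have h6 : Tendsto (fun r => r * ENNReal.ofReal (Real.exp (c * t))) (𝓝[>] (volume E))
      (𝓝 (volume E * ENNReal.ofReal (Real.exp (c * t)))) :=
    (ENNReal.Tendsto.mul_const tendsto_id (Or.inr ENNReal.ofReal_ne_top)).mono_left
      nhdsWithin_le_nhds
  have : (𝓝[>] (volume E)).NeBot := nhdsGT_neBot_of_exists_gt ⟨∞, lt_top_iff_ne_top.2 hEt⟩
  exact ge_of_tendsto h6 (by filter_upwards [self_mem_nhdsWithin] with r hr using h5 r hr)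

end

end FluidDomain

end EulerVorticity
end

/-! ### Weak convergence of transported vorticities. -/

noncomputable section

namespace EulerVorticity
namespace FluidDomain

variable {D : FluidDomain}

section Convergence

variable {A B : ℝ} {ω₀ : Plane → ℝ}

lemma IsVorticity.integrable (h : D.IsVorticity A B ω₀) : Integrable ω₀ D.measure :=
  ⟨h.aestronglyMeasurable, h.l1.trans_lt ENNReal.ofReal_lt_top⟩

lemma IsTransport.lintegral_comp_le {S : Set Plane} {Y : Plane → Plane} (hY : D.IsTransport S Y)
    {Λ : ℝ≥0∞} (hΛ : CompressesBy Λ S Y) {h : Plane → ℝ≥0∞} (hh : Measurable h) :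
    ∫⁻ x in S, h (Y x) ∂D.measure ≤ Λ * ∫⁻ x, h x := by
  calc ∫⁻ x in S, h (Y x) ∂D.measure ≤ ∫⁻ x in S, h (Y x) :=
        lintegral_mono' (Measure.restrict_mono_measure Measure.restrict_le_self _) le_rfl
    _ = ∫⁻ x, h x ∂(volume.restrict S).map Y := (lintegral_map hh hY.measurable).symm
    _ ≤ ∫⁻ x, h x ∂(Λ • volume) := by
        refine lintegral_mono' (Measure.le_iff.2 fun E hE => ?_) le_rfl
        rw [Measure.map_apply hY.measurable hE,
          Measure.restrict_apply (hY.measurable hE), inter_comm]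
        exact hΛ E hE
    _ = _ := by rw [lintegral_smul_measure, smul_eq_mul]

lemma IsVorticity.tail_tendsto (h : D.IsVorticity A B ω₀) :
    Tendsto (fun n : ℕ => ∫⁻ x in (Metric.closedBall 0 (n : ℝ))ᶜ, ‖ω₀ x‖ₑ ∂D.measure) atTop
      (𝓝 0) := by
  have hm : ∀ n : ℕ, MeasurableSet (Metric.closedBall (0 : Plane) (n : ℝ))ᶜ :=
    fun n => measurableSet_closedBall.compl
  simp_rw [← lintegral_indicator (hm _)]
  rw [← lintegral_zero (μ := D.measure)]
  refine tendsto_lintegral_of_dominated_convergence' (fun x => ‖ω₀ x‖ₑ)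
    (fun n => h.aestronglyMeasurable.enorm.indicator (hm n))
    (fun n => ae_of_all _ fun x => indicator_le_self _ _ x) h.integrable.2.ne
    (ae_of_all _ fun x => tendsto_const_nhds.congr' ?_)
  filter_upwards [eventually_ge_atTop ⌈‖x‖⌉₊] with n hn
  rw [indicator_of_notMem]
  simpa using (Nat.le_ceil _).trans (Nat.cast_le.2 hn)

/-- Bounded functions along the flows are replaced by continuous functions with compact support. -/
lemma exists_approx_pairing (hω₀ : D.IsVorticity A B ω₀) (hB : 0 ≤ B) {φ : Plane → ℝ}
    (hφ : Measurable φ) {M : ℝ} (hM : ∀ x, |φ x| ≤ M) (Λ R : ℝ) {ε : ℝ} (hε : 0 < ε) :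
    ∃ (f g : Plane → ℝ), AEStronglyMeasurable f D.measure ∧ (∀ x, |f x| ≤ |ω₀ x|) ∧
      Continuous g ∧ HasCompactSupport g ∧
      ∀ S Y, D.IsTransport S Y → CompressesBy (ENNReal.ofReal Λ) S Y →
        (∀ x ∈ S, ‖Y x - x‖ ≤ R) →
        |∫ x in S, ω₀ x * φ (Y x) ∂D.measure - ∫ x in S, f x * g (Y x) ∂D.measure| ≤ ε := by
  have hM0 : 0 ≤ M := (abs_nonneg _).trans (hM 0)
  -- Outside the ball of radius `n` the vorticity has so little mass that it costs at most `ε / 2`.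
  -- Particles starting inside remain in the ball of radius `n + R`, so there `φ` can be cut off to
  -- an integrable function.
  obtain ⟨n, hn⟩ := ((ENNReal.tendsto_nhds_zero.1 hω₀.tail_tendsto)
    (ENNReal.ofReal (ε / (2 * (M + 1)))) (by simpa using by positivity)).exists
  set φ' : Plane → ℝ := (Metric.closedBall 0 (n + R)).indicator φ with hφ'
  have hφ'm : Measurable φ' := hφ.indicator measurableSet_closedBall
  have hφ'i : Integrable φ' := by
    refine (integrable_indicator_iff measurableSet_closedBall).2 ?_
    exact Measure.integrableOn_of_bounded (M := M) (measure_closedBall_lt_top.ne)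
      hφ.aestronglyMeasurable (ae_of_all _ fun x => hM x)
  -- Approximation in `L¹` is sufficient: along any flow with compression factor `Λ` the error is
  -- multiplied by at most `B Λ`. Thus `g` does not depend on the flow.
  obtain ⟨g, hgs, hg, hgc, hgi⟩ := hφ'i.exists_hasCompactSupport_lintegral_sub_le
    (ε := ENNReal.ofReal (ε / (2 * (B * |Λ| + 1)))) (by simpa using by positivity)
  refine ⟨(Metric.closedBall 0 n).indicator ω₀, g,
    hω₀.aestronglyMeasurable.indicator measurableSet_closedBall, fun x => ?_, hgc, hgs,
    fun S Y hY hΛ hR => ?_⟩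
  · by_cases hx : x ∈ Metric.closedBall (0 : Plane) n <;> simp [hx]
  obtain ⟨G, hG⟩ := hgc.bounded_above_of_compact_support hgs
  have hi1 : Integrable (fun x => ω₀ x * φ (Y x)) (D.measure.restrict S) :=
    (hω₀.integrable.mono_measure Measure.restrict_le_self).mul_bdd (c := M)
      (hφ.comp hY.measurable).aestronglyMeasurable (ae_of_all _ fun x => hM _)
  have hi2 : Integrable (fun x => (Metric.closedBall 0 (n : ℝ)).indicator ω₀ x * g (Y x))
      (D.measure.restrict S) :=
    ((hω₀.integrable.indicator measurableSet_closedBall).mono_measure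
      Measure.restrict_le_self).mul_bdd (c := G)
      (hgc.measurable.comp hY.measurable).aestronglyMeasurable (ae_of_all _ fun x => hG _)
  rw [← integral_sub hi1 hi2, ← Real.norm_eq_abs, ← ENNReal.ofReal_le_ofReal_iff hε.le, ofReal_norm]
  calc ‖∫ x in S, (ω₀ x * φ (Y x) -
          (Metric.closedBall 0 (n : ℝ)).indicator ω₀ x * g (Y x)) ∂D.measure‖ₑ
      ≤ ∫⁻ x in S, ‖ω₀ x * φ (Y x) -
          (Metric.closedBall 0 (n : ℝ)).indicator ω₀ x * g (Y x)‖ₑ ∂D.measure :=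
        enorm_integral_le_lintegral_enorm _
    _ ≤ ∫⁻ x in S, ENNReal.ofReal M * (Metric.closedBall 0 (n : ℝ))ᶜ.indicator (‖ω₀ ·‖ₑ) x +
          ENNReal.ofReal B * ‖φ' (Y x) - g (Y x)‖ₑ ∂D.measure := by
        refine lintegral_mono_ae ?_
        filter_upwards [ae_restrict_mem hY.measurableSet, ae_restrict_of_ae hω₀.sup] with x hx hxB
        by_cases hxn : x ∈ Metric.closedBall (0 : Plane) n
        · have hYx : Y x ∈ Metric.closedBall (0 : Plane) (n + R) := by
            rw [mem_closedBall_zero_iff] at hxn ⊢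
            have := norm_le_norm_add_norm_sub' (Y x) x
            linarith [hR x hx]
          rw [indicator_of_mem hxn, indicator_of_notMem (by simpa using hxn), mul_zero, zero_add,
            ← mul_sub, enorm_mul, hφ', indicator_of_mem hYx, ← ofReal_norm (ω₀ x), Real.norm_eq_abs]
          gcongr
        · rw [indicator_of_notMem hxn, indicator_of_mem (by simpa using hxn), zero_mul, sub_zero,
            enorm_mul, mul_comm, ← ofReal_norm (φ (Y x)), Real.norm_eq_abs]
          exact le_add_right (by gcongr; exact hM _)
    _ ≤ ENNReal.ofReal (ε / 2) + ENNReal.ofReal (ε / 2) := by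
        have hm : Measurable fun x => ENNReal.ofReal B * ‖φ' (Y x) - g (Y x)‖ₑ :=
          (((hφ'm.sub hgc.measurable).comp hY.measurable).enorm).const_mul _
        rw [lintegral_add_right _ hm, lintegral_const_mul' _ _ ENNReal.ofReal_ne_top,
          lintegral_const_mul' _ _ ENNReal.ofReal_ne_top]
        refine add_le_add ?_ ?_
        · calc _ ≤ ENNReal.ofReal M * ENNReal.ofReal (ε / (2 * (M + 1))) := by
                gcongr
                refine (lintegral_mono' Measure.restrict_le_self le_rfl).trans ?_
                rw [lintegral_indicator measurableSet_closedBall.compl]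
                exact hn
            _ ≤ _ := by
                rw [← ENNReal.ofReal_mul hM0]
                refine ENNReal.ofReal_le_ofReal ?_
                rw [mul_div_assoc', div_le_div_iff₀ (by positivity) (by positivity)]
                nlinarith
        · calc _ ≤ ENNReal.ofReal B * (ENNReal.ofReal |Λ| *
                  ENNReal.ofReal (ε / (2 * (B * |Λ| + 1)))) := by
                gcongr
                refine (hY.lintegral_comp_le hΛ (h := fun y => ‖φ' y - g y‖ₑ)
                  (by fun_prop)).trans ?_
                gcongr
                exact le_abs_self Λ
            _ ≤ _ := by
                rw [← ENNReal.ofReal_mul (abs_nonneg _), ← ENNReal.ofReal_mul hB]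
                refine ENNReal.ofReal_le_ofReal ?_
                have : 0 ≤ B * |Λ| := by positivity
                rw [← mul_assoc, mul_div_assoc', div_le_div_iff₀ (by positivity) (by positivity)]
                nlinarith
    _ = ENNReal.ofReal ε := by rw [← ENNReal.ofReal_add (by positivity) (by positivity), add_halves]

/-- If flows which do not compress the area too much converge pointwise, then the transported
vorticities converge weakly. -/
lemma tendsto_integral_transport (hω₀ : D.IsVorticity A B ω₀) (hB : 0 ≤ B) {ι : Type*}
    {l : Filter ι} [l.IsCountablyGenerated] {S : ι → Set Plane} {X : ι → Plane → Plane}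
    {Y : Plane → Plane} {Λ R : ℝ}
    (hX : ∀ᶠ n in l, D.IsTransport (S n) (X n) ∧ CompressesBy (ENNReal.ofReal Λ) (S n) (X n) ∧
      ∀ x ∈ S n, ‖X n x - x‖ ≤ R)
    (hY : D.IsTransport D.carrier Y ∧ CompressesBy (ENNReal.ofReal Λ) D.carrier Y ∧
      ∀ x ∈ D.carrier, ‖Y x - x‖ ≤ R)
    (hXY : ∀ x ∈ D.carrier, (∀ᶠ n in l, x ∈ S n) ∧ Tendsto (fun n => X n x) l (𝓝 (Y x)))
    {φ : Plane → ℝ} (hφ : Measurable φ) {M : ℝ} (hM : ∀ x, |φ x| ≤ M) :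
    Tendsto (fun n => ∫ x in S n, ω₀ x * φ (X n x) ∂D.measure) l
      (𝓝 (∫ x in D.carrier, ω₀ x * φ (Y x) ∂D.measure)) := by
  rw [Metric.tendsto_nhds]
  intro ε hε
  obtain ⟨f, g, hf, hfω, hgc, hgs, hfg⟩ := exists_approx_pairing hω₀ hB hφ hM Λ R
    (show 0 < ε / 3 by positivity)
  obtain ⟨G, hG⟩ := hgc.bounded_above_of_compact_support hgs
  -- For continuous `g` the integrands converge pointwise, each particle being eventually alive, and
  -- dominated convergence applies. The replacement of `φ` by `g` is uniform in `n`.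
  have h1 : Tendsto (fun n => ∫ x in S n, f x * g (X n x) ∂D.measure) l
      (𝓝 (∫ x in D.carrier, f x * g (Y x) ∂D.measure)) := by
    have h2 : Tendsto (fun n => ∫ x, (S n).indicator (fun x => f x * g (X n x)) x ∂D.measure) l
        (𝓝 (∫ x, D.carrier.indicator (fun x => f x * g (Y x)) x ∂D.measure)) := by
      refine tendsto_integral_filter_of_dominated_convergence (fun x => |ω₀ x| * G) ?_ ?_
        (hω₀.integrable.abs.mul_const G) ?_
      · filter_upwards [hX] with n hn
        exact (hf.mul (hgc.measurable.comp hn.1.measurable).aestronglyMeasurable).indicator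
          hn.1.measurableSet
      · filter_upwards [hX] with n hn
        refine ae_of_all _ fun x => ?_
        refine (norm_indicator_le_norm_self _ _).trans ?_
        rw [norm_mul]
        exact mul_le_mul (hfω x) (hG _) (norm_nonneg _) (abs_nonneg _)
      · filter_upwards [ae_mem_carrier] with x hx
        rw [indicator_of_mem hx]
        refine Tendsto.congr' ?_ (((hgc.tendsto _).comp (hXY x hx).2).const_mul (f x))
        filter_upwards [(hXY x hx).1] with n hn
        rw [indicator_of_mem hn]; rfl
    rw [integral_indicator D.measurableSet_carrier] at h2
    refine h2.congr' ?_
    filter_upwards [hX] with n hn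
    rw [integral_indicator hn.1.measurableSet]
  filter_upwards [hX, Metric.tendsto_nhds.1 h1 (ε / 3) (by positivity)] with n hn h2
  have h3 := hfg _ _ hn.1 hn.2.1 hn.2.2
  have h4 := hfg _ _ hY.1 hY.2.1 hY.2.2
  rw [Real.dist_eq] at h2 ⊢
  rw [abs_lt] at h2 ⊢
  rw [abs_le] at h3 h4
  constructor <;> linarith

end Convergence

/-! ### Convergence and decay of the velocity. -/

section Velocity

variable {k : Plane → Plane → Plane} {C₁ C₂ A B : ℝ} {ω : Plane → ℝ}

/-- A component of the kernel away from its singularity. -/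
def farKernel (D : FluidDomain) (k : Plane → Plane → Plane) (x : Plane) (r : ℝ) (i : Fin 2)
    (z : Plane) : ℝ :=
  {z | r ≤ D.distance x z}.indicator (fun z => D.carrier.indicator (k x) z i) z

lemma KernelEstimates.measurable_farKernel (hk : D.KernelEstimates k C₁ C₂) {x : Plane}
    (hx : x ∈ D.carrier) (r : ℝ) (i : Fin 2) : Measurable (D.farKernel k x r i) := by
  have h := hk.measurable_indicator hx
  have h2 : Measurable fun z => D.carrier.indicator (k x) z i := by fun_prop
  exact h2.indicator (measurableSet_le_distance x r)

lemma KernelEstimates.periodic_farKernel (hk : D.KernelEstimates k C₁ C₂) {x : Plane}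
    (hx : x ∈ D.carrier) (r : ℝ) (i : Fin 2) : D.Periodic (D.farKernel k x r i) := by
  intro z hz l hl
  have h1 : z + l ∈ {z | r ≤ D.distance x z} ↔ z ∈ {z | r ≤ D.distance x z} := by
    simp [D.distance_add_right x z hl]
  unfold farKernel
  by_cases h : z ∈ {z | r ≤ D.distance x z}
  · rw [indicator_of_mem h, indicator_of_mem (h1.2 h), indicator_of_mem hz,
      indicator_of_mem (D.add_mem_carrier hz hl)]
    exact congrArg (fun v : Plane => v i) (hk.periodic_right x hx z hz l hl)
  · rw [indicator_of_notMem h, indicator_of_notMem (mt h1.1 h)]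

/-- The cutoff radius `r` is separate from the actual lower bound `s` of the distance, because the
decay of the velocity at infinity needs `s` large while `r` is small and fixed. -/
lemma KernelEstimates.abs_farKernel_le_div (hk : D.KernelEstimates k C₁ C₂) (hC₁ : 0 ≤ C₁)
    {x z : Plane} (hx : x ∈ D.carrier) {r s : ℝ} (hr : 0 < r) (hs : 0 < s) (i : Fin 2)
    (hsz : z ∈ D.carrier → s ≤ D.distance x z) :
    |D.farKernel k x r i z| ≤ C₁ / s := by
  unfold farKernel
  by_cases h : z ∈ {z | r ≤ D.distance x z}
  · rw [indicator_of_mem h]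
    by_cases hz : z ∈ D.carrier
    · rw [indicator_of_mem hz]
      have h1 : x - z ∉ D.lattice := fun h' => by
        have := D.distance_eq_zero h'
        have h : r ≤ D.distance x z := h
        linarith
      calc |k x z i| ≤ ‖k x z‖ := PiLp.norm_apply_le (k x z) i
        _ ≤ C₁ / D.distance x z := hk.bound x hx z hz h1
        _ ≤ C₁ / s := by gcongr; exact hsz hz
    · rw [indicator_of_notMem hz]; simp; positivity
  · rw [indicator_of_notMem h, abs_zero]; positivity

lemma KernelEstimates.abs_farKernel_le (hk : D.KernelEstimates k C₁ C₂) (hC₁ : 0 ≤ C₁)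
    {x : Plane} (hx : x ∈ D.carrier) {r : ℝ} (hr : 0 < r) (i : Fin 2) (z : Plane) :
    |D.farKernel k x r i z| ≤ C₁ / r := by
  by_cases h : z ∈ {z | r ≤ D.distance x z}
  · exact hk.abs_farKernel_le_div hC₁ hx hr hr i fun _ => h
  · rw [farKernel, indicator_of_notMem h, abs_zero]; positivity

/-- The part of the velocity which is generated by the vorticity at distance at least `r`. -/
def farVelocity (D : FluidDomain) (k : Plane → Plane → Plane) (r : ℝ) (ω : Plane → ℝ)
    (x : Plane) : Plane :=
  WithLp.toLp 2 fun i => ∫ z, ω z * D.farKernel k x r i z ∂D.measure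

lemma KernelEstimates.norm_velocityOf_sub_far_le (hk : D.KernelEstimates k C₁ C₂) (hC₁ : 0 ≤ C₁)
    (hA : 0 ≤ A) (hB : 0 ≤ B) (hω : D.IsVorticity A B ω) {x : Plane} (hx : x ∈ D.carrier) {r : ℝ}
    (hr : 0 ≤ r) :
    ‖D.velocityOf k ω x - D.farVelocity k r ω x‖ ≤ 8 * C₁ * B * r := by
  have hint := hk.integrable hC₁ hA hB hω hx
  have h1 : D.farVelocity k r ω x = ∫ z in {z | r ≤ D.distance x z}, ω z • k x z ∂D.measure := by
    ext i
    have h2 := (EuclideanSpace.proj (𝕜 := ℝ) i).integral_comp_comm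
      (hint.integrableOn (s := {z | r ≤ D.distance x z}))
    refine Eq.trans ?_ h2
    rw [← integral_indicator (measurableSet_le_distance x r)]
    refine integral_congr_ae ?_
    filter_upwards [ae_mem_carrier] with z hz
    by_cases h : z ∈ {z | r ≤ D.distance x z}
    · simp [farKernel, indicator_of_mem h, indicator_of_mem hz]
    · simp [farKernel, indicator_of_notMem h]
  have h3 := integral_add_compl (measurableSet_distance_lt (D := D) x r) hint
  have h4 : {z | D.distance x z < r}ᶜ = {z | r ≤ D.distance x z} := by ext z; simp
  rw [h4] at h3
  rw [h1, velocityOf, ← h3, add_sub_cancel_right]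
  exact norm_integral_le_of_lintegral (by positivity) (hk.lintegral_near_le hC₁ hB hω hx hr)

lemma exists_small_radius (a : ℝ) {η : ℝ} (hη : 0 < η) : ∃ r > 0, a * r < η := by
  obtain ⟨r, h1, h2⟩ := ((eventually_mul_lt (a := a) hη).and self_mem_nhdsWithin).exists
  exact ⟨r, h2, by linarith⟩

/-- The part of the velocity generated within distance `r` is at most `8 C₁ B r`, uniformly in the
vorticity. The remaining part pairs the vorticity with a bounded measurable periodic function, so it
converges by assumption. -/
lemma KernelEstimates.tendsto_velocityOf (hk : D.KernelEstimates k C₁ C₂) (hC₁ : 0 ≤ C₁)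
    (hA : 0 ≤ A) (hB : 0 ≤ B) {ι : Type*} {l : Filter ι} {ω' : ι → Plane → ℝ}
    (hω' : ∀ᶠ n in l, D.IsVorticity A B (ω' n)) (hω : D.IsVorticity A B ω)
    (hlim : ∀ φ : Plane → ℝ, Measurable φ → D.Periodic φ → (∃ M : ℝ, ∀ x, |φ x| ≤ M) →
      Tendsto (fun n => ∫ x, ω' n x * φ x ∂D.measure) l (𝓝 (∫ x, ω x * φ x ∂D.measure)))
    {x : Plane} (hx : x ∈ D.carrier) :
    Tendsto (fun n => D.velocityOf k (ω' n) x) l (𝓝 (D.velocityOf k ω x)) := by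
  rw [Metric.tendsto_nhds]
  intro ε hε
  obtain ⟨r, hr, hr'⟩ := exists_small_radius (8 * C₁ * B) (show 0 < ε / 3 by positivity)
  have h1 : Tendsto (fun n => D.farVelocity k r (ω' n) x) l (𝓝 (D.farVelocity k r ω x)) := by
    refine ((PiLp.continuous_toLp 2 _).tendsto _).comp (tendsto_pi_nhds.2 fun i => ?_)
    exact hlim _ (hk.measurable_farKernel hx r i) (hk.periodic_farKernel hx r i)
      ⟨_, hk.abs_farKernel_le hC₁ hx hr i⟩
  filter_upwards [hω', Metric.tendsto_nhds.1 h1 (ε / 3) (by positivity)] with n hn h2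
  have h3 := hk.norm_velocityOf_sub_far_le hC₁ hA hB hn hx hr.le
  have h4 := hk.norm_velocityOf_sub_far_le hC₁ hA hB hω hx hr.le
  rw [dist_eq_norm] at h2 ⊢
  calc _ = ‖(D.velocityOf k (ω' n) x - D.farVelocity k r (ω' n) x) +
        (D.farVelocity k r (ω' n) x - D.farVelocity k r ω x) -
        (D.velocityOf k ω x - D.farVelocity k r ω x)‖ := congrArg norm (by abel)
    _ ≤ _ := (norm_sub_le _ _).trans (add_le_add_left (norm_add_le _ _) _)
    _ < ε := by linarith

/-- In the planar case the distance is Euclidean. The cell of the torus is bounded, and a radius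
beyond it makes the statement vacuous. -/
lemma exists_sub_norm_le_distance (D : FluidDomain) :
    ∃ R, ∀ x ∈ D.cell, R ≤ ‖x‖ → ∀ y, ‖x‖ - ‖y‖ ≤ D.distance x y := by
  cases D with
  | planar Ω _ _ =>
    refine ⟨0, fun x _ _ y => (norm_sub_norm_le x y).trans_eq ?_⟩
    simp [distance, lattice]
  | torus =>
    obtain ⟨R, hR⟩ := (ZSpan.fundamentalDomain_isBounded stdBasis).subset_closedBall 0
    refine ⟨R + 1, fun x hx hRx => ?_⟩
    have := mem_closedBall_zero_iff.1 (hR hx)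
    linarith

/-- The velocity is small far away, uniformly with respect to the flow which transports the
vorticity. -/
lemma KernelEstimates.exists_norm_velocityOf_le (hk : D.KernelEstimates k C₁ C₂) (hC₁ : 0 ≤ C₁)
    (hA : 0 ≤ A) (hB : 0 ≤ B) {ω₀ : Plane → ℝ} {B₀ : ℝ} (hω₀ : D.IsVorticity A B₀ ω₀) (R : ℝ)
    {η : ℝ} (hη : 0 < η) :
    ∃ R', ∀ Y ω, D.IsTransport D.carrier Y → (∀ x ∈ D.carrier, ‖Y x - x‖ ≤ R) →
      D.IsVorticity A B ω →
      (∀ φ : Plane → ℝ, Measurable φ → D.Periodic φ → (∃ M : ℝ, ∀ x, |φ x| ≤ M) →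
        ∫ x, ω x * φ x ∂D.measure = ∫ x in D.carrier, ω₀ x * φ (Y x) ∂D.measure) →
      ∀ x ∈ D.cell, R' ≤ ‖x‖ → ‖D.velocityOf k ω x‖ ≤ η := by
  obtain ⟨r, hr, hr'⟩ := exists_small_radius (8 * C₁ * B) (show 0 < η / 2 by positivity)
  obtain ⟨R₀, hR₀⟩ := D.exists_sub_norm_le_distance
  obtain ⟨n, hn⟩ := ((ENNReal.tendsto_nhds_zero.1 hω₀.tail_tendsto)
    (ENNReal.ofReal (η / (8 * (C₁ / r + 1)))) (by simpa using by positivity)).exists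
  obtain ⟨s, hs, hs'⟩ : ∃ s : ℝ, 0 < s ∧ C₁ / s * A ≤ η / 8 := by
    refine ⟨8 * (C₁ * A + 1) / η, by positivity, ?_⟩
    rw [div_div_eq_mul_div, div_mul_eq_mul_div, div_le_iff₀ (by positivity)]
    nlinarith [mul_nonneg hC₁ hA]
  -- Vorticity starting in the ball of radius `n` has moved by at most `R`, so it stays at distance
  -- at least `s` from `x` when `‖x‖ ≥ s + n + R`. The vorticity starting outside has small mass.
  refine ⟨max R₀ (s + (n + R)), fun Y ω hY hYR hω hpush x hx hRx => ?_⟩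
  have hxc := D.cell_subset_carrier hx
  have hfar : ∀ i, |D.farVelocity k r ω x i| ≤ η / 4 := by
    intro i
    change |∫ z, ω z * D.farKernel k x r i z ∂D.measure| ≤ η / 4
    rw [hpush _ (hk.measurable_farKernel hxc r i) (hk.periodic_farKernel hxc r i)
      ⟨_, hk.abs_farKernel_le hC₁ hxc hr i⟩, ← Real.norm_eq_abs,
      ← ENNReal.ofReal_le_ofReal_iff (by positivity), ofReal_norm]
    calc ‖∫ z in D.carrier, ω₀ z * D.farKernel k x r i (Y z) ∂D.measure‖ₑ
        ≤ ∫⁻ z in D.carrier, ‖ω₀ z * D.farKernel k x r i (Y z)‖ₑ ∂D.measure :=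
          enorm_integral_le_lintegral_enorm _
      _ ≤ ∫⁻ z in D.carrier, ENNReal.ofReal (C₁ / r) *
            (Metric.closedBall 0 (n : ℝ))ᶜ.indicator (‖ω₀ ·‖ₑ) z +
            ENNReal.ofReal (C₁ / s) * ‖ω₀ z‖ₑ ∂D.measure := by
          refine lintegral_mono_ae ?_
          filter_upwards [ae_restrict_mem D.measurableSet_carrier] with z hz
          rw [enorm_mul, mul_comm, ← ofReal_norm (D.farKernel _ _ _ _ _), Real.norm_eq_abs]
          by_cases hzn : z ∈ Metric.closedBall (0 : Plane) n
          · refine le_add_left ?_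
            gcongr
            refine hk.abs_farKernel_le_div hC₁ hxc hr hs i fun _ => ?_
            have h1 := hR₀ x hx ((le_max_left _ _).trans hRx) (Y z)
            have h2 := (le_max_right _ _).trans hRx
            have h3 := norm_le_norm_add_norm_sub' (Y z) z
            have h4 := hYR z hz
            rw [mem_closedBall_zero_iff] at hzn
            linarith
          · rw [indicator_of_mem (by simpa using hzn)]
            refine le_add_right ?_
            gcongr
            exact hk.abs_farKernel_le hC₁ hxc hr i _
      _ ≤ ENNReal.ofReal (η / 8) + ENNReal.ofReal (η / 8) := by
          refine (lintegral_mono' Measure.restrict_le_self le_rfl).trans ?_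
          rw [lintegral_add_right' _ (hω₀.aestronglyMeasurable.enorm.const_mul _),
            lintegral_const_mul' _ _ ENNReal.ofReal_ne_top,
            lintegral_const_mul' _ _ ENNReal.ofReal_ne_top,
            lintegral_indicator measurableSet_closedBall.compl]
          refine add_le_add ((mul_le_mul_right hn _).trans ?_)
            ((mul_le_mul_right hω₀.l1 _).trans ?_)
          · rw [← ENNReal.ofReal_mul (by positivity)]
            refine ENNReal.ofReal_le_ofReal ?_
            rw [mul_div_assoc', div_le_div_iff₀ (by positivity) (by positivity)]
            have : 0 ≤ C₁ / r := by positivity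
            nlinarith
          · rw [← ENNReal.ofReal_mul (by positivity)]
            exact ENNReal.ofReal_le_ofReal hs'
      _ = ENNReal.ofReal (η / 4) := by
          rw [← ENNReal.ofReal_add (by positivity) (by positivity)]; congr 1; ring
  have hnorm : ‖D.farVelocity k r ω x‖ ≤ η / 2 := by
    have h0 := abs_le.1 (hfar 0)
    have h1 := abs_le.1 (hfar 1)
    rw [EuclideanSpace.norm_eq, Fin.sum_univ_two]
    refine Real.sqrt_le_iff.2 ⟨by positivity, ?_⟩
    simp only [Real.norm_eq_abs, sq_abs]
    nlinarith
  have h2 := hk.norm_velocityOf_sub_far_le hC₁ hA hB hω hxc hr.le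
  have h3 := norm_le_norm_add_norm_sub' (D.velocityOf k ω x) (D.farVelocity k r ω x)
  linarith

end Velocity
end FluidDomain

end EulerVorticity
end

/-! ### Continuity of the velocity in time and the weak formulation. -/

noncomputable section

namespace EulerVorticity
namespace FluidDomain

variable {D : FluidDomain}

lemma IsVorticity.mono {A B B' : ℝ} {ω : Plane → ℝ} (h : D.IsVorticity A B ω) (hB : B ≤ B') :
    D.IsVorticity A B' ω :=
  ⟨h.periodic, h.aestronglyMeasurable, h.l1, h.sup.mono fun _ hx => hx.trans hB⟩

lemma IsVorticity.eLpNorm_one_le {A B : ℝ} {ω : Plane → ℝ} (h : D.IsVorticity A B ω) :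
    eLpNorm ω 1 D.measure ≤ ENNReal.ofReal A := by
  rw [eLpNorm_one_eq_lintegral_enorm]; exact h.l1

lemma IsVorticity.eLpNorm_top_le {A B : ℝ} {ω : Plane → ℝ} (h : D.IsVorticity A B ω) :
    eLpNorm ω ∞ D.measure ≤ ENNReal.ofReal B := by
  rw [eLpNorm_exponent_top]; exact eLpNormEssSup_le_of_ae_bound h.sup

lemma isVorticity_of_memLp {ω : Plane → ℝ} (hp : D.Periodic ω) (h1 : MemLp ω 1 D.measure)
    (h2 : MemLp ω ∞ D.measure) :
    D.IsVorticity (eLpNorm ω 1 D.measure).toReal (eLpNorm ω ∞ D.measure).toReal ω where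
  periodic := hp
  aestronglyMeasurable := h1.1
  l1 := by rw [ENNReal.ofReal_toReal h1.2.ne, eLpNorm_one_eq_lintegral_enorm]
  sup := by
    have h3 := ae_le_eLpNormEssSup (f := ω) (μ := D.measure)
    filter_upwards [h3] with x hx
    rw [← eLpNorm_exponent_top] at hx
    simpa using ENNReal.toReal_mono h2.2.ne hx

/-- The vorticity `ω` is transported by the flow `Y`, which compresses areas by a factor of at most
`exp (c t)` up to the time `t`. -/
structure IsTransportedVorticity (D : FluidDomain) (A B c : ℝ) (ω₀ : Plane → ℝ)
    (Y : ℝ → Plane → Plane) (ω : ℝ → Plane → ℝ) : Prop where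
  transport : ∀ t, D.IsTransport D.carrier (Y t)
  initial : ∀ x, Y 0 x = x
  compresses : ∀ t, CompressesBy (ENNReal.ofReal (Real.exp (c * max t 0))) D.carrier (Y t)
  continuous : ∀ x, Continuous fun t => Y t x
  displacement : ∀ T, ∃ R, ∀ t ≤ T, ∀ x ∈ D.carrier, ‖Y t x - x‖ ≤ R
  measurable : Measurable (Function.uncurry ω)
  vorticity : ∀ t, D.IsVorticity A (Real.exp (c * max t 0) * B) (ω t)
  push : ∀ t φ, Measurable φ → D.Periodic φ → (∃ M : ℝ, ∀ x, |φ x| ≤ M) →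
    ∫ x, ω t x * φ x ∂D.measure = ∫ x in D.carrier, ω₀ x * φ (Y t x) ∂D.measure

section

variable {k : Plane → Plane → Plane} {C₁ C₂ A B c : ℝ} {ω₀ : Plane → ℝ}
  {Y : ℝ → Plane → Plane} {ω : ℝ → Plane → ℝ}

lemma IsTransportedVorticity.vorticity_of_le (h : D.IsTransportedVorticity A B c ω₀ Y ω)
    (hB : 0 ≤ B) (hc : 0 ≤ c) {t T : ℝ} (hT : 0 ≤ T) (ht : t ≤ T) :
    D.IsVorticity A (Real.exp (c * T) * B) (ω t) := by
  refine (h.vorticity t).mono ?_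
  have := max_le ht hT
  gcongr

lemma IsTransportedVorticity.compresses_of_le (h : D.IsTransportedVorticity A B c ω₀ Y ω)
    (hc : 0 ≤ c) {t T : ℝ} (hT : 0 ≤ T) (ht : t ≤ T) :
    CompressesBy (ENNReal.ofReal (Real.exp (c * T))) D.carrier (Y t) := by
  intro E hE
  refine (h.compresses t E hE).trans ?_
  have := max_le ht hT
  gcongr

/-- The convergence theorem for transported vorticities is applied to the flow itself, with the maps
`Y s` converging to `Y t` as `s → t` and no particle discarded. -/
lemma IsTransportedVorticity.continuous_velocityOf (h : D.IsTransportedVorticity A B c ω₀ Y ω)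
    (hk : D.KernelEstimates k C₁ C₂) (hC₁ : 0 ≤ C₁) (hA : 0 ≤ A) (hB : 0 ≤ B) (hc : 0 ≤ c)
    (hω₀ : D.IsVorticity A B ω₀) {x : Plane} (hx : x ∈ D.carrier) :
    Continuous fun t => D.velocityOf k (ω t) x := by
  refine continuous_iff_continuousAt.2 fun t => ?_
  have hT : 0 ≤ max t 0 + 1 := by positivity
  have htT : t ≤ max t 0 + 1 := by linarith [le_max_left t 0]
  have hev : ∀ᶠ s in 𝓝 t, s ≤ max t 0 + 1 :=
    Iic_mem_nhds (by linarith [le_max_left t 0])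
  obtain ⟨R, hR⟩ := h.displacement (max t 0 + 1)
  refine hk.tendsto_velocityOf hC₁ hA (B := Real.exp (c * (max t 0 + 1)) * B) (by positivity)
    (hev.mono fun s hs => h.vorticity_of_le hB hc hT hs) (h.vorticity_of_le hB hc hT htT)
    (fun φ hφ hφp hφM => ?_) hx
  obtain ⟨M, hM⟩ := hφM
  simp only [h.push _ φ hφ hφp ⟨M, hM⟩]
  exact tendsto_integral_transport hω₀ hB (R := R)
    (hev.mono fun s hs => ⟨h.transport s, h.compresses_of_le hc hT hs, hR s hs⟩)
    ⟨h.transport t, h.compresses_of_le hc hT htT, hR t htT⟩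
    (fun x hx => ⟨Eventually.of_forall fun _ => hx, (h.continuous x).tendsto t⟩) hφ hM

lemma tendsto_mul_logLipModulus_norm (a : ℝ) {ι : Type*} {l : Filter ι} {u : ι → Plane} {y : Plane}
    (hu : Tendsto u l (𝓝 y)) : Tendsto (fun i => a * logLipModulus ‖u i - y‖) l (𝓝 0) := by
  have h1 : Tendsto (fun i => ‖u i - y‖) l (𝓝[Ici 0] 0) :=
    tendsto_nhdsWithin_iff.2 ⟨tendsto_iff_norm_sub_tendsto_zero.1 hu,
      Eventually.of_forall fun _ => norm_nonneg _⟩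
  have h2 := ((continuousOn_logLipModulus 0 (mem_Ici.2 le_rfl)).tendsto.comp h1).const_mul a
  simpa using h2

lemma KernelEstimates.norm_velocityOf_sub_le_norm (hk : D.KernelEstimates k C₁ C₂) (hC₁ : 0 ≤ C₁)
    (hC₂ : 0 ≤ C₂) (hA : 0 ≤ A) (hB : 0 ≤ B) (hω : D.IsVorticity A B ω₀) {x y : Plane}
    (hx : x ∈ D.carrier) (hy : y ∈ D.carrier) :
    ‖D.velocityOf k ω₀ x - D.velocityOf k ω₀ y‖ ≤
      velocityConst C₁ C₂ * (A + B) * logLipModulus ‖x - y‖ := by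
  refine (hk.norm_velocityOf_sub_le hC₁ hC₂ hA hB hω hx hy).trans ?_
  have h := logLipModulus_mono (D.distance_nonneg x y) (D.distance_le_norm x y)
  have : 0 ≤ velocityConst C₁ C₂ := by unfold velocityConst; positivity
  gcongr

lemma IsTransportedVorticity.continuous_velocityOf_comp
    (h : D.IsTransportedVorticity A B c ω₀ Y ω)
    (hk : D.KernelEstimates k C₁ C₂) (hC₁ : 0 ≤ C₁) (hC₂ : 0 ≤ C₂) (hA : 0 ≤ A) (hB : 0 ≤ B)
    (hc : 0 ≤ c) (hω₀ : D.IsVorticity A B ω₀) {y : ℝ → Plane} (hy : Continuous y)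
    (hyc : ∀ t, y t ∈ D.carrier) : Continuous fun t => D.velocityOf k (ω t) (y t) := by
  refine continuous_iff_continuousAt.2 fun t => ?_
  have hT : 0 ≤ max t 0 + 1 := by positivity
  have h1 := (h.continuous_velocityOf hk hC₁ hA hB hc hω₀ (hyc t)).tendsto t
  have h2 : Tendsto (fun s => D.velocityOf k (ω s) (y s) - D.velocityOf k (ω s) (y t)) (𝓝 t)
      (𝓝 0) := by
    refine squeeze_zero_norm' ?_ (tendsto_mul_logLipModulus_norm
      (velocityConst C₁ C₂ * (A + Real.exp (c * (max t 0 + 1)) * B)) (hy.tendsto t))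
    filter_upwards [Iic_mem_nhds (show t < max t 0 + 1 by linarith [le_max_left t 0])] with s hs
    exact hk.norm_velocityOf_sub_le_norm hC₁ hC₂ hA (by positivity)
      (h.vorticity_of_le hB hc hT hs) (hyc s) (hyc t)
  simpa [ContinuousAt] using h2.add h1

/-- The velocity as a bounded continuous function. -/
lemma IsTransportedVorticity.exists_continuous_velocity
    (h : D.IsTransportedVorticity A B c ω₀ Y ω)
    (hk : D.KernelEstimates k C₁ C₂) (hC₁ : 0 ≤ C₁) (hC₂ : 0 ≤ C₂) (hA : 0 ≤ A) (hB : 0 ≤ B)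
    (hc : 0 ≤ c) (hω₀ : D.IsVorticity A B ω₀) :
    ∃ V : ℝ → (D.carrier →ᵇ Plane), Continuous V ∧
      ∀ t (x : D.carrier), V t x = D.velocityOf k (ω t) x := by
  have hcC : 0 ≤ velocityConst C₁ C₂ := by unfold velocityConst; positivity
  have hcont : ∀ t, Continuous fun x : D.carrier => D.velocityOf k (ω t) x := by
    intro t
    refine continuous_iff_continuousAt.2 fun x => ?_
    refine tendsto_iff_norm_sub_tendsto_zero.2 ?_
    refine squeeze_zero (fun _ => norm_nonneg _) (fun y => hk.norm_velocityOf_sub_le_norm hC₁ hC₂ hA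
      (by positivity) (h.vorticity t) y.2 x.2) ?_
    exact tendsto_mul_logLipModulus_norm _ (continuous_subtype_val.tendsto x)
  let V : ℝ → (D.carrier →ᵇ Plane) := fun t => BoundedContinuousFunction.ofNormedAddCommGroup
    (fun x : D.carrier => D.velocityOf k (ω t) x) (hcont t) _ fun x =>
      hk.norm_velocityOf_le_const hC₁ hC₂ hA (by positivity) (h.vorticity t) x.2
  refine ⟨V, continuous_iff_continuousAt.2 fun t => Metric.tendsto_nhds.2 fun η hη => ?_,
    fun t x => rfl⟩
  have htT : t < max t 0 + 1 := by linarith [le_max_left t 0]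
  have hT : 0 ≤ max t 0 + 1 := by positivity
  set T := max t 0 + 1
  set B' := Real.exp (c * T) * B with hB'
  have hB'0 : 0 ≤ B' := by positivity
  obtain ⟨R, hR⟩ := h.displacement T
  -- Uniformity in space: representatives outside a large ball are handled by the uniform decay,
  -- those inside by a finite `δ`-net and the common modulus of continuity. Only the finitely many
  -- points of the net need convergence in time.
  obtain ⟨R', hR'⟩ := hk.exists_norm_velocityOf_le hC₁ hA hB'0 hω₀ R
    (show 0 < η / 5 by positivity)
  obtain ⟨δ, hδ, hδη⟩ : ∃ δ > 0, velocityConst C₁ C₂ * (A + B') * logLipModulus δ < η / 5 := by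
    have h1 : Tendsto (fun r => velocityConst C₁ C₂ * (A + B') * logLipModulus r) (𝓝[>] 0)
        (𝓝 0) := by
      have h2 := ((continuousOn_logLipModulus 0 (mem_Ici.2 le_rfl)).tendsto.const_mul
        (velocityConst C₁ C₂ * (A + B'))).mono_left (nhdsWithin_mono _ Ioi_subset_Ici_self)
      simpa using h2
    obtain ⟨δ, h3, h4⟩ := ((h1.eventually_lt_const (show 0 < η / 5 by positivity)).and
      self_mem_nhdsWithin).exists
    exact ⟨δ, h4, h3⟩
  obtain ⟨F, hFs, hF, hcov⟩ := Metric.finite_approx_of_totallyBounded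
    ((isCompact_closedBall (0 : Plane) R').totallyBounded.subset
      (inter_subset_right (s := D.cell))) δ hδ
  have hev : ∀ᶠ s in 𝓝 t, ∀ y ∈ F, dist (D.velocityOf k (ω s) y) (D.velocityOf k (ω t) y) < η / 5 :=
    (hF.eventually_all).2 fun y hy => Metric.tendsto_nhds.1
      ((h.continuous_velocityOf hk hC₁ hA hB hc hω₀ (D.cell_subset_carrier (hFs hy).1)).tendsto t)
      _ (by positivity)
  filter_upwards [hev, Iic_mem_nhds htT] with s hs hsT
  refine lt_of_le_of_lt ((BoundedContinuousFunction.dist_le (C := 3 * (η / 5)) (by positivity)).2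
    fun x => ?_) (by linarith)
  have hper : ∀ r, V r x = D.velocityOf k (ω r) (D.rep x) := fun r => by
    obtain ⟨l, hl, h⟩ := D.exists_rep_eq x
    rw [h, hk.velocityOf_periodic x.2 hl]; rfl
  have hxc := D.rep_mem_cell x.2
  rw [hper, hper, dist_eq_norm]
  rcases le_total R' ‖D.rep x‖ with hx | hx
  · have hdecay : ∀ r ≤ T, ‖D.velocityOf k (ω r) (D.rep x)‖ ≤ η / 5 := fun r hr =>
      hR' (Y r) (ω r) (h.transport r) (hR r hr) (h.vorticity_of_le hB hc hT hr) (h.push r) _ hxc hx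
    have := _root_.norm_sub_le (D.velocityOf k (ω s) (D.rep x)) (D.velocityOf k (ω t) (D.rep x))
    linarith [hdecay s hsT, hdecay t htT.le]
  · obtain ⟨y, hyF, hy⟩ := mem_iUnion₂.1 (hcov ⟨hxc, mem_closedBall_zero_iff.2 hx⟩)
    have hyF' := hs y hyF
    have hosc : ∀ r ≤ T, ‖D.velocityOf k (ω r) (D.rep x) - D.velocityOf k (ω r) y‖ ≤ η / 5 := by
      intro r hr
      refine (hk.norm_velocityOf_sub_le_norm hC₁ hC₂ hA hB'0 (h.vorticity_of_le hB hc hT hr)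
        (D.cell_subset_carrier hxc) (D.cell_subset_carrier (hFs hyF).1)).trans (le_trans ?_ hδη.le)
      have hle : ‖D.rep x - y‖ ≤ δ := by rw [← dist_eq_norm]; exact (Metric.mem_ball.1 hy).le
      have := logLipModulus_mono (norm_nonneg _) hle
      gcongr
    rw [dist_eq_norm] at hyF'
    calc _ = ‖(D.velocityOf k (ω s) (D.rep x) - D.velocityOf k (ω s) y) +
          (D.velocityOf k (ω s) y - D.velocityOf k (ω t) y) -
          (D.velocityOf k (ω t) (D.rep x) - D.velocityOf k (ω t) y)‖ := congrArg norm (by abel)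
      _ ≤ _ := (_root_.norm_sub_le _ _).trans (add_le_add_left (norm_add_le _ _) _)
      _ ≤ 3 * (η / 5) := by linarith [hosc s hsT, hosc t htT.le]

end

section TestFunctions

variable {φ : ℝ × Plane → ℝ}

lemma IsSpaceTimeTestFunction.exists_bound (hφ : D.IsSpaceTimeTestFunction φ) (t : ℝ) :
    ∃ M, ∀ x, |φ (t, x)| ≤ M := by
  obtain ⟨S, hS, -, hsupp⟩ := hφ.support
  have hc : Continuous fun x => φ (t, x) := hφ.contDiff.continuous.comp (by fun_prop)
  obtain ⟨M, hM⟩ := hS.exists_bound_of_continuousOn hc.continuousOn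
  refine ⟨max M 0, fun x => ?_⟩
  by_cases h : φ (t, x) = 0
  · simp [h]
  · obtain ⟨l, hl, hx⟩ := hsupp t x h
    rw [← hφ.periodic t x l hl]
    exact (hM _ hx).trans (le_max_left _ _)

lemma IsSpaceTimeTestFunction.fderiv_add (hφ : D.IsSpaceTimeTestFunction φ) (t : ℝ) (x : Plane)
    {l : Plane} (hl : l ∈ D.lattice) : fderiv ℝ φ (t, x + l) = fderiv ℝ φ (t, x) := by
  have h1 : (fun p : ℝ × Plane => φ (p + (0, l))) = φ := by
    funext p
    obtain ⟨s, y⟩ := p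
    simpa using hφ.periodic s y l hl
  have h2 := fderiv_comp_add_right (𝕜 := ℝ) (f := φ) (x := (t, x)) ((0, l) : ℝ × Plane)
  rw [h1] at h2
  simpa using h2.symm

open scoped Pointwise in
lemma IsSpaceTimeTestFunction.exists_fderiv_bound (hφ : D.IsSpaceTimeTestFunction φ) (T : ℝ) :
    ∃ M, ∀ t ∈ Icc 0 T, ∀ x, ‖fderiv ℝ φ (t, x)‖ ≤ M := by
  obtain ⟨S, hS, -, hsupp⟩ := hφ.support
  have hc := hφ.contDiff.continuous_fderiv one_ne_zero
  obtain ⟨M, hM⟩ := (isCompact_Icc (a := (0 : ℝ)) (b := T)).prod hS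
    |>.exists_bound_of_continuousOn hc.continuousOn
  refine ⟨max M 0, fun t ht x => ?_⟩
  by_cases h : fderiv ℝ φ (t, x) = 0
  · simp [h]
  · have h1 : (t, x) ∈ tsupport φ := support_fderiv_subset ℝ h
    -- The lattice is closed and `S` is compact, so their sum is closed and contains the closure of
    -- the spatial supports. By periodicity a bound of the derivative on `[0, T] × S` is a bound
    -- everywhere.
    have h2 : tsupport φ ⊆ Prod.snd ⁻¹' ((D.lattice : Set Plane) + S) := by
      refine closure_minimal (fun p hp => ?_)
        ((D.isClosed_lattice.add_right_of_isCompact hS).preimage continuous_snd)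
      obtain ⟨l, hl, hx⟩ := hsupp p.1 p.2 hp
      exact ⟨-l, neg_mem hl, _, hx, by simp⟩
    obtain ⟨l, hl, y, hy, hlx⟩ := h2 h1
    have hlx : l + y = x := hlx
    rw [← hlx, add_comm, hφ.fderiv_add t y hl]
    exact (hM (t, y) ⟨ht, hy⟩).trans (le_max_left _ _)

lemma IsSpaceTimeTestFunction.deriv_add_fderiv (hφ : D.IsSpaceTimeTestFunction φ) (t : ℝ)
    (x w : Plane) : deriv (fun s => φ (s, x)) t + fderiv ℝ (fun y => φ (t, y)) x w =
      fderiv ℝ φ (t, x) (1, w) := by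
  have hd : HasFDerivAt φ (fderiv ℝ φ (t, x)) (t, x) :=
    (hφ.contDiff.differentiable one_ne_zero _).hasFDerivAt
  have h1 : HasDerivAt (fun s => φ (s, x)) (fderiv ℝ φ (t, x) (1, 0)) t :=
    hd.comp_hasDerivAt t ((hasDerivAt_id t).prodMk (hasDerivAt_const t x))
  have h2 : HasFDerivAt (fun y => φ (t, y))
      ((fderiv ℝ φ (t, x)).comp (ContinuousLinearMap.inr ℝ ℝ Plane)) x :=
    hd.comp x (hasFDerivAt_prodMk_right t x)
  rw [h1.deriv, h2.fderiv, ContinuousLinearMap.comp_apply, ContinuousLinearMap.inr_apply, ← map_add]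
  simp

end TestFunctions

section

variable {k : Plane → Plane → Plane} {C₁ C₂ A B c : ℝ} {ω₀ : Plane → ℝ}
  {Y : ℝ → Plane → Plane} {ω : ℝ → Plane → ℝ}

lemma restrict_measure_carrier : D.measure.restrict D.carrier = D.measure := by
  rw [FluidDomain.measure, Measure.restrict_restrict D.measurableSet_carrier,
    inter_eq_right.2 D.cell_subset_carrier]

/-- Along a trajectory the derivative of `φ (t, Y t x)` is the transport derivative of `φ`. The
fundamental theorem of calculus is applied for each `x` and integrated against `ω₀`. Fubini's
theorem and the push-forward identity, at each time, turn both sides into integrals of `ω t`. -/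
lemma IsTransportedVorticity.weak_form (h : D.IsTransportedVorticity A B c ω₀ Y ω)
    (hk : D.KernelEstimates k C₁ C₂) (hC₁ : 0 ≤ C₁) (hC₂ : 0 ≤ C₂) (hA : 0 ≤ A) (hB : 0 ≤ B)
    (hc : 0 ≤ c) (hω₀ : D.IsVorticity A B ω₀)
    (hode : ∀ x ∈ D.carrier, ∀ t, 0 ≤ t →
      HasDerivWithinAt (fun s => Y s x) (D.velocityOf k (ω t) (Y t x)) (Ici 0) t)
    {T : ℝ} (hT : 0 < T) {φ : ℝ × Plane → ℝ} (hφ : D.IsSpaceTimeTestFunction φ) :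
    (∫ x, φ (T, x) * ω T x ∂D.measure) - ∫ x, φ (0, x) * ω₀ x ∂D.measure =
      ∫ t in (0 : ℝ)..T, ∫ x, ω t x *
        (deriv (fun s => φ (s, x)) t + fderiv ℝ (fun y => φ (t, y)) x
          (D.carrier.indicator (D.velocityOf k (ω t)) x)) ∂D.measure := by
  have hcC : 0 ≤ velocityConst C₁ C₂ := by unfold velocityConst; positivity
  set v : ℝ → Plane → Plane := fun t => D.carrier.indicator (D.velocityOf k (ω t)) with hv
  have hvm : ∀ t, Measurable (v t) := fun t =>
    hk.measurable_velocity hC₁ hC₂ hA (by positivity) (h.vorticity t)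
  set M := velocityConst C₁ C₂ * (A + Real.exp (c * T) * B) with hM
  have hM0 : 0 ≤ M := by positivity
  have hvM : ∀ t ≤ T, ∀ x, ‖v t x‖ ≤ M := by
    intro t ht x
    by_cases hx : x ∈ D.carrier
    · simp only [hv, indicator_of_mem hx]
      exact hk.norm_velocityOf_le_const hC₁ hC₂ hA (by positivity)
        (h.vorticity_of_le hB hc hT.le ht) hx
    · simp only [hv, indicator_of_notMem hx, norm_zero]; exact hM0
  obtain ⟨G, hG⟩ := hφ.exists_fderiv_bound T
  have hG0 : 0 ≤ G := (norm_nonneg _).trans (hG 0 ⟨le_rfl, hT.le⟩ 0)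
  have hdc := hφ.contDiff.continuous_fderiv one_ne_zero
  set ψ : ℝ → Plane → ℝ := fun t x => fderiv ℝ φ (t, x) (1, v t x) with hψ
  have hψm : ∀ t, Measurable (ψ t) := fun t => by
    have h1 : Continuous fun q : Plane × Plane => fderiv ℝ φ (t, q.1) (1, q.2) :=
      (hdc.comp (by fun_prop : Continuous fun q : Plane × Plane => (t, q.1))).clm_apply
        (by fun_prop)
    exact h1.measurable.comp (measurable_id.prodMk (hvm t))
  have hψb : ∀ t ∈ Icc 0 T, ∀ x, |ψ t x| ≤ G * max 1 M := by
    intro t ht x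
    refine ((fderiv ℝ φ (t, x)).le_opNorm _).trans ?_
    have h1 : ‖((1 : ℝ), v t x)‖ ≤ max 1 M := by
      rw [Prod.norm_mk, norm_one]; exact max_le_max le_rfl (hvM t ht.2 x)
    gcongr
    exact hG t ht x
  have hψp : ∀ t, D.Periodic (ψ t) := by
    intro t x hx l hl
    simp only [hψ, hv, hφ.fderiv_add t x hl, indicator_of_mem hx,
      indicator_of_mem (D.add_mem_carrier hx hl), hk.velocityOf_periodic hx hl]
  set g : ℝ → Plane → ℝ := fun t => D.carrier.indicator fun x => ψ t (Y t x) with hg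
  -- Joint measurability, required by Fubini's theorem, holds because `g` is continuous in time for
  -- fixed `x` and measurable in `x` for fixed time.
  have hgm : Measurable (Function.uncurry g) := by
    refine measurable_uncurry_of_continuous_of_measurable (fun x => ?_) fun t =>
      ((hψm t).comp (h.transport t).measurable).indicator D.measurableSet_carrier
    by_cases hx : x ∈ D.carrier
    · have h1 := h.continuous_velocityOf_comp hk hC₁ hC₂ hA hB hc hω₀ (h.continuous x)
        fun t => (h.transport t).mapsTo x hx
      have h2 := h.continuous x
      simp only [hg, hψ, hv, indicator_of_mem hx, indicator_of_mem ((h.transport _).mapsTo x hx)]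
      exact (hdc.comp (by fun_prop : Continuous fun t => (t, Y t x))).clm_apply (by fun_prop)
    · simp only [hg, indicator_of_notMem hx]; exact continuous_const
  have hgb : ∀ t ∈ Icc 0 T, ∀ x, |g t x| ≤ G * max 1 M := fun t ht x => by
    exact (norm_indicator_le_norm_self (fun x => ψ t (Y t x)) x).trans (hψb t ht _)
  have hrhs : ∀ t ∈ Icc 0 T, ∫ x, ω t x * (deriv (fun s => φ (s, x)) t +
      fderiv ℝ (fun y => φ (t, y)) x (v t x)) ∂D.measure = ∫ x, ω₀ x * g t x ∂D.measure := by
    intro t ht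
    simp only [hφ.deriv_add_fderiv]
    rw [h.push t (ψ t) (hψm t) (hψp t) ⟨_, hψb t ht⟩, restrict_measure_carrier]
    refine integral_congr_ae ?_
    filter_upwards [ae_mem_carrier] with x hx
    simp only [hg, indicator_of_mem hx]
  have hlhs : ∀ t, ∫ x, φ (t, x) * ω t x ∂D.measure = ∫ x, ω₀ x * φ (t, Y t x) ∂D.measure := by
    intro t
    have h1 := h.push t (fun x => φ (t, x)) (hφ.contDiff.continuous.comp (by fun_prop)).measurable
      (fun x _ l hl => hφ.periodic t x l hl) (hφ.exists_bound t)
    rw [restrict_measure_carrier] at h1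
    simpa only [mul_comm] using h1
  have hinit : ∫ x, φ (0, x) * ω₀ x ∂D.measure = ∫ x, ω₀ x * φ (0, Y 0 x) ∂D.measure := by
    simp only [h.initial, mul_comm]
  have hint : ∀ t, Integrable (fun x => ω₀ x * φ (t, Y t x)) D.measure := by
    intro t
    obtain ⟨M', hM'⟩ := hφ.exists_bound t
    exact hω₀.integrable.mul_bdd (c := M') ((hφ.contDiff.continuous.comp (by fun_prop :
      Continuous fun x : Plane => (t, x))).measurable.comp
        (h.transport t).measurable).aestronglyMeasurable (ae_of_all _ fun x => hM' _)
  have hftc : ∀ x ∈ D.carrier, φ (T, Y T x) - φ (0, Y 0 x) = ∫ t in (0 : ℝ)..T, g t x := by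
    intro x hx
    have hder : ∀ t, 0 ≤ t → HasDerivWithinAt (fun s => φ (s, Y s x)) (g t x) (Ici 0) t := by
      intro t ht
      have hd : HasFDerivAt φ (fderiv ℝ φ (t, Y t x)) (t, Y t x) :=
        (hφ.contDiff.differentiable one_ne_zero _).hasFDerivAt
      have h1 := hd.comp_hasDerivWithinAt t ((hasDerivWithinAt_id t _).prodMk (hode x hx t ht))
      simp only [hg, hψ, hv, indicator_of_mem hx, indicator_of_mem ((h.transport _).mapsTo x hx)]
      exact h1
    refine (intervalIntegral.integral_eq_sub_of_hasDerivAt_of_le hT.le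
      (fun t ht => ((hder t ht.1).continuousWithinAt).mono Icc_subset_Ici_self)
      (fun t ht => (hder t ht.1.le).hasDerivAt (Ici_mem_nhds ht.1)) ?_).symm
    refine (intervalIntegrable_iff_integrableOn_Icc_of_le hT.le).2 ?_
    exact Measure.integrableOn_of_bounded (M := G * max 1 M) (by simp)
      (hgm.comp (by fun_prop : Measurable fun t : ℝ => (t, x))).aestronglyMeasurable
      ((ae_restrict_mem measurableSet_Icc).mono fun t ht => hgb t ht x)
  rw [hlhs, hinit, ← integral_sub (hint T) (hint 0)]
  rw [intervalIntegral.integral_congr (g := fun t => ∫ x, ω₀ x * g t x ∂D.measure)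
    fun t ht => hrhs t (by rwa [uIcc_of_le hT.le] at ht)]
  rw [intervalIntegral.integral_of_le hT.le, integral_integral_swap]
  · refine integral_congr_ae ?_
    filter_upwards [ae_mem_carrier] with x hx
    rw [← mul_sub, hftc x hx, intervalIntegral.integral_of_le hT.le, integral_const_mul]
  · refine (hω₀.integrable.comp_snd (volume.restrict (Ioc 0 T))).mul_bdd (c := G * max 1 M)
      hgm.aestronglyMeasurable ?_
    filter_upwards [Measure.quasiMeasurePreserving_fst.ae
      (ae_restrict_mem (μ := volume) (measurableSet_Ioc (a := (0 : ℝ)) (b := T)))] with p hp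
    exact hgb p.1 (Ioc_subset_Icc_self hp) p.2

end
end FluidDomain

end EulerVorticity
end

/-! ### Passage to the limit in the equation for the flow. -/

noncomputable section

namespace EulerVorticity
namespace FluidDomain

variable {D : FluidDomain} {k : Plane → Plane → Plane} {C₁ C₂ A B c : ℝ} {ω₀ : Plane → ℝ}
  {κ N : ℕ → ℝ} {X : ℕ → ℝ → Plane → Plane} {S : ℕ → ℝ → Set Plane} {ω' : ℕ → ℝ → Plane → ℝ}
  {Y : ℝ → Plane → Plane} {ω : ℝ → Plane → ℝ}

lemma IsLimitFlow.exists_isTransportedVorticity {K : (Plane → ℝ) → Plane → Plane} {C : ℝ}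
    (hY : IsLimitFlow D K A B C c ω₀ κ N X S ω' Y) (hC : 0 ≤ C) (hA : 0 ≤ A) (hB : 0 ≤ B)
    (hω₀ : D.IsVorticity A B ω₀) : ∃ ω, D.IsTransportedVorticity A B c ω₀ Y ω := by
  have hcomp : ∀ t, CompressesBy (ENNReal.ofReal (Real.exp (c * max t 0))) D.carrier (Y t) := by
    intro t
    have : Y (max t 0) = Y t := funext (hY.max_zero t)
    rw [← this]
    exact hY.compressesBy hC hA hB (le_max_right _ _)
  obtain ⟨ω, h1, h2, h3⟩ := exists_transported_vorticity (hY.measurable_uncurry hC hA hB)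
    (hY.isTransport hC hA hB) (fun t => ⟨_, (Real.exp_pos _).le, hcomp t⟩) hB hω₀
  refine ⟨ω, hY.isTransport hC hA hB, hY.initial, hcomp, hY.continuous hC hA hB, fun T => ?_, h1,
    fun t => h2 t _ (Real.exp_pos _).le (hcomp t), h3⟩
  refine ⟨velBound C A B c (max T 0) * max T 0, fun t ht x hx => ?_⟩
  have hT : max t 0 ≤ max T 0 := max_le_max ht le_rfl
  have h4 := hY.displacement hC hA hB hx le_rfl (le_max_right t 0) hT
  rw [hY.max_zero, hY.initial, sub_zero] at h4
  have := velBound_nonneg (c := c) hC hA hB (max T 0)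
  exact h4.trans (by gcongr)

/-- At the fixed point `Y s x` the velocities converge by weak convergence of the vorticities.
Evaluating at `X n s x` instead costs an error controlled by the log-Lipschitz modulus, which is
uniform in `n`. -/
lemma IsLimitFlow.tendsto_velocity
    (hY : IsLimitFlow D (fun u => D.carrier.indicator (D.velocityOf k u)) A B
      (velocityConst C₁ C₂) c ω₀ κ N X S ω' Y) (h : D.IsTransportedVorticity A B c ω₀ Y ω)
    (hk : D.KernelEstimates k C₁ C₂) (hC₁ : 0 ≤ C₁) (hC₂ : 0 ≤ C₂) (hA : 0 ≤ A) (hB : 0 ≤ B)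
    (hc : 0 ≤ c) (hω₀ : D.IsVorticity A B ω₀) {x : Plane} (hx : x ∈ D.carrier) {s : ℝ}
    (hs : 0 ≤ s) :
    Tendsto (fun n => D.carrier.indicator (D.velocityOf k (ω' n s)) (X n s x)) atTop
      (𝓝 (D.velocityOf k (ω s) (Y s x))) := by
  have hcC : 0 ≤ velocityConst C₁ C₂ := by unfold velocityConst; positivity
  -- A common sup bound for the limit and for all approximations with `κ n < 1`.
  set B' := Real.exp ((c + 1) * s) * B with hB'
  have hexp : ∀ᶠ n in atTop, Real.exp ((c + κ n) * s) ≤ Real.exp ((c + 1) * s) := by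
    filter_upwards [hY.kappa_tendsto.eventually_lt_const one_pos] with n hn
    gcongr
  have hev : ∀ᶠ n in atTop, D.IsVorticity A B' (ω' n s) := by
    filter_upwards [hexp, hY.time_tendsto.eventually_ge_atTop s] with n h1 h2
    exact ((hY.approx n).vorticity s hs h2).mono (mul_le_mul_of_nonneg_right h1 hB)
  have hexp' : Real.exp (c * s) ≤ Real.exp ((c + 1) * s) := by gcongr; linarith
  have hωs : D.IsVorticity A B' (ω s) :=
    (h.vorticity_of_le hB hc hs le_rfl).mono (mul_le_mul_of_nonneg_right hexp' hB)
  have h1 : Tendsto (fun n => D.velocityOf k (ω' n s) (Y s x)) atTop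
      (𝓝 (D.velocityOf k (ω s) (Y s x))) := by
    refine hk.tendsto_velocityOf hC₁ hA (by positivity) hev hωs (fun φ hφ hφp hφM => ?_)
      ((h.transport s).mapsTo x hx)
    obtain ⟨M, hM⟩ := hφM
    rw [h.push s φ hφ hφp ⟨M, hM⟩]
    obtain ⟨R, hR⟩ := h.displacement s
    have h2 := tendsto_integral_transport hω₀ hB (l := atTop) (S := fun n => S n s)
      (X := fun n => X n s) (Y := Y s) (Λ := Real.exp ((c + 1) * s))
      (R := max R (velBound (velocityConst C₁ C₂) A B c s * s + 1)) ?_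
      ⟨h.transport s, fun E hE => (h.compresses_of_le hc hs le_rfl E hE).trans (by gcongr),
        fun z hz => (hR s le_rfl z hz).trans (le_max_left _ _)⟩
      (fun z hz => ⟨hY.eventually_mem hcC hA hB hz hs, hY.tendsto s hs z hz⟩) hφ hM
    · refine h2.congr' ?_
      filter_upwards [hY.time_tendsto.eventually_ge_atTop s] with n hn
      exact ((hY.approx n).push s hs hn φ hφ hφp ⟨M, hM⟩).symm
    · filter_upwards [hexp, hY.time_tendsto.eventually_ge_atTop s,
        hY.kappa_tendsto.eventually_lt_const one_pos] with n h2 h3 h4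
      refine ⟨(hY.approx n).transport s hs h3,
        fun E hE => ((hY.approx n).compresses s hs h3 E hE).trans (by gcongr), fun z hz => ?_⟩
      have h5 := (hY.approx n).displacement 0 s s le_rfl hs le_rfl h3 z hz
      rw [(hY.approx n).initial, sub_zero] at h5
      exact h5.trans ((by linarith : _ ≤ _).trans (le_max_right _ _))
  have h2 : Tendsto (fun n => D.carrier.indicator (D.velocityOf k (ω' n s)) (X n s x) -
      D.velocityOf k (ω' n s) (Y s x)) atTop (𝓝 0) := by
    refine squeeze_zero_norm' ?_ (tendsto_mul_logLipModulus_norm (velocityConst C₁ C₂ * (A + B'))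
      (hY.tendsto s hs x hx))
    filter_upwards [hev, hY.time_tendsto.eventually_ge_atTop s,
      hY.eventually_mem hcC hA hB hx hs] with n h3 h4 h5
    have h6 := ((hY.approx n).transport s hs h4).mapsTo x h5
    rw [indicator_of_mem h6]
    exact hk.norm_velocityOf_sub_le_norm hC₁ hC₂ hA (by positivity) h3 h6
      ((h.transport s).mapsTo x hx)
  simpa using h2.add h1

/-- Dominated convergence in the approximate integral equation, whose error is a multiple of `ℓ(κ
n)` and tends to `0`. -/
lemma IsLimitFlow.integral_eq
    (hY : IsLimitFlow D (fun u => D.carrier.indicator (D.velocityOf k u)) A B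
      (velocityConst C₁ C₂) c ω₀ κ N X S ω' Y) (h : D.IsTransportedVorticity A B c ω₀ Y ω)
    (hk : D.KernelEstimates k C₁ C₂) (hC₁ : 0 ≤ C₁) (hC₂ : 0 ≤ C₂) (hA : 0 ≤ A) (hB : 0 ≤ B)
    (hc : 0 ≤ c) (hω₀ : D.IsVorticity A B ω₀) {x : Plane} (hx : x ∈ D.carrier) {t : ℝ}
    (ht : 0 ≤ t) : Y t x = x + ∫ s in (0 : ℝ)..t, D.velocityOf k (ω s) (Y s x) := by
  have hcC : 0 ≤ velocityConst C₁ C₂ := by unfold velocityConst; positivity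
  have h1 : Tendsto (fun n => ∫ s in (0 : ℝ)..t,
      D.carrier.indicator (D.velocityOf k (ω' n s)) (X n s x)) atTop
      (𝓝 (∫ s in (0 : ℝ)..t, D.velocityOf k (ω s) (Y s x))) := by
    refine intervalIntegral.tendsto_integral_filter_of_dominated_convergence
      (fun _ => velBound (velocityConst C₁ C₂) A B c t) ?_ ?_ intervalIntegrable_const ?_
    · exact Eventually.of_forall fun n =>
        ((hY.approx n).measurable_velocity x).aestronglyMeasurable
    · filter_upwards [hY.time_tendsto.eventually_ge_atTop t,
        hY.kappa_tendsto.eventually_lt_const one_pos] with n h2 h3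
      refine ae_of_all _ fun s hs => ?_
      rw [uIoc_of_le ht] at hs
      by_cases hX : X n s x ∈ D.carrier
      · rw [indicator_of_mem hX]
        refine (hk.norm_velocityOf_le_const hC₁ hC₂ hA (by positivity)
          ((hY.approx n).vorticity s hs.1.le (hs.2.trans h2)) hX).trans ?_
        have h4 : (c + κ n) * s ≤ (c + 1) * t := by
          have := hs.1.le
          have := hs.2
          gcongr
        unfold velBound
        gcongr
      · rw [indicator_of_notMem hX, norm_zero]
        exact velBound_nonneg hcC hA hB t
    · refine ae_of_all _ fun s hs => ?_
      rw [uIoc_of_le ht] at hs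
      exact hY.tendsto_velocity h hk hC₁ hC₂ hA hB hc hω₀ hx hs.1.le
  have h2 := (((hY.tendsto t ht x hx).sub_const x).sub h1).norm
  have h3 : Tendsto (fun n => (velBound (velocityConst C₁ C₂) A B c t * t + 1) *
      logLipModulus (κ n)) atTop (𝓝 0) := by
    have h4 : Tendsto κ atTop (𝓝[Ici 0] 0) :=
      tendsto_nhdsWithin_iff.2 ⟨hY.kappa_tendsto, Eventually.of_forall hY.kappa_nonneg⟩
    simpa using ((continuousOn_logLipModulus 0 (mem_Ici.2 le_rfl)).tendsto.comp h4).const_mul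
      (velBound (velocityConst C₁ C₂) A B c t * t + 1)
  have h5 : ‖Y t x - x - ∫ s in (0 : ℝ)..t, D.velocityOf k (ω s) (Y s x)‖ ≤ 0 := by
    refine le_of_tendsto_of_tendsto h2 h3 ?_
    filter_upwards [hY.time_tendsto.eventually_ge_atTop t, hY.eventually_mem hcC hA hB hx ht]
      with n h6 h7
    exact (hY.approx n).integral_eq t ht h6 x h7
  have h6 := norm_le_zero_iff.1 h5
  rw [sub_sub, sub_eq_zero] at h6
  exact h6

/-- The velocity along a trajectory is continuous in time, so the integral equation can be
differentiated at every time and not merely almost every time. -/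
lemma IsLimitFlow.hasDerivWithinAt
    (hY : IsLimitFlow D (fun u => D.carrier.indicator (D.velocityOf k u)) A B
      (velocityConst C₁ C₂) c ω₀ κ N X S ω' Y) (h : D.IsTransportedVorticity A B c ω₀ Y ω)
    (hk : D.KernelEstimates k C₁ C₂) (hC₁ : 0 ≤ C₁) (hC₂ : 0 ≤ C₂) (hA : 0 ≤ A) (hB : 0 ≤ B)
    (hc : 0 ≤ c) (hω₀ : D.IsVorticity A B ω₀) {x : Plane} (hx : x ∈ D.carrier) {t : ℝ}
    (ht : 0 ≤ t) :
    HasDerivWithinAt (fun s => Y s x) (D.velocityOf k (ω t) (Y t x)) (Ici 0) t := by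
  have h1 := h.continuous_velocityOf_comp hk hC₁ hC₂ hA hB hc hω₀ (h.continuous x)
    fun t => (h.transport t).mapsTo x hx
  have h2 := (intervalIntegral.integral_hasDerivAt_right (h1.intervalIntegrable 0 t)
    (h1.stronglyMeasurableAtFilter _ _) h1.continuousAt).const_add x
  exact h2.hasDerivWithinAt.congr
    (fun s hs => hY.integral_eq h hk hC₁ hC₂ hA hB hc hω₀ hx hs)
    (hY.integral_eq h hk hC₁ hC₂ hA hB hc hω₀ hx ht)

lemma IsTransportedVorticity.isLagrangianWeakSolution (h : D.IsTransportedVorticity A B c ω₀ Y ω)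
    (hk : D.KernelEstimates k C₁ C₂) (hC₁ : 0 ≤ C₁) (hC₂ : 0 ≤ C₂) (hA : 0 ≤ A) (hB : 0 ≤ B)
    (hc : 0 ≤ c) (hω₀ : D.IsVorticity A B ω₀)
    (hode : ∀ x ∈ D.carrier, ∀ t, 0 ≤ t →
      HasDerivWithinAt (fun s => Y s x) (D.velocityOf k (ω t) (Y t x)) (Ici 0) t) :
    D.IsLagrangianWeakSolution k ∞ ω₀ ω
      fun t => D.carrier.indicator (D.velocityOf k (ω t)) := by
  have hcC : 0 ≤ velocityConst C₁ C₂ := by unfold velocityConst; positivity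
  refine ⟨⟨h.measurable.aestronglyMeasurable, fun t _ => (h.vorticity t).inL1LpUl le_top,
    fun T hT => ?_, fun t _ x hx => indicator_of_mem hx _, ?_,
    fun T hT φ hφ => h.weak_form hk hC₁ hC₂ hA hB hc hω₀ hode hT hφ⟩, Y, ⟨?_, ?_, ?_, ?_, ?_⟩, ?_⟩
  · refine ⟨A.toNNReal + (Real.exp (c * T) * B).toNNReal, fun t ht => ?_⟩
    have h1 := h.vorticity_of_le hB hc hT.le ht.2
    rw [lpUlNorm, if_pos rfl, ENNReal.coe_add]
    exact ⟨h1.eLpNorm_one_le.trans le_self_add, h1.eLpNorm_top_le.trans le_add_self⟩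
  · obtain ⟨V, hV, hVω⟩ := h.exists_continuous_velocity hk hC₁ hC₂ hA hB hc hω₀
    refine ⟨V, fun t _ x => by rw [hVω, indicator_of_mem x.2], fun T hT => ?_⟩
    refine memLp_top_of_bound hV.aestronglyMeasurable
      (velocityConst C₁ C₂ * (A + Real.exp (c * T) * B)) ?_
    filter_upwards [ae_restrict_mem measurableSet_Icc] with t ht
    refine (BoundedContinuousFunction.norm_le (by positivity)).2 fun x => ?_
    rw [hVω]
    exact hk.norm_velocityOf_le_const hC₁ hC₂ hA (by positivity)
      (h.vorticity_of_le hB hc hT.le ht.2) x.2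
  · exact fun t _ x hx => (h.transport t).mapsTo x hx
  · exact fun t _ x hx l hl => (h.transport t).equivariant x hx l hl
  · exact fun t _ => (h.transport t).measurable.comp measurable_subtype_coe
  · exact fun x _ => h.initial x
  · intro x hx t ht
    simp only [indicator_of_mem ((h.transport t).mapsTo x hx)]
    exact hode x hx t ht
  · intro t _ φ hφ hφp hφM
    rw [h.push t φ hφ hφp hφM, restrict_measure_carrier]

end FluidDomain

end EulerVorticity
end


theorem theorem3p3 (C₁ C₂ : ℝ) (hC₁ : 0 < C₁) (hC₂ : 0 < C₂) :
    ∃ C : ℝ, 0 < C ∧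
      ∀ (D : EulerVorticity.FluidDomain)
        (k : EulerVorticity.Plane → EulerVorticity.Plane → EulerVorticity.Plane)
        (p : ℝ≥0∞) (C₃ : ℝ), 2 < p → 0 < C₃ →
        D.KernelEstimates k C₁ C₂ → D.BoundedDivNoFlow k p C₃ →
      ∀ ω₀ : EulerVorticity.Plane → ℝ,
        D.Periodic ω₀ → MemLp ω₀ 1 D.measure → MemLp ω₀ ∞ D.measure →
      ∃ (ω : ℝ → EulerVorticity.Plane → ℝ) (v : ℝ → EulerVorticity.Plane → EulerVorticity.Plane),
        D.IsLagrangianWeakSolution k ∞ ω₀ ω v ∧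
        ∀ T : ℝ, 0 < T → ∀ t ∈ Icc 0 T,
          eLpNorm (ω t) 1 D.measure ≤ eLpNorm ω₀ 1 D.measure ∧
          eLpNorm (ω t) ∞ D.measure ≤
            ENNReal.ofReal (Real.exp (C₃ * T * (eLpNorm ω₀ 1 D.measure).toReal)) *
              eLpNorm ω₀ ∞ D.measure ∧
          (∀ x ∈ D.carrier, ‖v t x‖ ≤
            C * Real.exp (C₃ * T * (eLpNorm ω₀ 1 D.measure).toReal) *
              ((eLpNorm ω₀ 1 D.measure).toReal + (eLpNorm ω₀ ∞ D.measure).toReal)) ∧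
          (∀ x ∈ D.carrier, ∀ y ∈ D.carrier, ‖v t x - v t y‖ ≤
            C * Real.exp (C₃ * T * (eLpNorm ω₀ 1 D.measure).toReal) *
              ((eLpNorm ω₀ 1 D.measure).toReal + (eLpNorm ω₀ ∞ D.measure).toReal) *
              EulerVorticity.logLipModulus (D.distance x y)) := by
  open EulerVorticity EulerVorticity.FluidDomain in
  have hcC : 0 < velocityConst C₁ C₂ := by unfold velocityConst; positivity
  refine ⟨velocityConst C₁ C₂, hcC, fun D k p C₃ hp hC₃ hk hdiv ω₀ hper h1 h2 => ?_⟩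
  have hω₀ := isVorticity_of_memLp hper h1 h2
  set A := (eLpNorm ω₀ 1 D.measure).toReal with hAdef
  set B := (eLpNorm ω₀ ∞ D.measure).toReal with hBdef
  have hA : 0 ≤ A := ENNReal.toReal_nonneg
  have hB : 0 ≤ B := ENNReal.toReal_nonneg
  -- The divergence bound `c = C₃ A` is the same for all times because transport does not increase
  -- the `L¹` norm.
  have hc : 0 ≤ C₃ * A := by positivity
  have hp1 : 1 ≤ p := (by norm_num : (1 : ℝ≥0∞) ≤ 2).trans hp.le
  obtain ⟨κ, N, X, S, ω', Y, hY⟩ := exists_isLimitFlow hcC.le hA hB hc hω₀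
    (K := fun u => D.carrier.indicator (D.velocityOf k u))
    fun B' ω hB' hω => hk.isAdmissible hdiv hp1 hC₁.le hC₂.le hC₃.le hA hB' hω
  obtain ⟨ω, hω⟩ := hY.exists_isTransportedVorticity hcC.le hA hB hω₀
  refine ⟨ω, fun t => D.carrier.indicator (D.velocityOf k (ω t)),
    hω.isLagrangianWeakSolution hk hC₁.le hC₂.le hA hB hc hω₀ fun x hx t ht =>
      hY.hasDerivWithinAt hω hk hC₁.le hC₂.le hA hB hc hω₀ hx ht, fun T hT t ht => ?_⟩
  have hωt := hω.vorticity_of_le hB hc hT.le ht.2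
  have hexp : C₃ * A * T = C₃ * T * A := by ring
  rw [hexp] at hωt
  -- Only the sup norm grows with time; the exponential is put in front of the `L¹` norm as well,
  -- which is harmless since it is at least `1`.
  have hE : velocityConst C₁ C₂ * (A + Real.exp (C₃ * T * A) * B) ≤
      velocityConst C₁ C₂ * Real.exp (C₃ * T * A) * (A + B) := by
    have h3 : 1 ≤ Real.exp (C₃ * T * A) := Real.one_le_exp (by positivity)
    rw [mul_assoc (velocityConst C₁ C₂), mul_add (Real.exp _)]
    gcongr
    exact le_mul_of_one_le_left hA h3
  have hB' : 0 ≤ Real.exp (C₃ * T * A) * B := by positivity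
  refine ⟨hωt.eLpNorm_one_le.trans_eq (ENNReal.ofReal_toReal h1.2.ne), ?_, fun x hx => ?_,
    fun x hx y hy => ?_⟩
  · refine hωt.eLpNorm_top_le.trans_eq ?_
    rw [ENNReal.ofReal_mul (Real.exp_pos _).le, hBdef, ENNReal.ofReal_toReal h2.2.ne]
  · simp only [indicator_of_mem hx]
    exact (hk.norm_velocityOf_le_const hC₁.le hC₂.le hA hB' hωt hx).trans hE
  · simp only [indicator_of_mem hx, indicator_of_mem hy]
    refine (hk.norm_velocityOf_sub_le hC₁.le hC₂.le hA hB' hωt hx hy).trans ?_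
    have := logLipModulus_nonneg (D.distance_nonneg x y)
    gcongr
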